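/- Conventions. A Riemann domain $(X,p)$ over a complex Banach space $E$ is a Hausdorff space $X$ with a local homeomorphism $p:X\to E$; an open set $U\subset E$ is a Riemann domain with the inclusion. For $x\in X$, $\mathrm{dist}_X(x)$ is the supremum of the $r>0$ such that $p$ maps some neighbourhood of $x$ homeomorphically onto the open ball $B(p(x),r)$ (for open $U\subset E$ this is the distance to $E\setminus U$). A set $A\subset X$ is $X$-bounded if $p(A)$ is bounded and $\inf_{x\in A}\mathrm{dist}_X(x)>0$; a function is of bounded type if it is bounded on every $X$-bounded set; $H(X)$ is the set of holomorphic functions $X\to\mathbb C$, and $H_b(X)$ is the algebra of those of bounded type, with the topology of uniform convergence on $X$-bounded sets. A morphism $\tau:(X,p)\to(Y,q)$ is a continuous map with $q\circ\tau=p$. It is an $H_b$-extension (resp. $H_b$-$H_b$-extension) if for every $f\in H_b(X)$ there is a unique $\tilde f\in H(Y)$ (resp. $\tilde f\in H_b(Y)$) with $\tilde f\circ\tau=f$; it is an $H_b$-envelope (resp. $H_b$-$H_b$-envelope) of $X$ if moreover for each $H_b$-extension (resp. $H_b$-$H_b$-extension) $\nu:X\to Z$ there is a morphism $\mu:Z\to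 Y$ with $\mu\circ\nu=\tau$. For $U\subset E$ open put $U_n=\{x\in U:\|x\|\le n,\ d(x,E\setminus U)\ge 1/n\}$ and $$\widehat U_{\mathcal P(E)}=\bigcup_{n\ge1}\{x\in E:\ |P(x)|\le\sup_{U_n}|P|\ \text{for every continuous polynomial } P \text{ on } E\}.$$ Let $M_b(U)$ be the set of nonzero continuous multiplicative linear functionals on $H_b(U)$, and $\pi:M_b(U)\to E''$, $\pi(\varphi)(\gamma)=\varphi(\gamma|_U)$ for $\gamma\in E'$. For $\varphi\in M_b(U)$ and $z\in E''$ of small norm let $\varphi^z\in M_b(U)$ be given by $\varphi^z(f)=\sum_{n\ge0}\varphi\big(x\mapsto \overline{d^nf(x)/n!}\,(z)\big)$, where $\overline P$ is the Aron–Berner extension to $E''$ of a continuous homogeneous polynomial $P$. The sets $\{\varphi^z:\|z\|<\varepsilon\}$, $\varepsilon>0$ small, are the basic neighbourhoods of $\varphi$; for symmetrically regular $E$ (e.g. $E=c_0$) this makes $(M_b(U),\pi)$ a Riemann domain over $E''$. The canonical extension of $f\in H_b(U)$ to $M_b(U)$ is $\varphi\mapsto\varphi(f)$. Theorem. There is a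 balanced open set $U\subset c_0$ such that $\widehat U_{\mathcal P(c_0)}$ is an open set containing $U$, the inclusion $U\hookrightarrow\widehat U_{\mathcal P(c_0)}$ is the $H_b$-envelope of $U$, and, for some $g\in H_b(U)$: 1. the (unique) holomorphic extension of $g$ to $\widehat U_{\mathcal P(c_0)}$ is not of bounded type (so the answer to Hirschowitz's 1972 question, whether the extension of every function of bounded type to the $H_b$-envelope is of bounded type, is negative); 2. the canonical extension of $g$ to the spectrum $M_b(U)$ is not of bounded type. Moreover, $U$ has no $H_b$-$H_b$-envelope. -/

import Mathlib

open scoped ENNReal Topology ZeroAtInfty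

universe u v w

noncomputable section

namespace BoundedType

/-! ### Riemann domains spread over a normed space and functions of bounded type -/

section RiemannDomains

variable {E : Type*} [NormedAddCommGroup E] [NormedSpace ℂ E]
variable {X : Type*} [TopologicalSpace X] {Y : Type*} [TopologicalSpace Y]

/-- `(X, p)` is a Riemann domain spread over `E`: `X` is a Hausdorff space and `p : X → E` is a
local homeomorphism. An open set `U ⊆ E` is the Riemann domain `(U, Subtype.val)`. -/
structure IsRiemannDomain (p : X → E) : Prop where
  t2 : T2Space X
  isLocalHomeomorph : IsLocalHomeomorph p

/-- `dist_X(x)`: the supremum of the radii `r > 0` such that some neighbourhood of `x` is mapped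
homeomorphically by `p` onto the open ball `B(p x, r)`. For an open set of `E` this is the
distance of `x` to the complement. -/
def distTo (p : X → E) (x : X) : ℝ≥0∞ :=
  ⨆ (r : ℝ) (_ : 0 < r ∧ ∃ e : OpenPartialHomeomorph X E,
    x ∈ e.source ∧ e.target = Metric.ball (p x) r ∧ Set.EqOn e p e.source), ENNReal.ofReal r

/-- `A` is `X`-bounded: `p(A)` is bounded and `dist_X(A) = inf_{x ∈ A} dist_X(x)` is positive. -/
def IsDomainBounded (p : X → E) (A : Set X) : Prop :=
  Bornology.IsBounded (p '' A) ∧ 0 < ⨅ x ∈ A, distTo p x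

/-- `f` is bounded on every `X`-bounded set. -/
def IsBoundedType (p : X → E) (f : X → ℂ) : Prop :=
  ∀ A : Set X, IsDomainBounded p A → Bornology.IsBounded (f '' A)

/-- `f ∈ H(X)`: read in the local charts given by `p`, the function `f` has a convergent power
series expansion about each point. -/
def IsHolomorphic (p : X → E) (f : X → ℂ) : Prop :=
  ∀ x : X, ∃ F : E → ℂ, AnalyticAt ℂ F (p x) ∧ f =ᶠ[𝓝 x] F ∘ p

/-- The algebra `H_b(X)` of holomorphic functions of bounded type. -/
def Hb (p : X → E) : Subalgebra ℂ (X → ℂ) where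
  carrier := {f | IsHolomorphic p f ∧ IsBoundedType p f}
  mul_mem' := by
    rintro f g ⟨hf, hf'⟩ ⟨hg, hg'⟩
    refine ⟨fun x => ?_, fun A hA => ?_⟩
    · obtain ⟨F, hF, hFf⟩ := hf x
      obtain ⟨G, hG, hGg⟩ := hg x
      exact ⟨F * G, hF.mul hG, hFf.mul hGg⟩
    · obtain ⟨C, hC⟩ := isBounded_iff_forall_norm_le.1 (hf' A hA)
      obtain ⟨D, hD⟩ := isBounded_iff_forall_norm_le.1 (hg' A hA)
      refine isBounded_iff_forall_norm_le.2 ⟨C * D, ?_⟩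
      rintro _ ⟨x, hx, rfl⟩
      have h1 := hC _ ⟨x, hx, rfl⟩
      have h2 := hD _ ⟨x, hx, rfl⟩
      simpa using mul_le_mul h1 h2 (norm_nonneg _) ((norm_nonneg _).trans h1)
  add_mem' := by
    rintro f g ⟨hf, hf'⟩ ⟨hg, hg'⟩
    refine ⟨fun x => ?_, fun A hA => ?_⟩
    · obtain ⟨F, hF, hFf⟩ := hf x
      obtain ⟨G, hG, hGg⟩ := hg x
      exact ⟨F + G, hF.add hG, hFf.add hGg⟩
    · obtain ⟨C, hC⟩ := isBounded_iff_forall_norm_le.1 (hf' A hA)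
      obtain ⟨D, hD⟩ := isBounded_iff_forall_norm_le.1 (hg' A hA)
      refine isBounded_iff_forall_norm_le.2 ⟨C + D, ?_⟩
      rintro _ ⟨x, hx, rfl⟩
      have h1 := hC _ ⟨x, hx, rfl⟩
      have h2 := hD _ ⟨x, hx, rfl⟩
      exact (norm_add_le _ _).trans (add_le_add h1 h2)
  algebraMap_mem' := by
    intro c
    refine ⟨fun x => ⟨fun _ => c, analyticAt_const, Filter.Eventually.of_forall fun _ => rfl⟩,
      fun A _ => isBounded_iff_forall_norm_le.2 ⟨‖c‖, ?_⟩⟩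
    rintro _ ⟨x, -, rfl⟩
    exact le_rfl

/-- The topology of `H_b(X)`: uniform convergence on `X`-bounded sets. -/
abbrev hbTopology (p : X → E) : TopologicalSpace (Hb p) :=
  .induced (fun f => UniformOnFun.ofFun {A : Set X | IsDomainBounded p A} (f : X → ℂ))
    inferInstance

/-- Morphisms of Riemann domains over `E`. -/
structure IsMorphism (p : X → E) (q : Y → E) (τ : X → Y) : Prop where
  continuous : Continuous τ
  comp_eq : q ∘ τ = p

/-- `τ : X → Y` is an `F`-`G`-extension: it is a morphism of Riemann domains and every `f ∈ F`
factors as `f̃ ∘ τ = f` for a unique `f̃ ∈ G`. -/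
def IsExtension (p : X → E) (F : Set (X → ℂ)) (q : Y → E) (G : Set (Y → ℂ)) (τ : X → Y) : Prop :=
  IsRiemannDomain p ∧ IsRiemannDomain q ∧ IsMorphism p q τ ∧
    ∀ f ∈ F, ∃! f' : Y → ℂ, f' ∈ G ∧ f' ∘ τ = f

/-- `H_b`-extension: functions in `H_b(X)` extend uniquely to functions in `H(Y)`. -/
def IsHbExtension (p : X → E) (q : Y → E) (τ : X → Y) : Prop :=
  IsExtension p (Hb p : Set (X → ℂ)) q {f | IsHolomorphic q f} τ

/-- `H_b`-`H_b`-extension: functions in `H_b(X)` extend uniquely to functions in `H_b(Y)`. -/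
def IsHbHbExtension (p : X → E) (q : Y → E) (τ : X → Y) : Prop :=
  IsExtension p (Hb p : Set (X → ℂ)) q (Hb q : Set (Y → ℂ)) τ

end RiemannDomains

section Envelopes

universe e x y z

variable {E : Type e} [NormedAddCommGroup E] [NormedSpace ℂ E]
variable {X : Type x} [TopologicalSpace X] {Y : Type y} [TopologicalSpace Y]

/-- `τ : X → Y` is the `H_b`-envelope of holomorphy of `X`: the largest `H_b`-extension. -/
def IsHbEnvelope (p : X → E) (q : Y → E) (τ : X → Y) : Prop :=
  IsHbExtension p q τ ∧
    ∀ (Z : Type z) [TopologicalSpace Z] (r : Z → E) (ν : X → Z), IsHbExtension p r ν →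
      ∃ μ : Z → Y, IsMorphism r q μ ∧ μ ∘ ν = τ

/-- `τ : X → Y` is the `H_b`-`H_b`-envelope of holomorphy of `X`: the largest
`H_b`-`H_b`-extension. -/
def IsHbHbEnvelope (p : X → E) (q : Y → E) (τ : X → Y) : Prop :=
  IsHbHbExtension p q τ ∧
    ∀ (Z : Type z) [TopologicalSpace Z] (r : Z → E) (ν : X → Z), IsHbHbExtension p r ν →
      ∃ μ : Z → Y, IsMorphism r q μ ∧ μ ∘ ν = τ

end Envelopes

/-! ### Open subsets of a normed space: polynomial hulls and the spectrum of `H_b(U)` -/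

section OpenSets

variable {E : Type*} [NormedAddCommGroup E] [NormedSpace ℂ E]

/-- `P ∈ 𝒫(E)`: `P` is a finite sum of continuous homogeneous polynomials. -/
def IsContinuousPolynomial (P : E → ℂ) : Prop :=
  ∃ (N : ℕ) (c : (n : ℕ) → E [×n]→L[ℂ] ℂ), ∀ x, P x = ∑ n ∈ Finset.range N, c n fun _ => x

/-- The polynomial hull of `A`: the points `x` with `|P(x)| ≤ sup_A |P|` for all `P ∈ 𝒫(E)`. -/
def polyHull (A : Set E) : Set E :=
  {x | ∀ P : E → ℂ, IsContinuousPolynomial P → ‖P x‖ₑ ≤ ⨆ a ∈ A, ‖P a‖ₑ}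

/-- `U_n = {x ∈ U : ‖x‖ ≤ n and d(x, E ∖ U) ≥ 1/n}` for `n ≥ 1`. -/
def exhaustion (U : Set E) (n : ℕ) : Set E :=
  {x | x ∈ U ∧ ‖x‖ ≤ n ∧ ENNReal.ofReal (1 / n) ≤ Metric.infEDist x Uᶜ}

/-- `Û_𝒫`, the union over `n ≥ 1` of the polynomial hulls of the sets `U_n`. -/
def hullUnion (U : Set E) : Set E :=
  {x | ∃ n : ℕ, 1 ≤ n ∧ x ∈ polyHull (exhaustion U n)}

/-- The spectrum `M_b(U)`: the nonzero (equivalently, unital) continuous multiplicative linear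
functionals on `H_b(U)`. -/
structure Spectrum (U : Set E) where
  /-- the functional -/
  toAlgHom : Hb (Subtype.val : U → E) →ₐ[ℂ] ℂ
  continuous : Continuous[hbTopology Subtype.val, inferInstance] toAlgHom

/-- The canonical extension (Gelfand transform) of `f ∈ H_b(U)` to the spectrum. -/
def gelfand {U : Set E} (f : Hb (Subtype.val : U → E)) (φ : Spectrum U) : ℂ := φ.toAlgHom f

/-- Restriction of a continuous linear functional to a Riemann domain. -/
def restrictDual {X : Type*} [TopologicalSpace X] (p : X → E) (γ : StrongDual ℂ E) : Hb p :=
  ⟨γ ∘ p, fun x => ⟨γ, γ.analyticAt (p x), Filter.Eventually.of_forall fun _ => rfl⟩, fun A hA => by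
    rw [Set.image_comp]
    exact γ.lipschitz.isBounded_image hA.1⟩

theorem continuous_restrictDual {X : Type*} [TopologicalSpace X] (p : X → E) :
    Continuous[inferInstance, hbTopology p] (restrictDual p) := by
  refine continuous_induced_rng.2 (continuous_iff_continuousAt.2 fun γ₀ => ?_)
  refine UniformOnFun.tendsto_iff_tendstoUniformlyOn.2 fun A hA => ?_
  refine Metric.tendstoUniformlyOn_iff.2 fun ε hε => ?_
  obtain ⟨C, hC0, hC⟩ := hA.1.exists_pos_norm_le
  filter_upwards [Metric.ball_mem_nhds γ₀ (div_pos hε hC0)] with γ hγ a ha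
  have h1 : ‖γ₀ - γ‖ < ε / C := by simpa [dist_comm, dist_eq_norm] using hγ
  have h2 : ‖p a‖ ≤ C := hC _ ⟨a, ha, rfl⟩
  calc dist (γ₀ (p a)) (γ (p a)) = ‖(γ₀ - γ) (p a)‖ := by simp [dist_eq_norm]
    _ ≤ ‖γ₀ - γ‖ * ‖p a‖ := (γ₀ - γ).le_opNorm _
    _ ≤ ‖γ₀ - γ‖ * C := by gcongr
    _ < ε / C * C := by gcongr
    _ = ε := by field_simp

/-- The projection `π : M_b(U) → E''`, `π(φ)(γ) = φ(γ|_U)`. -/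
def proj (U : Set E) (φ : Spectrum U) : StrongDual ℂ (StrongDual ℂ E) where
  toFun γ := φ.toAlgHom (restrictDual Subtype.val γ)
  map_add' γ γ' := by
    rw [← map_add]
    rfl
  map_smul' c γ := by
    rw [RingHom.id_apply, ← map_smul]
    rfl
  cont := @Continuous.comp _ _ _ _ (hbTopology Subtype.val) _ _ _ φ.continuous
    (continuous_restrictDual _)

/-- The Aron–Berner extension to the bidual, obtained one variable at a time:
`aronBerner n z A` is the value at `(z 0, …, z (n - 1)) ∈ (E'')ⁿ` of the canonical extension of the
`n`-linear form `A`, so that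
`Ā(z 0, …, z n) = z 0 (x ↦ (A(x, ·))‾(z 1, …, z n))`. -/
def aronBerner : (n : ℕ) → (Fin n → StrongDual ℂ (StrongDual ℂ E)) →
    (E [×n]→L[ℂ] ℂ) →L[ℂ] ℂ
  | 0, _ => ContinuousMultilinearMap.apply ℂ (fun _ : Fin 0 => E) ℂ 0
  | n + 1, z => (z 0).comp
      ((ContinuousLinearMap.compL ℂ E (E [×n]→L[ℂ] ℂ) ℂ (aronBerner n (Fin.tail z))).comp
        (continuousMultilinearCurryLeftEquiv ℂ (fun _ : Fin (n + 1) => E)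
          ℂ).toContinuousLinearEquiv.toContinuousLinearMap)

/-- `ψ = φ^z`, the translate of `φ ∈ M_b(U)` by `z ∈ E''`: for every `f ∈ H_b(U)`,
`ψ(f) = ∑ₙ φ(x ↦ P̄ₙ,ₓ(z))`, where `P̄ₙ,ₓ` is the Aron–Berner extension of the `n`-th Taylor
polynomial `dⁿf(x)/n!` of `f` at `x ∈ U`. (The values outside `U` of the extension by zero of `f`
are irrelevant, as `U` is open.) -/
def IsTranslate {U : Set E} (z : StrongDual ℂ (StrongDual ℂ E)) (φ ψ : Spectrum U) : Prop :=
  ∀ f : Hb (Subtype.val : U → E), ∃ P : ℕ → Hb (Subtype.val : U → E),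
    (∀ (n : ℕ) (x : U), (P n : U → ℂ) x = (n.factorial : ℂ)⁻¹ *
      aronBerner n (fun _ => z) (iteratedFDeriv ℂ n (Function.extend Subtype.val (f : U → ℂ) 0) x)) ∧
    HasSum (fun n => φ.toAlgHom (P n)) (ψ.toAlgHom f)

/-- The topology of `M_b(U)` in which the sets `{φ^z : z ∈ E'', ‖z‖ < ε}`, `ε > 0` small, form a
base of neighbourhoods of `φ`. For symmetrically regular `E` and open `U` it makes
`π : M_b(U) → E''` a Riemann domain over `E''`. -/
instance (U : Set E) : TopologicalSpace (Spectrum U) where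
  IsOpen S := ∀ φ ∈ S, ∃ ε > 0, ∀ z : StrongDual ℂ (StrongDual ℂ E), ‖z‖ < ε →
    ∀ ψ : Spectrum U, IsTranslate z φ ψ → ψ ∈ S
  isOpen_univ := fun _ _ => ⟨1, one_pos, fun _ _ _ _ => Set.mem_univ _⟩
  isOpen_inter := by
    rintro S T hS hT φ ⟨hφS, hφT⟩
    obtain ⟨ε, hε, h⟩ := hS φ hφS
    obtain ⟨ε', hε', h'⟩ := hT φ hφT
    exact ⟨min ε ε', lt_min hε hε', fun z hz ψ hψ =>
      ⟨h z (hz.trans_le (min_le_left _ _)) ψ hψ, h' z (hz.trans_le (min_le_right _ _)) ψ hψ⟩⟩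
  isOpen_sUnion := by
    rintro 𝒮 h𝒮 φ ⟨S, hS, hφ⟩
    obtain ⟨ε, hε, h⟩ := h𝒮 S hS φ hφ
    exact ⟨ε, hε, fun z hz ψ hψ => ⟨S, hS, h z hz ψ hψ⟩⟩

end OpenSets

end BoundedType

end

/-! The set `U` is the open unit ball of c₀ together with, for each `k`, a spike: a polydisc of
radius `k + 4` in the `k`-th coordinate and `1 / (k + 4)` in the others. The spikes get thinner, so
a set at distance at least `δ` from the complement of `U` enters only finitely many of them beyond
the ball: its far coordinates are at most `1 - δ / 2` (`norm_coord_le_of_ball_subset`). Hence `g(x)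
= ∑ xₖ ^ (k + 1)` is of bounded type on `U`. Polynomial hulls fatten each spike: by the maximum
principle on an annulus joining the ball to the `k`-th spike, the polydisc of radii `2` and `1 / 4`
lies in the hull of a single `U_m`, with `m` depending on `k` (`polydisc_subset_polyHull`). So the
points `(3/2) eₖ` lie in the union of the hulls, uniformly far from its complement, while `g` takes
there the unbounded values `(3/2) ^ (k + 1)`.

For balanced `U` the union of the hulls is the envelope. Taylor series at `0` converge geometrically
on each `U_m`; their terms are polynomials, so the same estimate holds on the hull
(`norm_taylorZero_le`). Maximality comes from Banach–Steinhaus: near a point outside the union, some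
function of bounded type is unbounded along any given sequence converging to that point
(`exists_unbounded_along`).

There is no `H_b`-`H_b`-envelope, because adjoining just one fat polydisc to `U` is an
`H_b`-`H_b`-extension for each `k`. An envelope would receive all of these at once, and the
extension of `g` would be unbounded on a domain-bounded sequence.

For the spectrum, a whole ball of c₀'' about each `(3/2) eₖ` has to be lifted to `M_b(U)`.
Evaluation at a bidual point is defined as the limit along its coordinate truncations. This works
because every continuous multilinear form on c₀ is the norm limit of its truncations
(`tendsto_compContinuousLinearMap_trunc`), which in turn holds because spaces of such forms contain
no copy of c₀ (`omitsNullSeq_multilinear`). The lifted points have distance at least `1 / 8`, and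
`g` is unbounded on them. -/

set_option linter.unusedSectionVars false

noncomputable section

namespace BoundedType

open Filter

/-! ### The space `c₀` and its truncations -/

section NullSequences

/-- `E` is isometric to `c₀`: it has coordinate functionals and unit vectors with respect to which
its norm is the supremum norm and its elements are null sequences. -/
class NullSequenceSpace (E : Type*) [NormedAddCommGroup E] [NormedSpace ℂ E] where
  /-- the coordinate functionals -/
  coord : ℕ → E →L[ℂ] ℂ
  /-- the unit vectors -/
  unitVec : ℕ → E
  coord_unitVec : ∀ j k, coord j (unitVec k) = if j = k then 1 else 0
  norm_le_iff : ∀ {x : E} {C : ℝ}, 0 ≤ C → (‖x‖ ≤ C ↔ ∀ k, ‖coord k x‖ ≤ C)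
  tendsto_coord : ∀ x : E, Tendsto (fun k => coord k x) atTop (𝓝 0)

instance : NullSequenceSpace C₀(ℕ, ℂ) where
  coord k := LinearMap.mkContinuous
    { toFun := fun x => x k, map_add' := fun _ _ => rfl, map_smul' := fun _ _ => rfl } 1
    fun x => by simpa using x.toBCF.norm_coe_le_norm k
  unitVec k :=
    { toFun := Pi.single k 1
      continuous_toFun := continuous_of_discreteTopology
      zero_at_infty' := by
        rw [cocompact_eq_cofinite, Nat.cofinite_eq_atTop]
        refine tendsto_const_nhds.congr' ?_
        filter_upwards [eventually_gt_atTop k] with j hj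
        simp [hj.ne'] }
  coord_unitVec j k := by
    change (Pi.single k 1 : ℕ → ℂ) j = _
    simp [Pi.single_apply]
  norm_le_iff {x _} hC := BoundedContinuousFunction.norm_le (f := x.toBCF) hC
  tendsto_coord x := by
    have := x.zero_at_infty'
    rwa [cocompact_eq_cofinite, Nat.cofinite_eq_atTop] at this

namespace NullSequenceSpace

variable {E : Type*} [NormedAddCommGroup E] [NormedSpace ℂ E] [NullSequenceSpace E]

theorem norm_coord_apply_le (k : ℕ) (x : E) : ‖coord k x‖ ≤ ‖x‖ :=
  (norm_le_iff (norm_nonneg _)).1 le_rfl k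

theorem ext_coord {x y : E} (h : ∀ k, coord k x = coord k y) : x = y := by
  rw [← sub_eq_zero, ← norm_le_zero_iff, norm_le_iff le_rfl]
  simp [h]

theorem norm_coord_le (k : ℕ) : ‖(coord k : E →L[ℂ] ℂ)‖ ≤ 1 :=
  ContinuousLinearMap.opNorm_le_bound _ zero_le_one fun x => by
    simpa using norm_coord_apply_le k x

/-- The projection onto the first `N` coordinates. -/
def trunc (N : ℕ) : E →L[ℂ] E :=
  ∑ k ∈ Finset.range N, (coord k).smulRight (unitVec k)

theorem coord_sum_smul_unitVec (N : ℕ) (a : ℕ → ℂ) (j : ℕ) :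
    coord j (∑ k ∈ Finset.range N, a k • unitVec k : E) = if j < N then a j else 0 := by
  rw [map_sum]
  simp [coord_unitVec]

theorem trunc_eq_sum (N : ℕ) (x : E) :
    trunc N x = ∑ k ∈ Finset.range N, coord k x • unitVec k := by
  simp [trunc]

theorem coord_trunc (N : ℕ) (x : E) (j : ℕ) :
    coord j (trunc N x) = if j < N then coord j x else 0 := by
  rw [trunc_eq_sum, coord_sum_smul_unitVec]

theorem norm_trunc_apply_le (N : ℕ) (x : E) : ‖trunc N x‖ ≤ ‖x‖ := by
  refine (norm_le_iff (norm_nonneg _)).2 fun j => ?_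
  rw [coord_trunc]
  split_ifs
  · exact norm_coord_apply_le j x
  · simp

theorem norm_trunc_le (N : ℕ) : ‖(trunc N : E →L[ℂ] E)‖ ≤ 1 :=
  ContinuousLinearMap.opNorm_le_bound _ zero_le_one fun x => by
    simpa using norm_trunc_apply_le N x

theorem trunc_trunc {M N : ℕ} (h : M ≤ N) (x : E) : trunc M (trunc N x) = trunc M x := by
  refine ext_coord fun j => ?_
  simp only [coord_trunc]
  split_ifs <;> first | rfl | omega

theorem tendsto_trunc (x : E) : Tendsto (fun N => trunc N x) atTop (𝓝 x) := by
  refine Metric.tendsto_atTop.2 fun ε hε => ?_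
  obtain ⟨N, hN⟩ := Metric.tendsto_atTop.1 (tendsto_coord x) (ε / 2) (half_pos hε)
  refine ⟨N, fun M hM => ?_⟩
  rw [dist_eq_norm]
  refine lt_of_le_of_lt ((norm_le_iff (half_pos hε).le).2 fun j => ?_) (half_lt_self hε)
  rw [map_sub, coord_trunc]
  split_ifs with h
  · simpa using (half_pos hε).le
  · have := hN j (by omega)
    simpa using this.le

/-- The blocks have disjoint supports `[N i, N (i + 1))`, so every coordinate sees at most one
summand. This is the source of unconditionally bounded sequences in c₀. -/
theorem norm_sum_blocks_le {N : ℕ → ℕ} (hN : StrictMono N) {x : ℕ → E}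
    (hx : ∀ i, ‖x i‖ ≤ 1) (s : Finset ℕ) {α : ℕ → ℂ} (hα : ∀ i, ‖α i‖ ≤ 1) :
    ‖∑ i ∈ s, α i • (trunc (N (i + 1)) (x i) - trunc (N i) (x i))‖ ≤ 1 := by
  refine (norm_le_iff zero_le_one).2 fun j => ?_
  have key : ∀ i, coord j (trunc (N (i + 1)) (x i) - trunc (N i) (x i)) =
      if N i ≤ j ∧ j < N (i + 1) then coord j (x i) else 0 := fun i => by
    have : N i < N (i + 1) := hN (Nat.lt_succ_self i)
    rw [map_sub, coord_trunc, coord_trunc]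
    split_ifs <;> first | omega | simp
  rw [map_sum]
  simp only [map_smul, key, smul_eq_mul]
  by_cases h : ∃ i ∈ s, N i ≤ j ∧ j < N (i + 1)
  · obtain ⟨i, his, hi⟩ := h
    rw [Finset.sum_eq_single_of_mem i his, if_pos hi]
    · rw [norm_mul]
      exact mul_le_one₀ (hα i) (norm_nonneg _) ((norm_coord_apply_le _ _).trans (hx i))
    · intro l _ hl
      rw [if_neg, mul_zero]
      rintro ⟨h1, h2⟩
      rcases lt_or_gt_of_ne hl with h | h
      · have : N (l + 1) ≤ N i := hN.monotone h
        omega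
      · have : N (i + 1) ≤ N l := hN.monotone h
        omega
  · push Not at h
    rw [Finset.sum_eq_zero]
    · simp
    · intro i hi
      rw [if_neg, mul_zero]
      rintro ⟨h1, h2⟩
      exact absurd h2 (not_lt.2 (h i hi h1))

end NullSequenceSpace

/-! ### Weakly unconditionally Cauchy sequences -/

/-- All finite sums `∑ αᵢ vᵢ` with `|αᵢ| ≤ 1` are bounded by `C`. -/
def UnconditionallyBounded {X : Type*} [NormedAddCommGroup X] [NormedSpace ℂ X] (C : ℝ)
    (v : ℕ → X) : Prop :=
  ∀ (s : Finset ℕ) (α : ℕ → ℂ), (∀ i, ‖α i‖ ≤ 1) → ‖∑ i ∈ s, α i • v i‖ ≤ C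

/-- Every weakly unconditionally Cauchy series in `X` has terms tending to `0`; by Bessaga and
Pełczyński this means that `X` contains no copy of `c₀`. -/
def OmitsNullSeq (X : Type*) [NormedAddCommGroup X] [NormedSpace ℂ X] : Prop :=
  ∀ (C : ℝ) (v : ℕ → X), UnconditionallyBounded C v → Tendsto v atTop (𝓝 0)

section

variable {X : Type*} [NormedAddCommGroup X] [NormedSpace ℂ X]
variable {Y : Type*} [NormedAddCommGroup Y] [NormedSpace ℂ Y]

theorem UnconditionallyBounded.comp_injective {C : ℝ} {v : ℕ → X} (h : UnconditionallyBounded C v)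
    {φ : ℕ → ℕ} (hφ : Function.Injective φ) : UnconditionallyBounded C (v ∘ φ) := by
  intro s α hα
  have := h (s.image φ) (fun j => α (Function.invFun φ j)) fun j => hα _
  rw [Finset.sum_image fun _ _ _ _ h => hφ h] at this
  simpa only [Function.leftInverse_invFun hφ _, Function.comp_apply] using this

theorem UnconditionallyBounded.map {C : ℝ} {v : ℕ → X} (h : UnconditionallyBounded C v)
    (T : X →L[ℂ] Y) : UnconditionallyBounded (‖T‖ * C) (fun i => T (v i)) := by
  intro s α hα
  have : ∑ i ∈ s, α i • T (v i) = T (∑ i ∈ s, α i • v i) := by simp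
  rw [this]
  exact (T.le_opNorm _).trans (mul_le_mul_of_nonneg_left (h s α hα) (norm_nonneg _))

/-- Choosing `α i` to be the conjugate phase of `v i` turns the hypothesis into absolute
summability. -/
theorem omitsNullSeq_complex : OmitsNullSeq ℂ := by
  intro C v h
  have hs : Summable fun i => ‖v i‖ := by
    refine summable_of_sum_le (c := C) (fun _ => norm_nonneg _) fun s => ?_
    have := h s (fun i => (starRingEnd ℂ) (v i) / ‖v i‖) fun i => by
      rw [norm_div, RCLike.norm_conj]
      simpa using div_self_le_one ‖v i‖
    refine le_trans (le_of_eq ?_) this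
    have h2 : ∑ i ∈ s, ((starRingEnd ℂ) (v i) / ‖v i‖) • v i = ((∑ i ∈ s, ‖v i‖ : ℝ) : ℂ) := by
      push_cast
      refine Finset.sum_congr rfl fun i _ => ?_
      by_cases hv : v i = 0
      · simp [hv]
      · have : (‖v i‖ : ℂ) ≠ 0 := by simpa using hv
        rw [smul_eq_mul, div_mul_eq_mul_div, Complex.conj_mul', sq, mul_div_assoc, div_self this,
          mul_one]
    rw [h2, Complex.norm_real, Real.norm_of_nonneg (Finset.sum_nonneg fun _ _ => norm_nonneg _)]
  exact tendsto_zero_iff_norm_tendsto_zero.2 hs.tendsto_atTop_zero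

theorem OmitsNullSeq.of_linearIsometryEquiv (e : X ≃ₗᵢ[ℂ] Y) (h : OmitsNullSeq Y) :
    OmitsNullSeq X := by
  intro C v hv
  have := h _ _ (hv.map (e.toContinuousLinearEquiv : X →L[ℂ] Y))
  rw [tendsto_zero_iff_norm_tendsto_zero] at this ⊢
  simpa using this

open NullSequenceSpace

variable {E : Type*} [NormedAddCommGroup E] [NormedSpace ℂ E] [NullSequenceSpace E]

/-- The hump of the gliding hump arguments: if `T` is large on the tail beyond `N`, then, since
truncations converge in c₀, it is already large on a finite block. -/
theorem exists_lt_norm_block {T : E →L[ℂ] X} {N : ℕ} {ε : ℝ}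
    (h : ε < ‖T.comp (ContinuousLinearMap.id ℂ _ - trunc N)‖) :
    ∃ x : E, ‖x‖ ≤ 1 ∧ ∀ᶠ M in atTop, ε < ‖T (trunc M x - trunc N x)‖ := by
  by_cases hε : 0 ≤ ε
  · by_contra! hcon
    refine absurd h (not_lt.2 ?_)
    refine ContinuousLinearMap.opNorm_le_of_unit_norm hε ?_
    · intro x hx
      obtain hx' := hcon x hx.le
      have hlim : Tendsto (fun M => ‖T (trunc M x - trunc N x)‖) atTop
          (𝓝 ‖T (x - trunc N x)‖) :=
        ((T.continuous.tendsto _).comp ((tendsto_trunc x).sub_const _)).norm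
      by_contra! hlt
      exact hx' ((hlim.eventually (lt_mem_nhds (by simpa using hlt))).mono fun _ h => not_le.2 h)
  · exact ⟨0, by simp, .of_forall fun M => by simpa using hε⟩

/-- A bounded operator from `c₀` to a space without `c₀` is compact. -/
theorem OmitsNullSeq.tendsto_comp_trunc (hX : OmitsNullSeq X) (T : E →L[ℂ] X) :
    Tendsto (fun N => T.comp (trunc N)) atTop (𝓝 T) := by
  have hanti : ∀ M N, M ≤ N → ‖T.comp (ContinuousLinearMap.id ℂ _ - trunc N)‖ ≤
      2 * ‖T.comp (ContinuousLinearMap.id ℂ _ - trunc M)‖ := fun M N h => by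
    have : T.comp (ContinuousLinearMap.id ℂ _ - trunc N) =
        (T.comp (ContinuousLinearMap.id ℂ _ - trunc M)).comp
          (ContinuousLinearMap.id ℂ _ - trunc N) := by
      ext x
      simp [trunc_trunc h]
    rw [this, mul_comm]
    refine (ContinuousLinearMap.opNorm_comp_le _ _).trans
      (mul_le_mul_of_nonneg_left ?_ (norm_nonneg _))
    refine (norm_sub_le _ _).trans ?_
    have := ContinuousLinearMap.norm_id_le (𝕜 := ℂ) (E := E)
    linarith [norm_trunc_le (E := E) N]
  refine Metric.tendsto_atTop.2 fun ε hε => ?_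
  by_contra! hcon
  -- Failure at a single `n ≥ N` bounds the tail at `N` below by `ε / 2`, by `hanti`; `ε / 3` makes
  -- the inequality strict.
  have hbig : ∀ N, ε / 3 < ‖T.comp (ContinuousLinearMap.id ℂ _ - trunc N)‖ := fun N => by
    obtain ⟨n, hn, h⟩ := hcon N
    have h1 := hanti N n hn
    have h2 : T.comp (trunc n) - T = -(T.comp (ContinuousLinearMap.id ℂ _ - trunc n)) := by
      ext x
      simp
    rw [dist_eq_norm, h2, norm_neg] at h
    linarith
  choose x hx hM using fun N => exists_lt_norm_block (hbig N)
  choose M hM using fun N => ((hM N).and (eventually_gt_atTop N)).exists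
  -- Gliding hump: consecutive blocks form an unconditionally bounded sequence, so their images
  -- under `T` must tend to `0`, although each has norm above `ε / 3`.
  let N : ℕ → ℕ := fun i => M^[i] 0
  have hN : ∀ i, N (i + 1) = M (N i) := fun i => Function.iterate_succ_apply' _ _ _
  have hmono : StrictMono N := strictMono_nat_of_lt_succ fun i => by
    rw [hN]; exact (hM _).2
  have hub : UnconditionallyBounded 1
      fun i => trunc (N (i + 1)) (x (N i)) - trunc (N i) (x (N i)) :=
    fun s α hα => norm_sum_blocks_le hmono (x := fun i => x (N i)) (fun i => hx _) s hα
  have h0 := hX _ _ (hub.map T)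
  obtain ⟨n, hn⟩ := Metric.tendsto_atTop.1 h0 (ε / 3) (by positivity)
  have h1 := hn n le_rfl
  have h2 := (hM (N n)).1
  rw [← hN] at h2
  rw [dist_zero_right] at h1
  exact lt_asymm h1 h2

/-- Averaging over signs: the mean of `(∑ sᵢ Vᵢ)(∑ sᵢ uᵢ)` is the diagonal `∑ Vᵢ uᵢ`, the mixed
terms cancelling. The parameters `r`, `V₀`, `u₀` absorb the terms already treated, so that the
induction removes one sign at a time. -/
theorem norm_add_sum_apply_le (V : ℕ → X →L[ℂ] Y) (u : ℕ → X) (C : ℝ) (K : ℕ) :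
    ∀ (r : Y) (V₀ : X →L[ℂ] Y) (u₀ : X),
      (∀ s : ℕ → ℂ, (∀ i, s i = 1 ∨ s i = -1) →
        ‖r + (V₀ + ∑ i ∈ Finset.range K, s i • V i) (u₀ + ∑ i ∈ Finset.range K, s i • u i)‖ ≤ C) →
      ‖r + V₀ u₀ + ∑ i ∈ Finset.range K, V i (u i)‖ ≤ C := by
  induction K with
  | zero =>
    intro r V₀ u₀ h
    simpa using h (fun _ => 1) fun _ => Or.inl rfl
  | succ K ih =>
    intro r V₀ u₀ h
    have h2 := ih (r + V K (u K)) V₀ u₀ fun s hs => by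
      have hs' : ∀ a : ℂ, (a = 1 ∨ a = -1) →
          ‖r + (V₀ + ∑ i ∈ Finset.range K, s i • V i + a • V K)
            (u₀ + ∑ i ∈ Finset.range K, s i • u i + a • u K)‖ ≤ C := fun a ha => by
        have h3 := h (Function.update s K a) fun i => by
          by_cases hi : i = K
          · subst hi; simpa using ha
          · simpa [Function.update_of_ne hi] using hs i
        rw [Finset.sum_range_succ, Finset.sum_range_succ, ← add_assoc, ← add_assoc] at h3
        rw [Finset.sum_congr rfl (fun i hi => by
            rw [Function.update_of_ne (Finset.mem_range.1 hi).ne]),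
          Finset.sum_congr (g := fun i => s i • u i) rfl (fun i hi => by
            rw [Function.update_of_ne (Finset.mem_range.1 hi).ne]), Function.update_self] at h3
        exact h3
      set V' := V₀ + ∑ i ∈ Finset.range K, s i • V i
      set u' := u₀ + ∑ i ∈ Finset.range K, s i • u i
      have hp := hs' 1 (Or.inl rfl)
      have hm := hs' (-1) (Or.inr rfl)
      have : (2 : ℂ) • (r + V K (u K) + V' u') =
          (r + (V' + (1 : ℂ) • V K) (u' + (1 : ℂ) • u K)) +
            (r + (V' + (-1 : ℂ) • V K) (u' + (-1 : ℂ) • u K)) := by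
        simp only [one_smul, neg_smul, add_apply, map_add, map_neg,
          neg_apply, two_smul]
        abel
      have h4 := norm_add_le (r + (V' + (1 : ℂ) • V K) (u' + (1 : ℂ) • u K))
        (r + (V' + (-1 : ℂ) • V K) (u' + (-1 : ℂ) • u K))
      rw [← this, norm_smul, Complex.norm_ofNat] at h4
      linarith
    rw [Finset.sum_range_succ]
    refine le_trans (le_of_eq ?_) h2
    congr 1
    abel

end

end NullSequences

end BoundedType

namespace BoundedType

open Filter NullSequenceSpace

/-! ### Operators from c₀ and multilinear forms on c₀: absence of copies of c₀. -/

section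

variable {X : Type*} [NormedAddCommGroup X] [NormedSpace ℂ X]
variable {E : Type*} [NormedAddCommGroup E] [NormedSpace ℂ E] [NullSequenceSpace E]

/-- On each unit vector `V k` tends to `0`, so operators that stay large do so on tails. A gliding
hump yields blocks `u i` on which a subsequence of `V` is large, and sign averaging shows that these
values form an unconditionally bounded sequence in `X`, contradicting `hX`. -/
theorem OmitsNullSeq.continuousLinearMap (hX : OmitsNullSeq X) :
    OmitsNullSeq (E →L[ℂ] X) := by
  intro C V hV
  have hpt : ∀ N, Tendsto (fun k => (V k).comp (trunc N)) atTop (𝓝 0) := fun N => by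
    have h1 : ∀ j, Tendsto (fun k => (coord j).smulRight (V k (unitVec j))) atTop
        (𝓝 (0 : E →L[ℂ] X)) := fun j => by
      have h2 := hX _ _ (hV.map (ContinuousLinearMap.apply ℂ X (unitVec j)))
      have h3 := ((ContinuousLinearMap.smulRightL ℂ E X (coord j)).continuous.tendsto 0).comp h2
      rw [map_zero] at h3
      exact h3
    have h4 := tendsto_finsetSum (Finset.range N) fun j _ => h1 j
    rw [Finset.sum_const_zero] at h4
    refine h4.congr fun k => ?_
    ext x
    simp [trunc_eq_sum]
  by_contra hcon
  obtain ⟨ε, hε, hfreq⟩ : ∃ ε > 0, ∃ᶠ k in atTop, ε ≤ ‖V k‖ := by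
    rw [Metric.tendsto_nhds] at hcon
    push Not at hcon
    obtain ⟨ε, hε, h⟩ := hcon
    exact ⟨ε, hε, h.mono fun k hk => by simpa using hk⟩
  have step : ∀ N : ℕ, ∃ k M : ℕ, ∃ x : E, N ≤ k ∧ k < M ∧ ‖x‖ ≤ 1 ∧
      ε / 3 < ‖V k (trunc M x - trunc N x)‖ := fun N => by
    have hsmall : ∀ᶠ k in atTop, ‖(V k).comp (trunc N)‖ < ε / 3 := by
      have := (Metric.tendsto_nhds.1 (hpt N)) (ε / 3) (by positivity)
      simpa using this
    obtain ⟨k, hk, hk1, hk2⟩ := (hfreq.and_eventually (hsmall.and (eventually_ge_atTop N))).exists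
    have hbig : ε / 3 < ‖(V k).comp (ContinuousLinearMap.id ℂ _ - trunc N)‖ := by
      have h1 : V k = (V k).comp (ContinuousLinearMap.id ℂ _ - trunc N) +
          (V k).comp (trunc N) := by
        ext x
        simp
      have h2 := norm_add_le ((V k).comp (ContinuousLinearMap.id ℂ _ - trunc N))
        ((V k).comp (trunc N))
      rw [← h1] at h2
      linarith
    obtain ⟨x, hx, hM⟩ := exists_lt_norm_block hbig
    obtain ⟨M, hM1, hM2⟩ := (hM.and (eventually_gt_atTop k)).exists
    exact ⟨k, M, x, hk2, hM2, hx, hM1⟩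
  choose k M x hk hM hx hbig using step
  let N : ℕ → ℕ := fun i => M^[i] 0
  have hN : ∀ i, N (i + 1) = M (N i) := fun i => Function.iterate_succ_apply' _ _ _
  have hmono : StrictMono N := strictMono_nat_of_lt_succ fun i => by
    rw [hN]; exact (hk _).trans_lt (hM _)
  have hkmono : StrictMono fun i => k (N i) := strictMono_nat_of_lt_succ fun i => by
    refine lt_of_lt_of_le ?_ (hk _)
    rw [hN]
    exact hM _
  let u : ℕ → E := fun i => trunc (N (i + 1)) (x (N i)) - trunc (N i) (x (N i))
  have hW := hV.comp_injective hkmono.injective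
  have hC : 0 ≤ C := by simpa using hV ∅ (fun _ => 0) (by simp)
  -- The coefficients `α` are attached to the operators, and the same signs multiply operators and
  -- blocks. The two random sums have norms at most `C` and `1`.
  have hub : UnconditionallyBounded C fun i => V (k (N i)) (u i) := by
    intro s α hα
    obtain ⟨K, hK⟩ := s.exists_nat_subset_range
    have e1 : ∑ i ∈ s, α i • V (k (N i)) (u i) = ∑ i ∈ Finset.range K,
        ((if i ∈ s then α i else 0) • V (k (N i))) (u i) := by
      rw [← Finset.sum_subset hK]
      · refine Finset.sum_congr rfl fun i hi => ?_
        simp [hi]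
      · intro i _ hi
        simp [hi]
    have h1 := norm_add_sum_apply_le (fun i => (if i ∈ s then α i else 0) • V (k (N i))) u C K
      0 0 0 fun σ hσ => by
        have hσ' : ∀ i, ‖σ i‖ ≤ 1 := fun i => by rcases hσ i with h | h <;> simp [h]
        have h2 := hW (Finset.range K) (fun i => σ i * if i ∈ s then α i else 0) fun i => by
          rw [norm_mul]
          refine mul_le_one₀ (hσ' i) (norm_nonneg _) ?_
          split_ifs
          · exact hα i
          · simp
        have h3 := norm_sum_blocks_le hmono (x := fun i => x (N i)) (fun i => hx _)
          (Finset.range K) hσ'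
        rw [zero_add, zero_add, zero_add]
        refine (ContinuousLinearMap.le_opNorm _ _).trans ?_
        simp only [smul_smul]
        exact (mul_le_mul h2 h3 (norm_nonneg _) hC).trans_eq (mul_one C)
    rw [e1]
    simpa using h1
  obtain ⟨n, hn⟩ := Metric.tendsto_atTop.1 (hX _ _ hub) (ε / 3) (by positivity)
  have h1 := hn n le_rfl
  have h2 := hbig (N n)
  rw [← hN] at h2
  rw [dist_zero_right] at h1
  exact lt_asymm h1 h2

theorem omitsNullSeq_multilinear (n : ℕ) :
    OmitsNullSeq (E [×n]→L[ℂ] ℂ) := by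
  induction n with
  | zero =>
    exact .of_linearIsometryEquiv (continuousMultilinearCurryFin0 ℂ E ℂ) omitsNullSeq_complex
  | succ n ih =>
    exact .of_linearIsometryEquiv
      (continuousMultilinearCurryLeftEquiv ℂ (fun _ : Fin (n + 1) => E) ℂ)
      ih.continuousLinearMap

/-! ### Truncation of multilinear forms on `c₀` -/

theorem norm_compContinuousLinearMap_trunc_le {n : ℕ} (N : ℕ) (A : E [×n]→L[ℂ] ℂ) :
    ‖A.compContinuousLinearMap fun _ => trunc N‖ ≤ ‖A‖ := by
  refine (A.norm_compContinuousLinearMap_le _).trans ?_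
  refine mul_le_of_le_one_right (norm_nonneg _) (Finset.prod_le_one ?_ ?_)
  · exact fun _ _ => norm_nonneg _
  · exact fun _ _ => norm_trunc_le N

/-- A continuous multilinear form on `c₀` is the norm limit of its truncations. -/
theorem tendsto_compContinuousLinearMap_trunc {n : ℕ} (A : E [×n]→L[ℂ] ℂ) :
    Tendsto (fun N => A.compContinuousLinearMap fun _ => trunc N) atTop (𝓝 A) := by
  induction n with
  | zero =>
    refine tendsto_const_nhds.congr fun N => ?_
    ext x
    rw [ContinuousMultilinearMap.compContinuousLinearMap_apply]
    congr 1
    exact Subsingleton.elim _ _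
  | succ n ih =>
    set T := A.curryLeft
    have hT := (omitsNullSeq_multilinear (E := E) n).tendsto_comp_trunc T
    rw [Metric.tendsto_atTop] at hT
    refine Metric.tendsto_atTop.2 fun ε hε => ?_
    obtain ⟨M, hM⟩ := hT (ε / 5) (by positivity)
    have hM' := hM M le_rfl
    rw [dist_eq_norm] at hM'
    have hsum : Tendsto (fun N => ∑ j ∈ Finset.range M,
        ‖(T (unitVec j)).compContinuousLinearMap (fun _ => trunc N) - T (unitVec j)‖)
        atTop (𝓝 0) := by
      have := tendsto_finsetSum (Finset.range M) fun j _ =>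
        tendsto_iff_norm_sub_tendsto_zero.1 (ih (T (unitVec j)))
      simpa using this
    -- Up to `ε / 5`, the curried operator `T` depends only on the finitely many forms `T (unitVec
    -- j)`, `j < M`, to which the induction hypothesis applies simultaneously.
    obtain ⟨L, hL⟩ := Metric.tendsto_atTop.1 hsum (ε / 5) (by positivity)
    refine ⟨max L M, fun N hN => ?_⟩
    have hL' := hL N (le_of_max_le_left hN)
    have hN' := hM N (le_of_max_le_right hN)
    rw [dist_eq_norm] at hN' ⊢
    rw [Real.dist_0_eq_abs, abs_of_nonneg (Finset.sum_nonneg fun _ _ => norm_nonneg _)] at hL'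
    have htail : ∀ (K : ℕ) (y : E), ‖T (trunc K y) - T y‖ ≤ ‖T.comp (trunc K) - T‖ * ‖y‖ :=
      fun K y => (T.comp (trunc K) - T).le_opNorm y
    have hfin : ∀ y : E,
        ‖(T (trunc M y)).compContinuousLinearMap (fun _ => trunc N) - T (trunc M y)‖ ≤
          ε / 5 * ‖y‖ := fun y => by
      have e1 : (T (trunc M y)).compContinuousLinearMap (fun _ => trunc N) - T (trunc M y) =
          ∑ j ∈ Finset.range M, coord j y •
            ((T (unitVec j)).compContinuousLinearMap (fun _ => trunc N) - T (unitVec j)) := by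
        ext m
        simp [trunc_eq_sum, mul_sub, Finset.sum_sub_distrib]
      rw [e1]
      refine (norm_sum_le _ _).trans ?_
      refine le_trans ?_ (mul_le_mul_of_nonneg_right hL'.le (norm_nonneg y))
      rw [Finset.sum_mul]
      refine Finset.sum_le_sum fun j _ => ?_
      rw [norm_smul, mul_comm]
      exact mul_le_mul_of_nonneg_left (norm_coord_apply_le j y) (norm_nonneg _)
    refine lt_of_le_of_lt (b := 4 * (ε / 5)) ?_ (by linarith)
    refine ContinuousMultilinearMap.opNorm_le_bound (by positivity) fun m => ?_
    obtain ⟨y, m, rfl⟩ : ∃ y m', m = Fin.cons y m' := ⟨m 0, Fin.tail m, (Fin.cons_self_tail m).symm⟩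
    -- Telescoping through `T (trunc M y)`; each of the four terms has norm at most `ε / 5` times
    -- the norms of the variables.
    have e2 : (A.compContinuousLinearMap (fun _ => trunc N) - A) (Fin.cons y m) =
        ((T (trunc N y) - T y).compContinuousLinearMap fun _ => trunc N) m +
        (((T (trunc M y)).compContinuousLinearMap (fun _ => trunc N) - T (trunc M y)) m -
          ((T (trunc M y) - T y).compContinuousLinearMap fun _ => trunc N) m +
          (T (trunc M y) - T y) m) := by
      have e3 : A (fun i => trunc N ((Fin.cons y m : Fin (n + 1) → E) i)) =
          T (trunc N y) (fun i => trunc N (m i)) := by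
        rw [ContinuousMultilinearMap.curryLeft_apply]
        congr 1
        funext i
        refine Fin.cases ?_ (fun i => ?_) i <;> simp
      simp only [sub_apply,
        ContinuousMultilinearMap.compContinuousLinearMap_apply, e3]
      rw [← ContinuousMultilinearMap.curryLeft_apply]
      ring
    rw [e2, Fin.prod_univ_succ]
    simp only [Fin.cons_zero, Fin.cons_succ]
    have b1 : ∀ B : E [×n]→L[ℂ] ℂ, ∀ c, ‖B‖ ≤ c * ‖y‖ →
        ‖B m‖ ≤ c * (‖y‖ * ∏ i, ‖m i‖) := fun B c hB => by
      refine (B.le_opNorm m).trans ?_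
      rw [← mul_assoc]
      exact mul_le_mul_of_nonneg_right hB (Finset.prod_nonneg fun _ _ => norm_nonneg _)
    have b2 : ‖T (trunc N y) - T y‖ ≤ ε / 5 * ‖y‖ :=
      (htail N y).trans (mul_le_mul_of_nonneg_right hN'.le (norm_nonneg _))
    have b3 : ‖T (trunc M y) - T y‖ ≤ ε / 5 * ‖y‖ :=
      (htail M y).trans (mul_le_mul_of_nonneg_right hM'.le (norm_nonneg _))
    have c1 := b1 _ _ ((norm_compContinuousLinearMap_trunc_le N _).trans b2)
    have c2 := b1 _ _ (hfin y)
    have c3 := b1 _ _ ((norm_compContinuousLinearMap_trunc_le N _).trans b3)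
    have c4 := b1 _ _ b3
    refine (norm_add_le _ _).trans ?_
    refine (add_le_add c1 ((norm_add_le _ _).trans
      (add_le_add ((norm_sub_le _ _).trans (add_le_add c2 c3)) c4))).trans (le_of_eq ?_)
    ring

/-! ### Weak-star convergence of truncations in the bidual of `c₀` -/

/-- The vector of `c₀` with the first `N` coordinates of `z ∈ c₀''`. -/
def bidualTrunc (N : ℕ) (z : StrongDual ℂ (StrongDual ℂ E)) : E :=
  ∑ k ∈ Finset.range N, z (coord k) • unitVec k

theorem coord_bidualTrunc (N : ℕ) (z : StrongDual ℂ (StrongDual ℂ E)) (j : ℕ) :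
    coord j (bidualTrunc N z) = if j < N then z (coord j) else 0 :=
  coord_sum_smul_unitVec N _ j

theorem trunc_bidualTrunc {M N : ℕ} (h : M ≤ N) (z : StrongDual ℂ (StrongDual ℂ E)) :
    trunc M (bidualTrunc N z) = bidualTrunc M z := by
  refine ext_coord fun j => ?_
  simp only [coord_trunc, coord_bidualTrunc]
  split_ifs <;> first | rfl | omega

theorem bidualTrunc_add (N : ℕ) (z w : StrongDual ℂ (StrongDual ℂ E)) :
    bidualTrunc N (z + w) = bidualTrunc N z + bidualTrunc N w := by
  simp [bidualTrunc, add_smul, Finset.sum_add_distrib]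

theorem norm_apply_coord_le (z : StrongDual ℂ (StrongDual ℂ E)) (k : ℕ) :
    ‖z (coord k)‖ ≤ ‖z‖ :=
  (z.le_opNorm _).trans (mul_le_of_le_one_right (norm_nonneg z) (norm_coord_le k))

theorem norm_bidualTrunc_le (N : ℕ) (z : StrongDual ℂ (StrongDual ℂ E)) :
    ‖bidualTrunc N z‖ ≤ ‖z‖ := by
  refine (norm_le_iff (norm_nonneg z)).2 fun j => ?_
  rw [coord_bidualTrunc]
  split_ifs
  · exact norm_apply_coord_le z j
  · simp

theorem apply_comp_trunc (N : ℕ) (z : StrongDual ℂ (StrongDual ℂ E)) (γ : StrongDual ℂ E) :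
    z (γ.comp (trunc N)) = γ (bidualTrunc N z) := by
  have : γ.comp (trunc N) = ∑ k ∈ Finset.range N, γ (unitVec k) • coord k := by
    ext x
    simp [trunc_eq_sum, mul_comm]
  rw [this]
  simp [bidualTrunc, mul_comm]

theorem tendsto_apply_bidualTrunc (z : StrongDual ℂ (StrongDual ℂ E)) (γ : StrongDual ℂ E) :
    Tendsto (fun N => γ (bidualTrunc N z)) atTop (𝓝 (z γ)) :=
  ((z.continuous.tendsto γ).comp (omitsNullSeq_complex.tendsto_comp_trunc γ)).congr fun N =>
    apply_comp_trunc N z γ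

/-- A truncated form depends on finitely many coordinates, and on finite combinations of the `coord
j` an element of the bidual acts as a vector of c₀. Hence the Aron–Berner extension is plain
substitution. -/
theorem aronBerner_compContinuousLinearMap_trunc (N : ℕ) :
    ∀ (n : ℕ) (z : Fin n → StrongDual ℂ (StrongDual ℂ E)) (A : E [×n]→L[ℂ] ℂ),
      aronBerner n z (A.compContinuousLinearMap fun _ => trunc N) =
        A fun i => bidualTrunc N (z i)
  | 0, z, A => by
    simp only [aronBerner, ContinuousMultilinearMap.apply_apply]
    rw [ContinuousMultilinearMap.compContinuousLinearMap_apply]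
    congr 1
    exact Subsingleton.elim _ _
  | n + 1, z, A => by
    let ev : (E [×n]→L[ℂ] ℂ) →L[ℂ] ℂ :=
      ContinuousMultilinearMap.apply ℂ (fun _ : Fin n => E) ℂ fun i => bidualTrunc N (Fin.tail z i)
    have h : (aronBerner n (Fin.tail z)).comp
        (A.compContinuousLinearMap fun _ => trunc N).curryLeft =
          (ev.comp A.curryLeft).comp (trunc N) := by
      ext x
      have h1 : (A.compContinuousLinearMap fun _ => trunc N).curryLeft x =
          (A.curryLeft (trunc N x)).compContinuousLinearMap fun _ => trunc N := by
        ext m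
        simp only [ContinuousMultilinearMap.curryLeft_apply,
          ContinuousMultilinearMap.compContinuousLinearMap_apply]
        congr 1
        funext i
        refine Fin.cases ?_ (fun i => ?_) i <;> simp
      simp only [ContinuousLinearMap.comp_apply, h1]
      exact aronBerner_compContinuousLinearMap_trunc N n _ _
    change z 0 ((aronBerner n (Fin.tail z)).comp
        (A.compContinuousLinearMap fun _ => trunc N).curryLeft) = _
    rw [h, apply_comp_trunc]
    change A.curryLeft (bidualTrunc N (z 0)) (fun i => bidualTrunc N (Fin.tail z i)) = _
    rw [ContinuousMultilinearMap.curryLeft_apply]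
    congr 1
    funext i
    refine Fin.cases ?_ (fun i => ?_) i <;> simp [Fin.tail]

/-- On `c₀` the Aron–Berner extension is the limit along truncations. -/
theorem tendsto_apply_bidualTrunc_aronBerner {n : ℕ} (z : StrongDual ℂ (StrongDual ℂ E))
    {T : ℕ → E [×n]→L[ℂ] ℂ} {A : E [×n]→L[ℂ] ℂ} (hT : Tendsto T atTop (𝓝 A)) :
    Tendsto (fun N => T N fun _ => bidualTrunc N z) atTop
      (𝓝 (aronBerner n (fun _ => z) A)) := by
  have h1 : Tendsto (fun N => A fun _ => bidualTrunc N z) atTop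
      (𝓝 (aronBerner n (fun _ => z) A)) :=
    (((aronBerner n fun _ => z).continuous.tendsto A).comp
      (tendsto_compContinuousLinearMap_trunc A)).congr fun N =>
        aronBerner_compContinuousLinearMap_trunc N n _ A
  -- The truncations of `z` stay in the ball of radius `‖z‖`, where norm convergence of the forms is
  -- uniform; this permits forms that vary with `N`.
  have h2 : Tendsto (fun N => (T N - A) fun _ => bidualTrunc N z) atTop (𝓝 0) := by
    have h3 := (tendsto_iff_norm_sub_tendsto_zero.1 hT).mul_const (‖z‖ ^ n)
    rw [zero_mul] at h3
    refine squeeze_zero_norm (fun N => ?_) h3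
    refine ((T N - A).le_opNorm _).trans (mul_le_mul_of_nonneg_left ?_ (norm_nonneg _))
    simpa using pow_le_pow_left₀ (norm_nonneg _) (norm_bidualTrunc_le N z) n
  simpa using h2.add h1

end

end BoundedType

namespace BoundedType

open Filter

/-! ### Cauchy estimates and uniform limits of analytic functions on normed spaces -/

section Analytic

variable {E : Type*} [NormedAddCommGroup E] [NormedSpace ℂ E]

theorem iteratedDeriv_comp_line {f : E → ℂ} {x : E} (hf : AnalyticAt ℂ f x) (y : E) (n : ℕ) :
    iteratedDeriv n (fun ζ : ℂ => f (x + ζ • y)) 0 = iteratedFDeriv ℂ n f x fun _ => y := by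
  obtain ⟨p, r, hp⟩ := hf
  have h1 : HasFPowerSeriesAt (fun v => f (x + v)) p 0 := by
    have := hp.comp_sub (-x)
    simp only [sub_neg_eq_add, add_neg_cancel] at this
    exact ⟨r, this.congr fun v _ => by rw [add_comm]⟩
  let u : ℂ →L[ℂ] E := (ContinuousLinearMap.id ℂ ℂ).smulRight y
  have h2 : HasFPowerSeriesAt ((fun v => f (x + v)) ∘ u) (p.compContinuousLinearMap u) 0 :=
    HasFPowerSeriesAt.compContinuousLinearMap (by simpa using h1)
  obtain ⟨r', h3⟩ := h2
  rw [← hp.factorial_smul y n, iteratedDeriv_eq_iteratedFDeriv]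
  have h4 := h3.factorial_smul 1 n
  have h5 : (p.compContinuousLinearMap u n fun _ => (1 : ℂ)) = p n fun _ => y := by
    rw [FormalMultilinearSeries.compContinuousLinearMap_apply]
    congr 1
    funext i
    simp [u]
  rw [h5] at h4
  rw [h4]
  rfl

theorem hasSum_taylor_line {f : E → ℂ} {x : E} (hf : AnalyticAt ℂ f x) (y : E) {R : ℝ} (hR : 1 < R)
    (hd : DifferentiableOn ℂ (fun ζ : ℂ => f (x + ζ • y)) (Metric.ball 0 R)) :
    HasSum (fun n => (n.factorial : ℂ)⁻¹ * iteratedFDeriv ℂ n f x fun _ => y) (f (x + y)) := by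
  have h := Complex.hasSum_taylorSeries_on_ball hd (z := 1) (by simpa using hR)
  simpa [iteratedDeriv_comp_line hf y] using h

theorem norm_taylor_line_le {f : E → ℂ} {x : E} (hf : AnalyticAt ℂ f x) (y : E) {r C : ℝ}
    (hr : 0 < r) (hd : DiffContOnCl ℂ (fun ζ : ℂ => f (x + ζ • y)) (Metric.ball 0 r))
    (hC : ∀ ζ : ℂ, ‖ζ‖ = r → ‖f (x + ζ • y)‖ ≤ C) (n : ℕ) :
    ‖(n.factorial : ℂ)⁻¹ * iteratedFDeriv ℂ n f x fun _ => y‖ ≤ C / r ^ n := by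
  have h := Complex.norm_iteratedDeriv_le_of_forall_mem_sphere_norm_le n hr hd
    fun ζ hζ => hC ζ (by simpa using hζ)
  rw [iteratedDeriv_comp_line hf] at h
  have hn : (0 : ℝ) < n.factorial := by exact_mod_cast n.factorial_pos
  rw [norm_mul, norm_inv, Complex.norm_natCast, inv_mul_le_iff₀ hn]
  rwa [mul_div_assoc] at h

/-- Each derivative costs a step of length `s` and, by the Schwarz lemma, a factor `2 / s`; the `2`
bounds the oscillation by twice the supremum. This estimates the multilinear norm directly, without
polarization. -/
theorem norm_iteratedFDeriv_le_of_closedBall {f : E → ℂ} {C s : ℝ} (hs : 0 < s) :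
    ∀ (n : ℕ) (x : E), (∀ y ∈ Metric.closedBall x (n * s), AnalyticAt ℂ f y ∧ ‖f y‖ ≤ C) →
      ‖iteratedFDeriv ℂ n f x‖ ≤ C * (2 / s) ^ n := by
  intro n
  induction n with
  | zero =>
    intro x h
    simpa using (h x (by simp)).2
  | succ n ih =>
    intro x h
    have hsub : ∀ y ∈ Metric.ball x s, Metric.closedBall y (n * s) ⊆
        Metric.closedBall x ((n + 1 : ℕ) * s) := fun y hy => by
      refine Metric.closedBall_subset_closedBall' ?_
      have := (Metric.mem_ball.1 hy).le
      push_cast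
      linarith
    have h1 : ∀ y ∈ Metric.ball x s, ‖iteratedFDeriv ℂ n f y‖ ≤ C * (2 / s) ^ n := fun y hy =>
      ih y fun z hz => h z (hsub y hy hz)
    have h2 : DifferentiableOn ℂ (iteratedFDeriv ℂ n f) (Metric.ball x s) := fun y hy =>
      (AnalyticOnNhd.iteratedFDeriv (s := {y}) (fun z hz => hz ▸
        (h y (hsub y hy (Metric.mem_closedBall_self (by positivity)))).1)
        n y rfl).differentiableAt.differentiableWithinAt
    have h3 := Complex.norm_fderiv_le_div_of_mapsTo_ball (R₂ := 2 * (C * (2 / s) ^ n)) h2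
      (fun y hy => by
        rw [Metric.mem_closedBall, dist_eq_norm]
        have := norm_sub_le (iteratedFDeriv ℂ n f y) (iteratedFDeriv ℂ n f x)
        linarith [h1 y hy, h1 x (Metric.mem_ball_self hs)]) hs
    rw [iteratedFDeriv_succ_eq_comp_left, Function.comp_apply, LinearIsometryEquiv.norm_map]
    refine h3.trans (le_of_eq ?_)
    rw [pow_succ]
    ring

theorem norm_iteratedFDeriv_le_of_ball {f : E → ℂ} {C ρ : ℝ} (hρ : 0 < ρ) (n : ℕ) {x : E}
    (h : ∀ y ∈ Metric.ball x ρ, AnalyticAt ℂ f y ∧ ‖f y‖ ≤ C) :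
    ‖iteratedFDeriv ℂ n f x‖ ≤ C * (2 * (n + 1) / ρ) ^ n := by
  have h1 := norm_iteratedFDeriv_le_of_closedBall (f := f) (C := C) (s := ρ / (n + 1))
    (by positivity) n x fun y hy => h y (by
      refine Metric.mem_ball.2 ((Metric.mem_closedBall.1 hy).trans_lt ?_)
      rw [mul_div_assoc', div_lt_iff₀ (by positivity)]
      nlinarith)
  refine h1.trans (le_of_eq ?_)
  rw [div_div_eq_mul_div]

/-- Dividing by `n!` makes the bound geometric, since `(n + 1) ^ n ≤ e ^ (n + 1) n!`. This is what
gives a positive radius of convergence. -/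
theorem norm_taylor_coeff_le {f : E → ℂ} {C ρ : ℝ} (hρ : 0 < ρ) (n : ℕ) {x : E}
    (h : ∀ y ∈ Metric.ball x ρ, AnalyticAt ℂ f y ∧ ‖f y‖ ≤ C) :
    ‖(n.factorial : ℂ)⁻¹ • iteratedFDeriv ℂ n f x‖ ≤
      C * Real.exp 1 * (2 * Real.exp 1 / ρ) ^ n := by
  have hC : 0 ≤ C := (norm_nonneg _).trans (h x (Metric.mem_ball_self hρ)).2
  have h1 := norm_iteratedFDeriv_le_of_ball hρ n h
  have hn : (0 : ℝ) < n.factorial := by exact_mod_cast n.factorial_pos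
  rw [norm_smul, norm_inv, Complex.norm_natCast, inv_mul_le_iff₀ hn]
  refine h1.trans ?_
  have h2 := Real.pow_div_factorial_le_exp ((n : ℝ) + 1) (by positivity) (n + 1)
  rw [Nat.factorial_succ, div_le_iff₀ (by positivity)] at h2
  push_cast at h2
  have h3 : ((n : ℝ) + 1) ^ n ≤ Real.exp 1 * Real.exp 1 ^ n * n.factorial := by
    have h4 : Real.exp ((n : ℝ) + 1) = Real.exp 1 * Real.exp 1 ^ n := by
      rw [← pow_succ', ← Real.exp_nat_mul]
      push_cast
      ring_nf
    rw [h4, pow_succ] at h2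
    have : (0 : ℝ) < n + 1 := by positivity
    nlinarith
  calc C * (2 * (n + 1) / ρ) ^ n = C * (2 / ρ) ^ n * ((n : ℝ) + 1) ^ n := by
        rw [mul_assoc, ← mul_pow]
        congr 2
        ring
    _ ≤ C * (2 / ρ) ^ n * (Real.exp 1 * Real.exp 1 ^ n * n.factorial) := by gcongr
    _ = n.factorial * (C * Real.exp 1 * (2 * Real.exp 1 / ρ) ^ n) := by
        have : 2 * Real.exp 1 / ρ = 2 / ρ * Real.exp 1 := by ring
        rw [this, mul_pow]
        ring

/-- A bounded uniform limit of analytic functions on a ball is analytic at the centre. -/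
theorem analyticAt_of_tendstoUniformlyOn {F : ℕ → E → ℂ} {f : E → ℂ} {x : E} {ρ C : ℝ}
    (hρ : 0 < ρ) (hF : ∀ k, ∀ y ∈ Metric.ball x ρ, AnalyticAt ℂ (F k) y ∧ ‖F k y‖ ≤ C)
    (hlim : TendstoUniformlyOn F f atTop (Metric.ball x ρ)) : AnalyticAt ℂ f x := by
  have hx : x ∈ Metric.ball x ρ := Metric.mem_ball_self hρ
  set a : ℝ := 2 * Real.exp 1 / ρ with ha
  have ha0 : 0 < a := by positivity
  have hC : 0 ≤ C := (norm_nonneg _).trans (hF 0 x hx).2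
  let q : ℕ → (n : ℕ) → E [×n]→L[ℂ] ℂ := fun k n =>
    (n.factorial : ℂ)⁻¹ • iteratedFDeriv ℂ n (F k) x
  have hq : ∀ k n, ‖q k n‖ ≤ C * Real.exp 1 * a ^ n := fun k n =>
    norm_taylor_coeff_le hρ n (hF k)
  have hcauchy : ∀ n, CauchySeq fun k => q k n := fun n => by
    refine Metric.cauchySeq_iff.2 fun ε hε => ?_
    set δ := ε / 2 / (Real.exp 1 * a ^ n) with hδ
    have hδ0 : 0 < δ := by positivity
    obtain ⟨N, hN⟩ := Metric.uniformCauchySeqOn_iff.1 hlim.uniformCauchySeqOn δ hδ0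
    refine ⟨N, fun k hk l hl => ?_⟩
    have h1 := norm_taylor_coeff_le (f := F k - F l) (C := δ) hρ n fun y hy =>
      ⟨(hF k y hy).1.sub (hF l y hy).1, by
        have := (hN k hk l hl y hy).le
        rwa [dist_eq_norm] at this⟩
    rw [iteratedFDeriv_sub_apply (hF k x hx).1.contDiffAt (hF l x hx).1.contDiffAt, smul_sub] at h1
    rw [dist_eq_norm]
    refine h1.trans_lt ?_
    rw [mul_assoc, hδ, div_mul_cancel₀ _ (by positivity)]
    linarith
  choose q' hq' using fun n => cauchySeq_tendsto_of_complete (hcauchy n)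
  have hq'n : ∀ n, ‖q' n‖ ≤ C * Real.exp 1 * a ^ n := fun n =>
    le_of_tendsto (hq' n).norm (.of_forall fun k => hq k n)
  -- With `‖y‖ < ρ / 2` the disc of radius `2` along `y` stays in the ball, so the Taylor series
  -- converges at `1`; `a * r ≤ 1 / 2` makes `(1 / 2) ^ n` a dominating sequence.
  set r : NNReal := ⟨min (ρ / 2) (a⁻¹ / 2), by positivity⟩ with hr
  have hr0 : 0 < (r : ℝ) := by
    change 0 < min (ρ / 2) (a⁻¹ / 2)
    positivity
  have hrρ : (r : ℝ) ≤ ρ / 2 := min_le_left _ _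
  have hra : a * r ≤ 1 / 2 := by
    have : (r : ℝ) ≤ a⁻¹ / 2 := min_le_right _ _
    calc a * r ≤ a * (a⁻¹ / 2) := by gcongr
      _ = 1 / 2 := by field_simp
  refine ⟨q', r, ?_, by exact_mod_cast hr0, fun {y} hy => ?_⟩
  · refine FormalMultilinearSeries.le_radius_of_bound _ (C * Real.exp 1) fun n => ?_
    calc ‖q' n‖ * (r : ℝ) ^ n ≤ C * Real.exp 1 * a ^ n * (r : ℝ) ^ n := by
          gcongr
          exact hq'n n
      _ = C * Real.exp 1 * (a * r) ^ n := by rw [mul_pow]; ring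
      _ ≤ C * Real.exp 1 * 1 := by
          gcongr
          exact pow_le_one₀ (by positivity) (by linarith)
      _ = _ := mul_one _
  · have hy' : ‖y‖ < r := by
      have : y ∈ Metric.eball (0 : E) (r : ℝ≥0∞) := hy
      rw [Metric.eball_coe] at this
      simpa using this
    have hmem : ∀ ζ : ℂ, ‖ζ‖ < 2 → x + ζ • y ∈ Metric.ball x ρ := fun ζ hζ => by
      rw [Metric.mem_ball, dist_eq_norm, add_sub_cancel_left, norm_smul]
      have := norm_nonneg y
      nlinarith [norm_nonneg ζ]
    have hsum : ∀ k, HasSum (fun n => q k n fun _ => y) (F k (x + y)) := fun k => by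
      refine hasSum_taylor_line (hF k x hx).1 y one_lt_two fun ζ hζ => ?_
      have h1 := (hF k _ (hmem ζ (by simpa using hζ))).1.differentiableAt
      exact (h1.comp ζ (by fun_prop)).differentiableWithinAt
    have hbound : ∀ (B : (n : ℕ) → E [×n]→L[ℂ] ℂ), (∀ n, ‖B n‖ ≤ C * Real.exp 1 * a ^ n) →
        ∀ n, ‖B n fun _ => y‖ ≤ C * Real.exp 1 * (1 / 2) ^ n := fun B hB n => by
      calc ‖B n fun _ => y‖ ≤ ‖B n‖ * ‖y‖ ^ n := by simpa using (B n).le_opNorm fun _ => y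
        _ ≤ C * Real.exp 1 * a ^ n * (r : ℝ) ^ n := by
          gcongr
          exact hB n
        _ = C * Real.exp 1 * (a * r) ^ n := by rw [mul_pow]; ring
        _ ≤ _ := by gcongr
    have hgeo : Summable fun n : ℕ => C * Real.exp 1 * (1 / 2 : ℝ) ^ n :=
      (summable_geometric_of_lt_one (by norm_num) (by norm_num)).mul_left _
    have h1 := tendsto_tsum_of_dominated_convergence (𝓕 := atTop) (f := fun k n => q k n fun _ => y)
      (g := fun n => q' n fun _ => y) hgeo
      (fun n => ((ContinuousMultilinearMap.apply ℂ (fun _ : Fin n => E) ℂ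
        fun _ => y).continuous.tendsto (q' n)).comp (hq' n))
      (.of_forall fun k => hbound (q k) (hq k))
    have h2 : Tendsto (fun k => F k (x + y)) atTop (𝓝 (f (x + y))) :=
      hlim.tendsto_at (by simpa using hmem 1 (by simp))
    have h3 : f (x + y) = ∑' n, q' n fun _ => y :=
      tendsto_nhds_unique h2 (h1.congr fun k => (hsum k).tsum_eq)
    rw [h3]
    exact (Summable.of_norm_bounded hgeo (hbound q' hq'n)).hasSum

theorem analyticOnNhd_diag {n : ℕ} (c : E [×n]→L[ℂ] ℂ) (s : Set E) :
    AnalyticOnNhd ℂ (fun x => c fun _ => x) s := fun x _ =>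
  (c.analyticAt (x := fun _ => x)).comp
    ((ContinuousLinearMap.pi fun _ : Fin n => ContinuousLinearMap.id ℂ E).analyticAt x)

/-! ### Continuous polynomials -/

/-- The continuous polynomials are the entire functions of polynomial growth. -/
theorem isContinuousPolynomial_iff {P : E → ℂ} : IsContinuousPolynomial P ↔
    (∀ x, AnalyticAt ℂ P x) ∧ ∃ (C : ℝ) (N : ℕ), ∀ x, ‖P x‖ ≤ C * (1 + ‖x‖) ^ N := by
  constructor
  · rintro ⟨N, c, hc⟩
    obtain rfl : P = fun x => ∑ n ∈ Finset.range N, c n fun _ => x := funext hc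
    refine ⟨fun x => ?_, ∑ n ∈ Finset.range N, ‖c n‖, N, fun x => ?_⟩
    · exact Finset.analyticAt_fun_sum _ fun n _ => analyticOnNhd_diag (c n) Set.univ x trivial
    · refine (norm_sum_le _ _).trans ?_
      rw [Finset.sum_mul]
      refine Finset.sum_le_sum fun n hn => ?_
      calc ‖c n fun _ => x‖ ≤ ‖c n‖ * ‖x‖ ^ n := by simpa using (c n).le_opNorm fun _ => x
        _ ≤ ‖c n‖ * (1 + ‖x‖) ^ n := by gcongr; linarith
        _ ≤ ‖c n‖ * (1 + ‖x‖) ^ N := by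
          gcongr
          · linarith [norm_nonneg x]
          · exact (Finset.mem_range.1 hn).le
  · rintro ⟨ha, C, N, hC⟩
    refine ⟨N + 1, fun n => (n.factorial : ℂ)⁻¹ • iteratedFDeriv ℂ n P 0, fun x => ?_⟩
    have hd : Differentiable ℂ fun ζ : ℂ => P (0 + ζ • x) := fun ζ =>
      (ha _).differentiableAt.comp ζ (by fun_prop)
    have hsum := hasSum_taylor_line (ha 0) x one_lt_two hd.differentiableOn
    -- Liouville: for `n > N`, Cauchy's estimate on the circle of radius `r` is of order `r ^ N / r
    -- ^ n ≤ 1 / r`, and `r` is arbitrary.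
    have hzero : ∀ n ∉ Finset.range (N + 1),
        (n.factorial : ℂ)⁻¹ * iteratedFDeriv ℂ n P 0 (fun _ => x) = 0 := fun n hn => by
      have hn' : N + 1 ≤ n := by simpa using hn
      set K := |C| * (1 + ‖x‖) ^ N
      have hK : ∀ r : ℝ, 1 ≤ r →
          ‖(n.factorial : ℂ)⁻¹ * iteratedFDeriv ℂ n P 0 fun _ => x‖ ≤ K / r := fun r hr => by
        have hr0 : 0 < r := by linarith
        have h1 := norm_taylor_line_le (C := K * r ^ N) (ha 0) x hr0 hd.diffContOnCl
          (fun ζ hζ => by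
            refine (hC _).trans ?_
            rw [zero_add, norm_smul, hζ, mul_assoc, ← mul_pow]
            have := norm_nonneg x
            refine mul_le_mul (le_abs_self C) (pow_le_pow_left₀ (by positivity) (by nlinarith) N)
              (by positivity) (abs_nonneg _)) n
        refine h1.trans ?_
        have hK0 : 0 ≤ K := by positivity
        rw [div_le_div_iff₀ (by positivity) hr0, mul_assoc, ← pow_succ]
        gcongr
      have hlim : Tendsto (fun r : ℝ => K / r) atTop (𝓝 0) :=
        tendsto_const_nhds.div_atTop tendsto_id
      exact norm_le_zero_iff.1 (ge_of_tendsto hlim ((eventually_ge_atTop 1).mono hK))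
    have h2 := hsum.unique (hasSum_sum_of_ne_finset_zero hzero)
    rw [zero_add] at h2
    exact h2

theorem isContinuousPolynomial_diag {n : ℕ} (c : E [×n]→L[ℂ] ℂ) :
    IsContinuousPolynomial fun x => c fun _ => x :=
  isContinuousPolynomial_iff.2 ⟨fun x => analyticOnNhd_diag c Set.univ x trivial, ‖c‖, n, fun x =>
    ((c.le_opNorm fun _ => x).trans_eq (by simp)).trans
      (mul_le_mul_of_nonneg_left (pow_le_pow_left₀ (norm_nonneg x) (by linarith) n)
        (norm_nonneg _))⟩

namespace IsContinuousPolynomial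

variable {P : E → ℂ}

theorem analyticAt (hP : IsContinuousPolynomial P) (x : E) : AnalyticAt ℂ P x :=
  (isContinuousPolynomial_iff.1 hP).1 x

theorem exists_norm_le (hP : IsContinuousPolynomial P) (R : ℝ) :
    ∃ C, ∀ x, ‖x‖ ≤ R → ‖P x‖ ≤ C := by
  obtain ⟨-, C, N, hC⟩ := isContinuousPolynomial_iff.1 hP
  refine ⟨|C| * (1 + R) ^ N, fun x hx => (hC x).trans ?_⟩
  exact mul_le_mul (le_abs_self C) (pow_le_pow_left₀ (by positivity) (by linarith) N)
    (by positivity) (abs_nonneg _)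

/-- The characterization by growth replaces the binomial expansion of shifted multilinear forms. -/
theorem comp_add (hP : IsContinuousPolynomial P) (h : E) :
    IsContinuousPolynomial fun x => P (x + h) := by
  obtain ⟨ha, C, N, hC⟩ := isContinuousPolynomial_iff.1 hP
  refine isContinuousPolynomial_iff.2 ⟨fun x => (ha (x + h)).comp_of_eq (by fun_prop) rfl,
    |C| * (1 + ‖h‖) ^ N, N, fun x => (hC _).trans ?_⟩
  rw [mul_assoc, ← mul_pow]
  refine mul_le_mul (le_abs_self C) (pow_le_pow_left₀ (by positivity) ?_ N)
    (by positivity) (abs_nonneg _)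
  nlinarith [norm_add_le x h, norm_nonneg x, norm_nonneg h, mul_nonneg (norm_nonneg x) (norm_nonneg h)]

theorem pow (hP : IsContinuousPolynomial P) (k : ℕ) : IsContinuousPolynomial fun x => P x ^ k := by
  obtain ⟨ha, C, N, hC⟩ := isContinuousPolynomial_iff.1 hP
  refine isContinuousPolynomial_iff.2 ⟨fun x => (ha x).pow k, C ^ k, N * k, fun x => ?_⟩
  rw [norm_pow, pow_mul, ← mul_pow]
  exact pow_le_pow_left₀ (norm_nonneg _) (hC x) k

theorem const_mul (hP : IsContinuousPolynomial P) (a : ℂ) :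
    IsContinuousPolynomial fun x => a * P x := by
  obtain ⟨ha, C, N, hC⟩ := isContinuousPolynomial_iff.1 hP
  refine isContinuousPolynomial_iff.2 ⟨fun x => analyticAt_const.mul (ha x), ‖a‖ * C, N, fun x => ?_⟩
  rw [norm_mul, mul_assoc]
  exact mul_le_mul_of_nonneg_left (hC x) (norm_nonneg _)

theorem comp_smul (hP : IsContinuousPolynomial P) (a : ℂ) :
    IsContinuousPolynomial fun x => P (a • x) := by
  obtain ⟨ha, C, N, hC⟩ := isContinuousPolynomial_iff.1 hP
  refine isContinuousPolynomial_iff.2 ⟨fun x => (ha (a • x)).comp_of_eq (by fun_prop) rfl,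
    |C| * (1 + ‖a‖) ^ N, N, fun x => (hC _).trans ?_⟩
  rw [mul_assoc, ← mul_pow]
  refine mul_le_mul (le_abs_self C) (pow_le_pow_left₀ (by positivity) ?_ N)
    (by positivity) (abs_nonneg _)
  rw [norm_smul]
  nlinarith [norm_nonneg x, norm_nonneg a, mul_nonneg (norm_nonneg a) (norm_nonneg x)]

end IsContinuousPolynomial

end Analytic

end BoundedType

namespace BoundedType

open Filter Metric

/-! ### Riemann domains, distances and domain-bounded sets -/

section Domains

variable {E : Type*} [NormedAddCommGroup E] [NormedSpace ℂ E]
variable {X : Type*} [TopologicalSpace X]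

/-- A section over the ball with open range is itself the inverse chart. Continuity of `p` is
required only on that range, so that the result applies to the spectrum, where `p` is not assumed to
be a local homeomorphism. -/
theorem ofReal_le_distTo {p : X → E} {x : X} {r : ℝ} (hr : 0 < r) (σ : ball (p x) r → X)
    (hσ : Continuous σ) (hpσ : ∀ y, p (σ y) = y) (hopen : IsOpen (Set.range σ))
    (hp : ContinuousOn p (Set.range σ)) (hx : σ ⟨p x, mem_ball_self hr⟩ = x) :
    ENNReal.ofReal r ≤ distTo p x := by
  classical
  let s : E → X := fun y => if h : y ∈ ball (p x) r then σ ⟨y, h⟩ else x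
  have hs : ∀ y : ball (p x) r, s y = σ y := fun y => dif_pos y.2
  let e : OpenPartialHomeomorph X E :=
    { toFun := p
      invFun := s
      source := Set.range σ
      target := ball (p x) r
      map_source' := by
        rintro _ ⟨y, rfl⟩
        rw [hpσ]
        exact y.2
      map_target' := fun y hy => ⟨⟨y, hy⟩, (hs ⟨y, hy⟩).symm⟩
      left_inv' := by
        rintro _ ⟨y, rfl⟩
        rw [hpσ, hs]
      right_inv' := fun y hy => by
        rw [hs ⟨y, hy⟩, hpσ]
      open_source := hopen
      open_target := isOpen_ball
      continuousOn_toFun := hp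
      continuousOn_invFun := by
        rw [continuousOn_iff_continuous_domRestrict]
        exact hσ.congr fun y => (hs y).symm }
  refine le_iSup₂_of_le r ⟨hr, e, ⟨_, hx⟩, rfl, fun _ _ => rfl⟩ le_rfl

theorem ofReal_le_distTo_of_isLocalHomeomorph {p : X → E} (hp : IsLocalHomeomorph p) {x : X} {r : ℝ}
    (hr : 0 < r) (σ : ball (p x) r → X) (hσ : Continuous σ) (hpσ : ∀ y, p (σ y) = y)
    (hx : σ ⟨p x, mem_ball_self hr⟩ = x) : ENNReal.ofReal r ≤ distTo p x := by
  refine ofReal_le_distTo hr σ hσ hpσ ?_ hp.continuous.continuousOn hx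
  have h : p ∘ σ = Subtype.val := funext hpσ
  have h1 : IsLocalHomeomorph (p ∘ σ) := by
    rw [h]
    exact isOpen_ball.isOpenEmbedding_subtypeVal.isLocalHomeomorph
  exact (IsLocalHomeomorph.of_comp h1 hp hσ).isOpenMap.isOpen_range

variable {V : Set E}

theorem isRiemannDomain_subtypeVal (hV : IsOpen V) : IsRiemannDomain (Subtype.val : V → E) :=
  ⟨inferInstance, hV.isOpenEmbedding_subtypeVal.isLocalHomeomorph⟩

theorem ofReal_le_distTo_subtypeVal (hV : IsOpen V) {x : V} {r : ℝ} (hr : 0 < r)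
    (h : ball (x : E) r ⊆ V) : ENNReal.ofReal r ≤ distTo Subtype.val x :=
  ofReal_le_distTo_of_isLocalHomeomorph (isRiemannDomain_subtypeVal hV).isLocalHomeomorph hr
    (Set.inclusion h) (continuous_inclusion h) (fun _ => rfl) rfl

theorem ball_subset_range_of_lt_distTo {p : X → E} {x : X} {r : ℝ}
    (h : ENNReal.ofReal r < distTo p x) : ball (p x) r ⊆ Set.range p := by
  obtain ⟨s, hs⟩ := lt_iSup_iff.1 h
  obtain ⟨⟨hs0, e, hx, ht, he⟩, hlt⟩ := lt_iSup_iff.1 hs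
  intro y hy
  have hrs : r < s := (ENNReal.ofReal_lt_ofReal_iff hs0).1 hlt
  have hy' : y ∈ e.target := by
    rw [ht]
    exact ball_subset_ball hrs.le hy
  have h1 := he (e.map_target hy')
  rw [e.right_inv hy'] at h1
  exact ⟨_, h1.symm⟩

theorem IsDomainBounded.exists_ball_subset {p : X → E} {A : Set X} (hA : IsDomainBounded p A) :
    ∃ R δ : ℝ, 0 < δ ∧ ∀ x ∈ A, ‖p x‖ ≤ R ∧ ball (p x) δ ⊆ Set.range p := by
  obtain ⟨hb, hd⟩ := hA
  obtain ⟨R, hR⟩ := isBounded_iff_forall_norm_le.1 hb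
  obtain ⟨c, hc0, hc⟩ := exists_between hd
  have hctop : c ≠ ⊤ := hc.ne_top
  refine ⟨R, c.toReal, ENNReal.toReal_pos hc0.ne' hctop, fun x hx =>
    ⟨hR _ ⟨x, hx, rfl⟩, ball_subset_range_of_lt_distTo ?_⟩⟩
  rw [ENNReal.ofReal_toReal hctop]
  exact hc.trans_le (iInf₂_le x hx)

theorem isDomainBounded_subtypeVal_iff (hV : IsOpen V) {A : Set V} :
    IsDomainBounded Subtype.val A ↔
      ∃ R δ : ℝ, 0 < δ ∧ ∀ x ∈ A, ‖(x : E)‖ ≤ R ∧ ball (x : E) δ ⊆ V := by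
  constructor
  · intro hA
    simpa only [Subtype.range_coe] using hA.exists_ball_subset
  · rintro ⟨R, δ, hδ, h⟩
    refine ⟨isBounded_iff_forall_norm_le.2 ⟨R, ?_⟩, ?_⟩
    · rintro _ ⟨x, hx, rfl⟩
      exact (h x hx).1
    · exact lt_of_lt_of_le (ENNReal.ofReal_pos.2 hδ)
        (le_iInf₂ fun x hx => ofReal_le_distTo_subtypeVal hV hδ (h x hx).2)

theorem isHolomorphic_comp_subtypeVal {F : E → ℂ} (hF : ∀ x ∈ V, AnalyticAt ℂ F x) :
    IsHolomorphic (Subtype.val : V → E) (F ∘ Subtype.val) := fun x =>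
  ⟨F, hF x x.2, .of_forall fun _ => rfl⟩

/-- The extension by zero of a function on `V`. -/
def zeroExt (f : V → ℂ) : E → ℂ := Function.extend Subtype.val f 0

@[simp] theorem zeroExt_apply (f : V → ℂ) (x : V) : zeroExt f x = f x :=
  Subtype.val_injective.extend_apply f 0 x

theorem IsHolomorphic.analyticAt_zeroExt (hV : IsOpen V) {f : V → ℂ}
    (hf : IsHolomorphic (Subtype.val : V → E) f) {x : E} (hx : x ∈ V) :
    AnalyticAt ℂ (zeroExt f) x := by
  obtain ⟨F, hF, hfF⟩ := hf ⟨x, hx⟩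
  refine hF.congr ?_
  have h := hV.isOpenEmbedding_subtypeVal.map_nhds_eq ⟨x, hx⟩
  rw [← h]
  exact hfF.mono fun y hy => by simpa using hy.symm

end Domains

/-! ### The exhaustion of an open set and its polynomial hulls -/

section Hulls

variable {E : Type*} [NormedAddCommGroup E] [NormedSpace ℂ E] {U : Set E}

theorem mem_exhaustion_iff {m : ℕ} (hm : 1 ≤ m) {x : E} :
    x ∈ exhaustion U m ↔ ‖x‖ ≤ m ∧ ball x (1 / m) ⊆ U := by
  have hm0 : (0 : ℝ) < 1 / m := by
    have : (0 : ℝ) < m := by exact_mod_cast hm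
    positivity
  have key : ENNReal.ofReal (1 / m) ≤ infEDist x Uᶜ ↔ ball x (1 / m) ⊆ U := by
    rw [le_infEDist]
    constructor
    · intro h y hy
      by_contra hyU
      have h1 := h y hyU
      rw [edist_dist, ENNReal.ofReal_le_ofReal_iff dist_nonneg, dist_comm] at h1
      exact absurd (mem_ball.1 hy) (not_lt.2 h1)
    · intro h y hy
      rw [edist_dist]
      refine ENNReal.ofReal_le_ofReal (not_lt.1 fun hlt => hy (h ?_))
      rwa [mem_ball, dist_comm]
  constructor
  · rintro ⟨-, h1, h2⟩
    exact ⟨h1, key.1 h2⟩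
  · rintro ⟨h1, h2⟩
    exact ⟨h2 (mem_ball_self hm0), h1, key.2 h2⟩

theorem exhaustion_subset (m : ℕ) : exhaustion U m ⊆ U := fun _ h => h.1

theorem exhaustion_mono {m n : ℕ} (hm : 1 ≤ m) (hmn : m ≤ n) :
    exhaustion U m ⊆ exhaustion U n := by
  intro x hx
  rw [mem_exhaustion_iff hm] at hx
  rw [mem_exhaustion_iff (hm.trans hmn)]
  have h1 : (m : ℝ) ≤ n := by exact_mod_cast hmn
  have h2 : (0 : ℝ) < m := by exact_mod_cast hm
  exact ⟨hx.1.trans h1, (ball_subset_ball (one_div_le_one_div_of_le h2 h1)).trans hx.2⟩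

theorem exists_exhaustion_superset {R δ : ℝ} (hδ : 0 < δ) :
    ∃ m : ℕ, 1 ≤ m ∧ ∀ x : E, ‖x‖ ≤ R → ball x δ ⊆ U → x ∈ exhaustion U m := by
  obtain ⟨m, hm⟩ := exists_nat_ge (max 1 (max R (1 / δ)))
  have hm1 : (1 : ℝ) ≤ m := (le_max_left _ _).trans hm
  have hm1' : 1 ≤ m := by exact_mod_cast hm1
  refine ⟨m, hm1', fun x hx hb => (mem_exhaustion_iff hm1').2
    ⟨hx.trans (((le_max_left _ _).trans (le_max_right _ _)).trans hm),
      (ball_subset_ball ?_).trans hb⟩⟩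
  rw [one_div_le (by linarith) hδ]
  exact ((le_max_right _ _).trans (le_max_right _ _)).trans hm

theorem exists_mem_exhaustion (hU : IsOpen U) {x : E} (hx : x ∈ U) :
    ∃ m : ℕ, 1 ≤ m ∧ x ∈ exhaustion U m := by
  obtain ⟨δ, hδ, h⟩ := Metric.isOpen_iff.1 hU x hx
  obtain ⟨m, hm, h'⟩ := exists_exhaustion_superset (U := U) (R := ‖x‖) hδ
  exact ⟨m, hm, h' x le_rfl h⟩

theorem isDomainBounded_exhaustion (hU : IsOpen U) {m : ℕ} (hm : 1 ≤ m) :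
    IsDomainBounded Subtype.val {x : U | (x : E) ∈ exhaustion U m} := by
  have hm0 : (0 : ℝ) < m := by exact_mod_cast hm
  exact (isDomainBounded_subtypeVal_iff hU).2 ⟨m, 1 / m, by positivity, fun x hx =>
    (mem_exhaustion_iff hm).1 hx⟩

theorem isBoundedType_subtypeVal_iff (hU : IsOpen U) {f : U → ℂ} :
    IsBoundedType Subtype.val f ↔
      ∀ m : ℕ, 1 ≤ m → ∃ C, ∀ x : U, (x : E) ∈ exhaustion U m → ‖f x‖ ≤ C := by
  constructor
  · intro h m hm
    obtain ⟨C, hC⟩ := isBounded_iff_forall_norm_le.1 (h _ (isDomainBounded_exhaustion hU hm))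
    exact ⟨C, fun x hx => hC _ ⟨x, hx, rfl⟩⟩
  · intro h A hA
    obtain ⟨R, δ, hδ, hA⟩ := (isDomainBounded_subtypeVal_iff hU).1 hA
    obtain ⟨m, hm, hsub⟩ := exists_exhaustion_superset (U := U) (R := R) hδ
    obtain ⟨C, hC⟩ := h m hm
    refine isBounded_iff_forall_norm_le.2 ⟨C, ?_⟩
    rintro _ ⟨x, hx, rfl⟩
    exact hC x (hsub x (hA x hx).1 (hA x hx).2)

theorem mem_Hb_comp_subtypeVal (hU : IsOpen U) {F : E → ℂ} (hF : ∀ x ∈ U, AnalyticAt ℂ F x)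
    (hb : ∀ m : ℕ, 1 ≤ m → ∃ C, ∀ x ∈ exhaustion U m, ‖F x‖ ≤ C) :
    F ∘ Subtype.val ∈ Hb (Subtype.val : U → E) :=
  ⟨isHolomorphic_comp_subtypeVal hF, (isBoundedType_subtypeVal_iff hU).2 fun m hm =>
    let ⟨C, hC⟩ := hb m hm
    ⟨C, fun x hx => hC x hx⟩⟩

theorem mem_polyHull_iff {A : Set E} {x : E} : x ∈ polyHull A ↔
    ∀ P : E → ℂ, IsContinuousPolynomial P → ∀ C : ℝ, 0 ≤ C → (∀ a ∈ A, ‖P a‖ ≤ C) → ‖P x‖ ≤ C := by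
  constructor
  · intro h P hP C hC0 hC
    have h1 : ‖P x‖ₑ ≤ ENNReal.ofReal C := (h P hP).trans <| iSup₂_le fun a ha => by
      rw [← ofReal_norm]
      exact ENNReal.ofReal_le_ofReal (hC a ha)
    rwa [← ofReal_norm, ENNReal.ofReal_le_ofReal_iff hC0] at h1
  · intro h P hP
    by_cases htop : (⨆ a ∈ A, ‖P a‖ₑ) = ⊤
    · rw [htop]
      exact le_top
    · rw [← ENNReal.ofReal_toReal htop, ← ofReal_norm]
      refine ENNReal.ofReal_le_ofReal (h P hP _ ENNReal.toReal_nonneg fun a ha => ?_)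
      have h1 : ‖P a‖ₑ ≤ ⨆ a ∈ A, ‖P a‖ₑ := le_iSup₂ (f := fun a (_ : a ∈ A) => ‖P a‖ₑ) a ha
      have h2 := ENNReal.toReal_mono htop h1
      rwa [toReal_enorm] at h2

theorem subset_polyHull (A : Set E) : A ⊆ polyHull A := fun a ha =>
  mem_polyHull_iff.2 fun _ _ _ _ h => h a ha

theorem subset_hullUnion (hU : IsOpen U) : U ⊆ hullUnion U := fun _ hx =>
  let ⟨m, hm, h⟩ := exists_mem_exhaustion hU hx
  ⟨m, hm, subset_polyHull _ h⟩

/-- Hulls commute with translations: the shift of `U_m` by a vector shorter than `1 / (2m)` lies in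
`U_{2m}`, and `P` may be shifted accordingly. -/
theorem ball_subset_polyHull {m : ℕ} (hm : 1 ≤ m) {x : E} (hx : x ∈ polyHull (exhaustion U m)) :
    ball x (1 / (2 * m)) ⊆ polyHull (exhaustion U (2 * m)) := by
  have hm1 : (1 : ℝ) ≤ m := by exact_mod_cast hm
  intro y hy
  refine mem_polyHull_iff.2 fun P hP C hC h => ?_
  have h1 := mem_polyHull_iff.1 hx _ (hP.comp_add (y - x)) C hC fun u hu => h _ ?_
  · simpa using h1
  · rw [mem_exhaustion_iff hm] at hu
    rw [mem_exhaustion_iff (by omega)]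
    have hyx : ‖y - x‖ < 1 / (2 * m) := by rwa [mem_ball, dist_eq_norm] at hy
    have h2 : 1 / (2 * (m : ℝ)) + 1 / (2 * m) = 1 / m := by
      field_simp
      norm_num
    have h3 : 1 / (2 * (m : ℝ)) ≤ m := by
      rw [div_le_iff₀ (by positivity)]
      nlinarith
    push_cast
    refine ⟨(norm_add_le _ _).trans (by linarith [hu.1]), fun z hz => hu.2 ?_⟩
    rw [mem_ball, dist_eq_norm] at hz ⊢
    calc ‖z - u‖ = ‖(z - (u + (y - x))) + (y - x)‖ := by congr 1; abel
      _ ≤ ‖z - (u + (y - x))‖ + ‖y - x‖ := norm_add_le _ _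
      _ < 1 / m := by linarith

theorem isOpen_hullUnion : IsOpen (hullUnion U) := by
  rw [Metric.isOpen_iff]
  rintro x ⟨m, hm, hx⟩
  have hm0 : (0 : ℝ) < m := by exact_mod_cast hm
  exact ⟨1 / (2 * m), by positivity, fun y hy => ⟨2 * m, by omega, ball_subset_polyHull hm hx hy⟩⟩

theorem smul_mem_of_norm_eq_one (hbal : Balanced ℂ U) {m : ℕ} (hm : 1 ≤ m) {x : E}
    (hx : x ∈ exhaustion U m) {ζ : ℂ} (hζ : ‖ζ‖ = 1) : ζ • x ∈ exhaustion U m := by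
  rw [mem_exhaustion_iff hm] at hx ⊢
  have hζ0 : ζ ≠ 0 := by
    rintro rfl
    simp at hζ
  refine ⟨by rw [norm_smul, hζ, one_mul]; exact hx.1, fun y hy => ?_⟩
  have h1 : ζ⁻¹ • y ∈ U := hx.2 (by
    rw [mem_ball, dist_eq_norm] at hy ⊢
    have : ζ⁻¹ • y - x = ζ⁻¹ • (y - ζ • x) := by rw [smul_sub, inv_smul_smul₀ hζ0]
    rwa [this, norm_smul, norm_inv, hζ, inv_one, one_mul])
  have := hbal.smul_mem hζ.le h1
  rwa [smul_inv_smul₀ hζ0] at this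

/-- `U_m` is invariant under rotations, and the maximum principle for `ζ ↦ P (ζ • u)` on the unit
disc covers the remaining scalars. -/
theorem smul_mem_polyHull_exhaustion (hbal : Balanced ℂ U) {m : ℕ} (hm : 1 ≤ m) {x : E}
    (hx : x ∈ polyHull (exhaustion U m)) {a : ℂ} (ha : ‖a‖ ≤ 1) :
    a • x ∈ polyHull (exhaustion U m) := by
  refine mem_polyHull_iff.2 fun P hP C hC h =>
    mem_polyHull_iff.1 hx _ (hP.comp_smul a) C hC fun u hu => ?_
  have hd : Differentiable ℂ fun ζ : ℂ => P (ζ • u) := fun ζ =>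
    (hP.analyticAt _).differentiableAt.comp ζ (by fun_prop)
  refine Complex.norm_le_of_forall_mem_frontier_norm_le (f := fun ζ : ℂ => P (ζ • u))
    (U := ball (0 : ℂ) 1) isBounded_ball hd.diffContOnCl (fun ζ hζ => ?_) ?_
  · rw [frontier_ball _ one_ne_zero, mem_sphere_zero_iff_norm] at hζ
    exact h _ (smul_mem_of_norm_eq_one hbal hm hu hζ)
  · rw [closure_ball _ one_ne_zero]
    simpa using ha

theorem balanced_hullUnion (hbal : Balanced ℂ U) : Balanced ℂ (hullUnion U) :=
  balanced_iff_smul_mem.2 fun {_} ha {_} ⟨m, hm, hx⟩ => ⟨m, hm, smul_mem_polyHull_exhaustion hbal hm hx ha⟩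

theorem isPreconnected_of_balanced {V : Set E} (hV : Balanced ℂ V) : IsPreconnected V := by
  refine isPreconnected_of_forall 0 fun y hy => ⟨segment ℝ 0 y, ?_, left_mem_segment _ _ _,
    right_mem_segment _ _ _, (convex_segment _ _).isPreconnected⟩
  intro z hz
  rw [segment_eq_image] at hz
  obtain ⟨t, ht, rfl⟩ := hz
  have := hV.smul_mem (a := (t : ℂ)) (by
    rw [Complex.norm_real, Real.norm_of_nonneg ht.1]
    exact ht.2) hy
  simpa using this

theorem eqOn_hullUnion (hU : IsOpen U) (hne : U.Nonempty) (hbal : Balanced ℂ U) {F G : E → ℂ}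
    (hF : ∀ x ∈ hullUnion U, AnalyticAt ℂ F x) (hG : ∀ x ∈ hullUnion U, AnalyticAt ℂ G x)
    (h : Set.EqOn F G U) : Set.EqOn F G (hullUnion U) := by
  obtain ⟨x, hx⟩ := hne
  exact AnalyticOnNhd.eqOn_of_preconnected_of_eventuallyEq hF hG
    (isPreconnected_of_balanced (balanced_hullUnion hbal)) (subset_hullUnion hU hx)
    (h.eventuallyEq_of_mem (hU.mem_nhds hx))

/-! ### Extension to the union of the hulls -/

/-- The `n`-th Taylor coefficient at `0`. -/
def taylorZero (F : E → ℂ) (n : ℕ) : E [×n]→L[ℂ] ℂ :=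
  (n.factorial : ℂ)⁻¹ • iteratedFDeriv ℂ n F 0

/-- The sum of the Taylor series at `0`. -/
def taylorSum (F : E → ℂ) (x : E) : ℂ := ∑' n, taylorZero F n fun _ => x

/-- The ratio with which Taylor series converge on the hull of `U_m`. -/
def hullRatio (m : ℕ) : ℝ := (1 + 1 / (2 * (m : ℝ) ^ 2))⁻¹

theorem hullRatio_nonneg (m : ℕ) : 0 ≤ hullRatio m := by
  unfold hullRatio
  positivity

theorem hullRatio_lt_one {m : ℕ} (hm : 1 ≤ m) : hullRatio m < 1 := by
  have hm0 : (0 : ℝ) < m := by exact_mod_cast hm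
  refine inv_lt_one_of_one_lt₀ ?_
  have : 0 < 1 / (2 * (m : ℝ) ^ 2) := by positivity
  linarith

theorem zero_mem_of_balanced (hne : U.Nonempty) (hbal : Balanced ℂ U) : (0 : E) ∈ U :=
  hbal.zero_mem hne

/-- For `x ∈ U_m` and `R = 1 + 1 / (2m²)`, the point `R x` moves by at most `1 / (2m)` and so lies
in `U_{2m}`. Since `U` is balanced, the whole disc of radius `R` along `x` lies in `U`, and Cauchy's
estimate there gives the ratio `R⁻¹`, which is `hullRatio m`. -/
theorem taylorZero_of_mem_exhaustion (hbal : Balanced ℂ U) (hne : U.Nonempty)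
    {F : E → ℂ} (hF : ∀ x ∈ U, AnalyticAt ℂ F x) {m : ℕ} (hm : 1 ≤ m) {x : E}
    (hx : x ∈ exhaustion U m) :
    HasSum (fun n => taylorZero F n fun _ => x) (F x) ∧
      ∀ C, (∀ u ∈ exhaustion U (2 * m), ‖F u‖ ≤ C) →
        ∀ n, ‖taylorZero F n fun _ => x‖ ≤ C * hullRatio m ^ n := by
  have hm1 : (1 : ℝ) ≤ m := by exact_mod_cast hm
  have hx' := (mem_exhaustion_iff hm).1 hx
  set R : ℝ := 1 + 1 / (2 * (m : ℝ) ^ 2) with hR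
  have hRpos : 0 < 1 / (2 * (m : ℝ) ^ 2) := by positivity
  have hR1 : 1 < R := by linarith
  have hR0 : 0 < R := by linarith
  have hRx : ‖(R : ℂ) • x - x‖ ≤ 1 / (2 * m) := by
    have : (R : ℂ) • x - x = ((1 / (2 * (m : ℝ) ^ 2) : ℝ) : ℂ) • x := by
      rw [hR]
      push_cast
      rw [add_smul, one_smul, add_sub_cancel_left]
    rw [this, norm_smul, Complex.norm_real, Real.norm_of_nonneg hRpos.le]
    calc (1 / (2 * (m : ℝ) ^ 2) : ℝ) * ‖x‖ ≤ 1 / (2 * (m : ℝ) ^ 2) * (m : ℝ) := by gcongr; exact hx'.1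
      _ = 1 / (2 * (m : ℝ)) := by field_simp
  have hhalf : 1 / (2 * (m : ℝ)) + 1 / (2 * m) = 1 / m := by
    field_simp
    norm_num
  have hpos : 0 < 1 / (2 * (m : ℝ)) := by positivity
  have hR2m : (R : ℂ) • x ∈ exhaustion U (2 * m) := by
    rw [mem_exhaustion_iff (by omega)]
    push_cast
    refine ⟨?_, fun z hz => hx'.2 ?_⟩
    · have h3 : 1 / (2 * (m : ℝ)) ≤ m := by
        rw [div_le_iff₀ (by positivity)]
        nlinarith
      have := norm_add_le ((R : ℂ) • x - x) x
      rw [sub_add_cancel] at this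
      linarith [hx'.1]
    · rw [mem_ball, dist_eq_norm] at hz ⊢
      have := norm_add_le (z - (R : ℂ) • x) ((R : ℂ) • x - x)
      rw [sub_add_sub_cancel] at this
      linarith
  have hmem : ∀ ζ : ℂ, ‖ζ‖ ≤ R → (0 : E) + ζ • x ∈ U := fun ζ hζ => by
    have h1 := hbal.smul_mem (a := ζ / R) (by
      rw [norm_div, Complex.norm_real, Real.norm_of_nonneg hR0.le]
      exact div_le_one_of_le₀ hζ hR0.le) (exhaustion_subset _ hR2m)
    rwa [smul_smul, div_mul_cancel₀ _ (by exact_mod_cast hR0.ne'), ← zero_add (ζ • x)] at h1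
  have hd : ∀ ζ : ℂ, ‖ζ‖ ≤ R → DifferentiableAt ℂ (fun ζ : ℂ => F (0 + ζ • x)) ζ := fun ζ hζ =>
    (hF _ (hmem ζ hζ)).differentiableAt.comp ζ (by fun_prop)
  have h0 := hF 0 (zero_mem_of_balanced hne hbal)
  refine ⟨?_, fun C hC n => ?_⟩
  · have := hasSum_taylor_line h0 x hR1 fun ζ hζ =>
      (hd ζ (by simpa using (mem_ball.1 hζ).le)).differentiableWithinAt
    rw [zero_add] at this
    exact this
  · have h1 := norm_taylor_line_le h0 x (C := C) hR0 (DifferentiableOn.diffContOnCl fun ζ hζ =>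
      (hd ζ (by
        rw [closure_ball _ hR0.ne'] at hζ
        simpa using hζ)).differentiableWithinAt) (fun ζ hζ => by
          rw [zero_add]
          refine hC _ ?_
          have h2 := smul_mem_of_norm_eq_one hbal (by omega) hR2m (ζ := ζ / R) (by
            rw [norm_div, hζ, Complex.norm_real, Real.norm_of_nonneg hR0.le, div_self hR0.ne'])
          rwa [smul_smul, div_mul_cancel₀ _ (by exact_mod_cast hR0.ne')] at h2) n
    rw [hullRatio, inv_pow, ← div_eq_mul_inv]
    exact h1

/-- The key to the extension: Taylor terms are continuous polynomials, so their bounds on `U_m`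
persist on its hull by definition. -/
theorem norm_taylorZero_le (hbal : Balanced ℂ U) (hne : U.Nonempty)
    {F : E → ℂ} (hF : ∀ x ∈ U, AnalyticAt ℂ F x) {m : ℕ} (hm : 1 ≤ m) {C : ℝ} (hC0 : 0 ≤ C)
    (hC : ∀ u ∈ exhaustion U (2 * m), ‖F u‖ ≤ C) {x : E} (hx : x ∈ polyHull (exhaustion U m))
    (n : ℕ) : ‖taylorZero F n fun _ => x‖ ≤ C * hullRatio m ^ n :=
  mem_polyHull_iff.1 hx _ (isContinuousPolynomial_diag (taylorZero F n)) _
    (mul_nonneg hC0 (pow_nonneg (hullRatio_nonneg m) n)) fun _ hu =>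
      (taylorZero_of_mem_exhaustion hbal hne hF hm hu).2 C hC n

theorem taylorSum_eqOn (hU : IsOpen U) (hbal : Balanced ℂ U)
    {F : E → ℂ} (hF : ∀ x ∈ U, AnalyticAt ℂ F x) : Set.EqOn (taylorSum F) F U := fun x hx => by
  obtain ⟨m, hm, hxm⟩ := exists_mem_exhaustion hU hx
  exact (taylorZero_of_mem_exhaustion hbal ⟨x, hx⟩ hF hm hxm).1.tsum_eq

theorem norm_taylorSum_le (hbal : Balanced ℂ U) (hne : U.Nonempty)
    {F : E → ℂ} (hF : ∀ x ∈ U, AnalyticAt ℂ F x) {m : ℕ} (hm : 1 ≤ m) {C : ℝ} (hC0 : 0 ≤ C)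
    (hC : ∀ u ∈ exhaustion U (2 * m), ‖F u‖ ≤ C) {x : E} (hx : x ∈ polyHull (exhaustion U m)) :
    ‖taylorSum F x‖ ≤ C * (1 - hullRatio m)⁻¹ :=
  tsum_of_norm_bounded ((hasSum_geometric_of_lt_one (hullRatio_nonneg m)
    (hullRatio_lt_one hm)).mul_left C) (norm_taylorZero_le hbal hne hF hm hC0 hC hx)

theorem analyticAt_tsum {G : ℕ → E → ℂ} {u : ℕ → ℝ} (hu : Summable u) {x : E} {ρ : ℝ} (hρ : 0 < ρ)
    (hG : ∀ n, ∀ y ∈ ball x ρ, AnalyticAt ℂ (G n) y ∧ ‖G n y‖ ≤ u n) :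
    AnalyticAt ℂ (fun y => ∑' n, G n y) x := by
  have hu0 : ∀ n, 0 ≤ u n := fun n => (norm_nonneg _).trans (hG n x (mem_ball_self hρ)).2
  refine analyticAt_of_tendstoUniformlyOn (C := ∑' n, u n)
    (F := fun k y => ∑ n ∈ Finset.range k, G n y) hρ (fun k y hy => ⟨?_, ?_⟩)
    (tendstoUniformlyOn_tsum_nat hu fun n y hy => (hG n y hy).2)
  · exact Finset.analyticAt_fun_sum _ fun n _ => (hG n y hy).1
  · exact (norm_sum_le _ _).trans ((Finset.sum_le_sum fun n _ => (hG n y hy).2).trans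
      (hu.sum_le_tsum _ fun n _ => hu0 n))

theorem analyticAt_taylorSum (hbal : Balanced ℂ U) (hne : U.Nonempty)
    {F : E → ℂ} (hF : ∀ x ∈ U, AnalyticAt ℂ F x)
    (hb : ∀ m : ℕ, 1 ≤ m → ∃ C, ∀ x ∈ exhaustion U m, ‖F x‖ ≤ C) {x : E} (hx : x ∈ hullUnion U) :
    AnalyticAt ℂ (taylorSum F) x := by
  obtain ⟨m, hm, hx⟩ := hx
  have hm0 : (0 : ℝ) < m := by exact_mod_cast hm
  obtain ⟨C, hC⟩ := hb (2 * (2 * m)) (by omega)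
  have hC' : ∀ u ∈ exhaustion U (2 * (2 * m)), ‖F u‖ ≤ |C| := fun u hu =>
    (hC u hu).trans (le_abs_self C)
  exact analyticAt_tsum ((summable_geometric_of_lt_one (hullRatio_nonneg (2 * m))
    (hullRatio_lt_one (by omega))).mul_left |C|) (ρ := 1 / (2 * m)) (by positivity) fun n y hy =>
      ⟨analyticOnNhd_diag _ Set.univ y trivial, norm_taylorZero_le hbal hne hF (by omega)
        (abs_nonneg C) hC' (ball_subset_polyHull hm hx hy) n⟩

end Hulls

end BoundedType

namespace BoundedType

open Filter Metric

/-! ### The union of the hulls is the `H_b`-envelope of a balanced open set. -/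

section Envelope

variable {E : Type*} [NormedAddCommGroup E] [NormedSpace ℂ E] {U : Set E}

/-- The extension of `f ∈ H_b(U)` to the union of the polynomial hulls. -/
def hullExt (f : Hb (Subtype.val : U → E)) : E → ℂ := taylorSum (zeroExt (f : U → ℂ))

theorem Hb.analyticAt_zeroExt (hU : IsOpen U) (f : Hb (Subtype.val : U → E)) :
    ∀ x ∈ U, AnalyticAt ℂ (zeroExt (f : U → ℂ)) x := fun _ hx => f.2.1.analyticAt_zeroExt hU hx

theorem Hb.exists_norm_zeroExt_le (hU : IsOpen U) (f : Hb (Subtype.val : U → E)) {m : ℕ}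
    (hm : 1 ≤ m) : ∃ C, ∀ x ∈ exhaustion U m, ‖zeroExt (f : U → ℂ) x‖ ≤ C := by
  obtain ⟨C, hC⟩ := (isBoundedType_subtypeVal_iff hU).1 f.2.2 m hm
  refine ⟨C, fun x hx => ?_⟩
  have := hC ⟨x, exhaustion_subset m hx⟩ hx
  rwa [← zeroExt_apply (f : U → ℂ)] at this

theorem analyticAt_hullExt (hU : IsOpen U) (hbal : Balanced ℂ U) (hne : U.Nonempty)
    (f : Hb (Subtype.val : U → E)) : ∀ x ∈ hullUnion U, AnalyticAt ℂ (hullExt f) x := fun _ hx =>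
  analyticAt_taylorSum hbal hne (Hb.analyticAt_zeroExt hU f)
    (fun _ hm => Hb.exists_norm_zeroExt_le hU f hm) hx

theorem hullExt_apply (hU : IsOpen U) (hbal : Balanced ℂ U) (f : Hb (Subtype.val : U → E)) (x : U) :
    hullExt f x = (f : U → ℂ) x := by
  rw [← zeroExt_apply (f : U → ℂ)]
  exact taylorSum_eqOn hU hbal (Hb.analyticAt_zeroExt hU f) x.2

theorem hullExt_eqOn (hU : IsOpen U) (hbal : Balanced ℂ U) (hne : U.Nonempty)
    (f : Hb (Subtype.val : U → E)) {G : E → ℂ} (hG : ∀ x ∈ hullUnion U, AnalyticAt ℂ G x)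
    (h : ∀ x : U, G x = (f : U → ℂ) x) : Set.EqOn (hullExt f) G (hullUnion U) :=
  eqOn_hullUnion hU hne hbal (analyticAt_hullExt hU hbal hne f) hG fun x hx =>
    (hullExt_apply hU hbal f ⟨x, hx⟩).trans (h ⟨x, hx⟩).symm

theorem norm_hullExt_le (hU : IsOpen U) (hbal : Balanced ℂ U) (hne : U.Nonempty)
    (f : Hb (Subtype.val : U → E)) {m : ℕ} (hm : 1 ≤ m) {C : ℝ} (hC0 : 0 ≤ C)
    (hC : ∀ u : U, (u : E) ∈ exhaustion U (2 * m) → ‖(f : U → ℂ) u‖ ≤ C) {x : E}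
    (hx : x ∈ polyHull (exhaustion U m)) : ‖hullExt f x‖ ≤ C * (1 - hullRatio m)⁻¹ :=
  norm_taylorSum_le hbal hne (Hb.analyticAt_zeroExt hU f) hm hC0 (fun u hu => by
    have := hC ⟨u, exhaustion_subset _ hu⟩ hu
    rwa [← zeroExt_apply (f : U → ℂ)] at this) hx

theorem isHbExtension_hullUnion (hU : IsOpen U) (hbal : Balanced ℂ U) (hne : U.Nonempty) :
    IsHbExtension (Subtype.val : U → E) (Subtype.val : hullUnion U → E)
      (Set.inclusion (subset_hullUnion hU)) := by
  refine ⟨isRiemannDomain_subtypeVal hU, isRiemannDomain_subtypeVal isOpen_hullUnion,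
    ⟨continuous_inclusion _, rfl⟩, fun f hf => ?_⟩
  let f' : Hb (Subtype.val : U → E) := ⟨f, hf⟩
  refine ⟨hullExt f' ∘ Subtype.val,
    ⟨isHolomorphic_comp_subtypeVal (analyticAt_hullExt hU hbal hne f'), funext fun x =>
      hullExt_apply hU hbal f' x⟩, ?_⟩
  rintro h ⟨hh, hhf⟩
  have := hullExt_eqOn hU hbal hne f' (G := zeroExt h)
    (fun x hx => IsHolomorphic.analyticAt_zeroExt isOpen_hullUnion hh hx) fun x => by
      have h1 := zeroExt_apply h (Set.inclusion (subset_hullUnion hU) x)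
      exact h1.trans (congrFun hhf x)
  funext x
  rw [Function.comp_apply, this x.2, zeroExt_apply]

/-- Outside the union of the hulls there are polynomials that are small on the sets `U_m` and large
at the given point. -/
theorem exists_polynomial_separating {y : E} (hy : y ∉ hullUnion U) (m : ℕ) :
    ∃ Q : E → ℂ, IsContinuousPolynomial Q ∧
      (∀ u ∈ exhaustion U (m + 1), ‖Q u‖ ≤ (1 / 2) ^ m) ∧ (m : ℝ) ≤ ‖Q y‖ := by
  have h1 : y ∉ polyHull (exhaustion U (m + 1)) := fun h => hy ⟨m + 1, by omega, h⟩
  rw [mem_polyHull_iff] at h1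
  push Not at h1
  obtain ⟨P, hP, C, hC0, hC, hlt⟩ := h1
  -- With `D` strictly between the bound on `U_{m+1}` and `‖P y‖`, high powers of `P / D` are as
  -- small as desired on the set and as large as desired at `y`.
  obtain ⟨D, hCD, hD⟩ := exists_between hlt
  have hD0 : 0 < D := hC0.trans_lt hCD
  have ht1 : Tendsto (fun k : ℕ => (C / D) ^ k) atTop (𝓝 0) :=
    tendsto_pow_atTop_nhds_zero_of_lt_one (by positivity) ((div_lt_one hD0).2 hCD)
  have ht2 : Tendsto (fun k : ℕ => (‖P y‖ / D) ^ k) atTop atTop :=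
    tendsto_pow_atTop_atTop_of_one_lt ((one_lt_div hD0).2 hD)
  obtain ⟨k, hk1, hk2⟩ := ((ht1.eventually (gt_mem_nhds (show (0 : ℝ) < (1 / 2) ^ m by
    positivity))).and (ht2.eventually_ge_atTop (m : ℝ))).exists
  refine ⟨fun x => ((D : ℂ)⁻¹ * P x) ^ k, (hP.const_mul _).pow k, fun u hu => ?_, ?_⟩
  · rw [norm_pow, norm_mul, norm_inv, Complex.norm_real, Real.norm_of_nonneg hD0.le,
      inv_mul_eq_div]
    refine le_trans ?_ hk1.le
    gcongr
    exact hC u hu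
  · rw [norm_pow, norm_mul, norm_inv, Complex.norm_real, Real.norm_of_nonneg hD0.le,
      inv_mul_eq_div]
    exact hk2

/-- On the hull of `U_k` the terms with `m ≥ k` are geometrically small because `U_k ⊆ U_{m+1}`; the
finitely many others are bounded since polynomials are bounded on bounded sets. -/
theorem exists_summable_bound {Q : ℕ → E → ℂ} (hQ : ∀ m, IsContinuousPolynomial (Q m))
    (hsmall : ∀ m, ∀ u ∈ exhaustion U (m + 1), ‖Q m u‖ ≤ (1 / 2) ^ m) {k : ℕ} (hk : 1 ≤ k) :
    ∃ u : ℕ → ℝ, Summable u ∧ ∀ m, ∀ x ∈ polyHull (exhaustion U k), ‖Q m x‖ ≤ u m := by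
  choose B hB using fun m => (hQ m).exists_norm_le (k : ℝ)
  refine ⟨fun m => (1 / 2) ^ m + if m < k then |B m| else 0, ?_, fun m x hx => ?_⟩
  · refine (summable_geometric_of_lt_one (by norm_num) (by norm_num)).add
      (summable_of_ne_finset_zero (s := Finset.range k) fun m hm => ?_)
    rw [if_neg (by simpa using hm)]
  · refine mem_polyHull_iff.1 hx _ (hQ m) _ (by dsimp only; split_ifs <;> positivity) fun a ha => ?_
    dsimp only
    split_ifs with h
    · have h1 := hB m a ha.2.1
      have h2 : (0 : ℝ) ≤ (1 / 2) ^ m := by positivity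
      linarith [le_abs_self (B m)]
    · rw [add_zero]
      exact hsmall m a (exhaustion_mono hk (by omega) ha)

/-- Banach–Steinhaus on ℓ^∞: if every `∑ θ_m Q_m` were bounded along `ys`, the evaluations would be
uniformly bounded functionals of `θ`. Testing on unit vectors bounds all `Q_m (ys n)` by one
constant, hence also `Q_m y` by continuity, which contradicts `m ≤ ‖Q_m y‖`. -/
theorem exists_unbounded_along (hU : IsOpen U) (hbal : Balanced ℂ U) (hne : U.Nonempty) {y : E}
    (hy : y ∉ hullUnion U) {ys : ℕ → E} (hys : ∀ n, ys n ∈ hullUnion U)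
    (hlim : Tendsto ys atTop (𝓝 y)) :
    ∃ f : Hb (Subtype.val : U → E), ¬ ∃ C, ∀ n, ‖hullExt f (ys n)‖ ≤ C := by
  choose Q hQ hsmall hlarge using exists_polynomial_separating hy
  choose u hu hQu using fun k : {k : ℕ // 1 ≤ k} => exists_summable_bound hQ hsmall k.2
  let F : BoundedContinuousFunction ℕ ℂ → E → ℂ := fun θ x => ∑' m, θ m * Q m x
  have hterm : ∀ (θ : BoundedContinuousFunction ℕ ℂ) (k : {k : ℕ // 1 ≤ k}) (m : ℕ),
      ∀ x ∈ polyHull (exhaustion U k), ‖θ m * Q m x‖ ≤ ‖θ‖ * u k m := fun θ k m x hx => by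
    rw [norm_mul]
    exact mul_le_mul (θ.norm_coe_le_norm m) (hQu k m x hx) (norm_nonneg _) (norm_nonneg _)
  have hFa : ∀ θ, ∀ x ∈ hullUnion U, AnalyticAt ℂ (F θ) x := by
    rintro θ x ⟨m, hm, hx⟩
    have hm0 : (0 : ℝ) < m := by exact_mod_cast hm
    exact analyticAt_tsum ((hu ⟨2 * m, by omega⟩).mul_left ‖θ‖) (ρ := 1 / (2 * m)) (by positivity)
      fun n y hy => ⟨analyticAt_const.mul ((hQ n).analyticAt y),
        hterm θ _ n y (ball_subset_polyHull hm hx hy)⟩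
  have hFb : ∀ θ (k : {k : ℕ // 1 ≤ k}), ∀ x ∈ polyHull (exhaustion U k),
      ‖F θ x‖ ≤ ∑' m, ‖θ‖ * u k m := fun θ k x hx =>
    tsum_of_norm_bounded ((hu k).mul_left ‖θ‖).hasSum fun m => hterm θ k m x hx
  let f : BoundedContinuousFunction ℕ ℂ → Hb (Subtype.val : U → E) := fun θ =>
    ⟨F θ ∘ Subtype.val, mem_Hb_comp_subtypeVal hU
      (fun x hx => hFa θ x (subset_hullUnion hU hx))
      fun m hm => ⟨_, fun x hx => hFb θ ⟨m, hm⟩ x (subset_polyHull _ hx)⟩⟩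
  have hf : ∀ θ n, hullExt (f θ) (ys n) = F θ (ys n) := fun θ n =>
    hullExt_eqOn hU hbal hne (f θ) (hFa θ) (fun _ => rfl) (hys n)
  by_contra! hcon
  have hsum : ∀ n, ∃ c, Summable c ∧ ∀ m, ‖Q m (ys n)‖ ≤ c m := fun n => by
    obtain ⟨m, hm, hx⟩ := hys n
    exact ⟨u ⟨m, hm⟩, hu _, fun i => hQu ⟨m, hm⟩ i _ hx⟩
  choose c hc hQc using hsum
  have hsumm : ∀ n (θ : BoundedContinuousFunction ℕ ℂ), Summable fun m => θ m * Q m (ys n) :=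
    fun n θ => .of_norm_bounded ((hc n).mul_left ‖θ‖) fun m => by
      rw [norm_mul]
      exact mul_le_mul (θ.norm_coe_le_norm m) (hQc n m) (norm_nonneg _) (norm_nonneg _)
  let L : ℕ → BoundedContinuousFunction ℕ ℂ →L[ℂ] ℂ := fun n =>
    LinearMap.mkContinuous
      { toFun := fun θ => F θ (ys n)
        map_add' := fun θ θ' => by
          change ∑' m, (θ m + θ' m) * Q m (ys n) = _
          simp only [add_mul]
          exact (hsumm n θ).tsum_add (hsumm n θ')
        map_smul' := fun a θ => by
          change ∑' m, (a * θ m) * Q m (ys n) = a * _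
          simp only [mul_assoc]
          exact tsum_mul_left }
      (∑' m, c n m) fun θ => by
        rw [mul_comm, ← tsum_mul_left]
        exact tsum_of_norm_bounded ((hc n).mul_left ‖θ‖).hasSum fun m => by
          rw [norm_mul]
          exact mul_le_mul (θ.norm_coe_le_norm m) (hQc n m) (norm_nonneg _) (norm_nonneg _)
  obtain ⟨C, hC⟩ := banach_steinhaus (g := L) fun θ => by
    obtain ⟨C, hC⟩ := hcon (f θ)
    exact ⟨C, fun n => by
      have := hC n
      rwa [hf] at this⟩
  have hQC : ∀ m n, ‖Q m (ys n)‖ ≤ C := fun m n => by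
    let θ : BoundedContinuousFunction ℕ ℂ :=
      BoundedContinuousFunction.ofNormedAddCommGroupDiscrete (Pi.single m 1) 1 fun j => by
        by_cases h : j = m
        · subst h; simp
        · simp [h]
    have hθ : ‖θ‖ ≤ 1 := BoundedContinuousFunction.norm_ofNormedAddCommGroup_le _ zero_le_one _
    have h1 : L n θ = Q m (ys n) := by
      change ∑' j, (Pi.single m 1 : ℕ → ℂ) j * Q j (ys n) = _
      rw [tsum_eq_single m fun j hj => by simp [hj]]
      simp
    rw [← h1]
    exact ((L n).le_opNorm θ).trans
      ((mul_le_of_le_one_right (norm_nonneg _) hθ).trans (hC n))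
  obtain ⟨m, hm⟩ := exists_nat_gt C
  have h1 : ‖Q m y‖ ≤ C := le_of_tendsto
    ((((hQ m).analyticAt y).continuousAt.tendsto.comp hlim).norm) (.of_forall fun n => hQC m n)
  linarith [hlarge m]

theorem IsHolomorphic.analyticAt_comp_symm {Z : Type*} [TopologicalSpace Z] {r : Z → E} {h : Z → ℂ}
    (hh : IsHolomorphic r h) {e : OpenPartialHomeomorph Z E} (he : r = e) {y : E}
    (hy : y ∈ e.target) : AnalyticAt ℂ (h ∘ e.symm) y := by
  obtain ⟨F, hF, hFh⟩ := hh (e.symm y)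
  have hr : ∀ z ∈ e.target, r (e.symm z) = z := fun z hz => by rw [he, e.right_inv hz]
  rw [hr y hy] at hF
  refine hF.congr ?_
  filter_upwards [(e.symm.continuousAt hy).eventually hFh, e.open_target.mem_nhds hy] with z hz hz'
  rw [Function.comp_apply, hz, Function.comp_apply, hr z hz']

/-- The map to the envelope must be `r` itself, so it suffices that `r` takes values in the union of
the hulls. The set `G` of points where this holds and all extended germs agree with `hullExt` is
shown to be open and closed, and then to be all of `Z`. -/
theorem isHbEnvelope_hullUnion (hU : IsOpen U) (hbal : Balanced ℂ U) (hne : U.Nonempty) :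
    IsHbEnvelope.{_, _, _, w} (Subtype.val : U → E) (Subtype.val : hullUnion U → E)
      (Set.inclusion (subset_hullUnion hU)) := by
  refine ⟨isHbExtension_hullUnion hU hbal hne, fun Z _ r ν ⟨hp, hr, hν, hext⟩ => ?_⟩
  choose ext' hext' _ using fun f : Hb (Subtype.val : U → E) => hext f f.2
  have hrν : ∀ x : U, r (ν x) = x := fun x => congrFun hν.comp_eq x
  let G : Set Z := {z | r z ∈ hullUnion U ∧ ∀ f, ext' f =ᶠ[𝓝 z] hullExt f ∘ r}
  have hνG : ∀ x, ν x ∈ G := fun x => by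
    refine ⟨by rw [hrν]; exact subset_hullUnion hU x.2, fun f => ?_⟩
    have hlh : IsLocalHomeomorph ν := by
      refine IsLocalHomeomorph.of_comp (g := r) ?_ hr.isLocalHomeomorph hν.continuous
      rw [hν.comp_eq]
      exact hp.isLocalHomeomorph
    filter_upwards [hlh.isOpenMap.isOpen_range.mem_nhds ⟨x, rfl⟩]
    rintro _ ⟨x', rfl⟩
    rw [Function.comp_apply, hrν, hullExt_apply hU hbal]
    exact congrFun (hext' f).2 x'
  -- agreement spreads over a chart domain that lies over a ball of the hull
  have hspread : ∀ (e : OpenPartialHomeomorph Z E), r = e → ∀ (c : E) (ρ : ℝ),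
      ball c ρ ⊆ e.target → ball c ρ ⊆ hullUnion U → ∀ z₁ ∈ e.source, r z₁ ∈ ball c ρ → z₁ ∈ G →
      ∀ z ∈ e.source, r z ∈ ball c ρ → z ∈ G := by
    intro e he c ρ ht hh z₁ hz₁ hb₁ hG₁ z hz hb
    refine ⟨hh hb, fun f => ?_⟩
    have h1 : (ext' f ∘ e.symm) =ᶠ[𝓝 (r z₁)] hullExt f := by
      have h2 := (e.symm.continuousAt (ht hb₁)).eventually (p := fun z => ext' f z = hullExt f (r z))
        (by
          have : e.symm (r z₁) = z₁ := by rw [he, e.left_inv hz₁]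
          rw [this]
          exact hG₁.2 f)
      filter_upwards [h2, e.open_target.mem_nhds (ht hb₁)] with y hy hyt
      rw [Function.comp_apply, hy, he, e.right_inv hyt]
    have h3 := AnalyticOnNhd.eqOn_of_preconnected_of_eventuallyEq (U := ball c ρ)
      (fun y hy => (hext' f).1.analyticAt_comp_symm he (ht hy))
      (fun y hy => analyticAt_hullExt hU hbal hne f y (hh hy)) (convex_ball c ρ).isPreconnected
      hb₁ h1
    filter_upwards [e.open_source.mem_nhds hz,
      hr.isLocalHomeomorph.continuous.continuousAt.preimage_mem_nhds (isOpen_ball.mem_nhds hb)]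
      with z' hz' hb'
    have h4 := h3 hb'
    rwa [Function.comp_apply, he, e.left_inv hz', ← he] at h4
  have hchart : ∀ z, r z ∈ hullUnion U → ∃ e : OpenPartialHomeomorph Z E, z ∈ e.source ∧ r = e ∧
      ∃ ρ > 0, ball (r z) ρ ⊆ e.target ∧ ball (r z) ρ ⊆ hullUnion U := fun z hz => by
    obtain ⟨e, hze, he⟩ := hr.isLocalHomeomorph z
    have h1 : r z ∈ e.target := by
      rw [he]
      exact e.map_source hze
    obtain ⟨ρ, hρ, h⟩ := Metric.isOpen_iff.1 (e.open_target.inter isOpen_hullUnion) _ ⟨h1, hz⟩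
    exact ⟨e, hze, he, ρ, hρ, h.trans Set.inter_subset_left, h.trans Set.inter_subset_right⟩
  have hopen : IsOpen G := isOpen_iff_mem_nhds.2 fun z hz => by
    obtain ⟨e, hze, he, ρ, hρ, h1, h2⟩ := hchart z hz.1
    filter_upwards [e.open_source.mem_nhds hze,
      hr.isLocalHomeomorph.continuous.continuousAt.preimage_mem_nhds (ball_mem_nhds _ hρ)]
      with z' hz' hb'
    exact hspread e he _ ρ h1 h2 z hze (mem_ball_self hρ) hz z' hz' hb'
  have hclosed : IsClosed G := isClosed_of_closure_subset fun z hz => by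
    have hfreq := mem_closure_iff_frequently.1 hz
    -- If a limit point of `G` lay over a point outside the hulls, some extension, being continuous
    -- there, would be bounded along a sequence on which the corresponding `hullExt f` is unbounded.
    have hmem : r z ∈ hullUnion U := by
      by_contra hnot
      obtain ⟨e, hze, he⟩ := hr.isLocalHomeomorph z
      have hrz : r z ∈ e.target := by
        rw [he]
        exact e.map_source hze
      have hfr : ∃ᶠ y in 𝓝 (r z), y ∈ e.target ∧ e.symm y ∈ G := by
        have h1 := e.map_nhds_eq hze
        rw [he, ← h1, frequently_map]
        refine (hfreq.and_eventually (e.open_source.mem_nhds hze)).mono ?_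
        rintro z' ⟨hz', hs⟩
        exact ⟨e.map_source hs, by rwa [e.left_inv hs]⟩
      obtain ⟨ys, hlim, hys⟩ := exists_seq_forall_of_frequently hfr
      have hry : ∀ n, r (e.symm (ys n)) = ys n := fun n => by rw [he, e.right_inv (hys n).1]
      obtain ⟨f, hf⟩ := exists_unbounded_along hU hbal hne hnot (ys := ys) (fun n => by
        have := (hys n).2.1
        rwa [hry] at this) hlim
      refine hf ?_
      have hbdd := Metric.isBounded_range_of_tendsto _
        (((hext' f).1.analyticAt_comp_symm he hrz).continuousAt.tendsto.comp hlim)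
      obtain ⟨C, hC⟩ := isBounded_iff_forall_norm_le.1 hbdd
      refine ⟨C, fun n => ?_⟩
      have h1 := hC _ ⟨n, rfl⟩
      have h2 := ((hys n).2.2 f).eq_of_nhds
      rw [Function.comp_apply, hry] at h2
      rwa [Function.comp_apply, Function.comp_apply, h2] at h1
    obtain ⟨e, hze, he, ρ, hρ, h1, h2⟩ := hchart z hmem
    obtain ⟨z₁, hz₁, hs, hb⟩ := (hfreq.and_eventually (inter_mem (e.open_source.mem_nhds hze)
      (hr.isLocalHomeomorph.continuous.continuousAt.preimage_mem_nhds
        (ball_mem_nhds _ hρ)))).exists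
    exact hspread e he _ ρ h1 h2 z₁ hs hb hz₁ z hze (mem_ball_self hρ)
  have hall : ∀ z, z ∈ G := by
    classical
    -- Uniqueness of extensions replaces connectedness of `Z`: the indicator of `Gᶜ` is holomorphic
    -- and extends `0`, so it vanishes.
    obtain ⟨h0, -, huniq⟩ := hext 0 (zero_mem (Hb (Subtype.val : U → E)))
    have e1 := huniq 0 ⟨fun z => ⟨0, analyticAt_const, .of_forall fun _ => rfl⟩, rfl⟩
    have e2 := huniq (Gᶜ.indicator 1) ⟨fun z => by
      by_cases hz : z ∈ G
      · refine ⟨0, analyticAt_const, ?_⟩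
        filter_upwards [hopen.mem_nhds hz] with z' hz'
        simp [hz']
      · refine ⟨fun _ => 1, analyticAt_const, ?_⟩
        filter_upwards [hclosed.isOpen_compl.mem_nhds hz] with z' hz'
        rw [Set.indicator_of_mem hz']
        rfl, funext fun x => by simp [hνG x]⟩
    intro z
    by_contra hz
    have := congrFun (e1.trans e2.symm) z
    rw [Set.indicator_of_mem hz] at this
    exact zero_ne_one this
  exact ⟨fun z => ⟨r z, (hall z).1⟩,
    ⟨hr.isLocalHomeomorph.continuous.subtype_mk _, rfl⟩, funext fun x => Subtype.ext (hrν x)⟩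

end Envelope

end BoundedType

namespace BoundedType

open Filter Metric NullSequenceSpace

/-! ### The unit ball of `c₀` with long thin polydiscs attached -/

section SpikedBall

variable {E : Type*} [NormedAddCommGroup E] [NormedSpace ℂ E] [NullSequenceSpace E]

/-- Deletion of the `k`-th coordinate. -/
def dropCoord (k : ℕ) : E →L[ℂ] E :=
  ContinuousLinearMap.id ℂ E - (coord k).smulRight (unitVec k)

theorem coord_dropCoord (k j : ℕ) (x : E) :
    coord j (dropCoord k x) = if j = k then 0 else coord j x := by
  simp only [dropCoord, sub_apply, ContinuousLinearMap.id_apply,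
    ContinuousLinearMap.smulRight_apply, map_sub, map_smul, coord_unitVec]
  split_ifs with h
  · subst h; simp
  · simp

theorem norm_dropCoord_apply_le (k : ℕ) (x : E) : ‖dropCoord k x‖ ≤ ‖x‖ := by
  refine (norm_le_iff (norm_nonneg x)).2 fun j => ?_
  rw [coord_dropCoord]
  split_ifs
  · simp
  · exact norm_coord_apply_le j x

theorem norm_le_of_coord_of_dropCoord {k : ℕ} {x : E} {C : ℝ} (h1 : ‖coord k x‖ ≤ C)
    (h2 : ‖dropCoord k x‖ ≤ C) : ‖x‖ ≤ C := by
  refine (norm_le_iff ((norm_nonneg _).trans h1)).2 fun j => ?_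
  by_cases h : j = k
  · subst h; exact h1
  · have := (norm_coord_apply_le j (dropCoord k x)).trans h2
    rwa [coord_dropCoord, if_neg h] at this

/-- The polydisc with radius `a` in the `k`-th coordinate and `b` in the others. -/
def polydisc (k : ℕ) (a b : ℝ) : Set E := {x | ‖coord k x‖ < a ∧ ‖dropCoord k x‖ < b}

theorem isOpen_polydisc (k : ℕ) (a b : ℝ) : IsOpen (polydisc k a b : Set E) :=
  (isOpen_lt (coord k).continuous.norm continuous_const).inter
    (isOpen_lt (dropCoord k).continuous.norm continuous_const)

theorem balanced_polydisc (k : ℕ) (a b : ℝ) : Balanced ℂ (polydisc k a b : Set E) :=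
  balanced_iff_smul_mem.2 fun {c} hc {x} hx => by
    refine ⟨?_, ?_⟩
    · rw [map_smul, norm_smul]
      exact (mul_le_of_le_one_left (norm_nonneg _) hc).trans_lt hx.1
    · rw [map_smul, norm_smul]
      exact (mul_le_of_le_one_left (norm_nonneg _) hc).trans_lt hx.2

theorem ball_subset_polydisc {k : ℕ} {a b r : ℝ} {x : E} (h1 : ‖coord k x‖ + r ≤ a)
    (h2 : ‖dropCoord k x‖ + r ≤ b) : ball x r ⊆ polydisc k a b := by
  intro y hy
  rw [mem_ball, dist_eq_norm] at hy
  have e1 := norm_add_le (coord k (y - x)) (coord k x)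
  have e2 := norm_add_le (dropCoord k (y - x)) (dropCoord k x)
  rw [← map_add, sub_add_cancel] at e1 e2
  have e3 := norm_coord_apply_le k (y - x)
  have e4 := norm_dropCoord_apply_le k (y - x)
  exact ⟨by linarith, by linarith⟩

/-- The lengths of the spikes. -/
def spikeLength (k : ℕ) : ℝ := k + 4

theorem four_le_spikeLength (k : ℕ) : 4 ≤ spikeLength k := by
  unfold spikeLength
  linarith [(Nat.cast_nonneg k : (0 : ℝ) ≤ k)]

variable (E) in
/-- The union of the unit ball and the polydiscs of length `k + 4` in the `k`-th coordinate and
radius `1 / (k + 4)` in the others. -/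
def spikedBall : Set E :=
  ball 0 1 ∪ ⋃ k, polydisc k (spikeLength k) (1 / spikeLength k)

theorem isOpen_spikedBall : IsOpen (spikedBall E) :=
  isOpen_ball.union (isOpen_iUnion fun k => isOpen_polydisc k _ _)

theorem balanced_spikedBall : Balanced ℂ (spikedBall E) :=
  balanced_ball_zero.union (balanced_iUnion fun k => balanced_polydisc k _ _)

theorem nonempty_spikedBall : (spikedBall E).Nonempty := ⟨0, Or.inl (mem_ball_self one_pos)⟩

/-- The index of the set of the exhaustion whose hull contains the `k`-th polydisc of radii
`2` and `1 / 4`. -/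
def spikeIndex (k : ℕ) : ℕ := 4 * (k + 4)

theorem one_le_spikeIndex (k : ℕ) : 1 ≤ spikeIndex k := by
  unfold spikeIndex
  omega

/-- A Hadamard-type argument: the curve `y` multiplies the `k`-th coordinate by `ζ` and the others
by `ζ⁻¹`. It passes through `x` at `ζ = 1`, and the maximum principle on an annulus bounds `P x` by
the values of `P` on the two boundary circles. -/
theorem polydisc_subset_polyHull (k : ℕ) :
    polydisc k 2 (1 / 4) ⊆ polyHull (exhaustion (spikedBall E) (spikeIndex k)) := by
  intro x hx
  set a := spikeLength k with ha
  have ha4 : 4 ≤ a := four_le_spikeLength k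
  have hm : ((spikeIndex k : ℕ) : ℝ) = 4 * a := by
    rw [ha, spikeIndex, spikeLength]
    push_cast
    ring
  refine mem_polyHull_iff.2 fun P hP C hC h => ?_
  let y : ℂ → E := fun ζ => ζ • (coord k x • unitVec k) + ζ⁻¹ • dropCoord k x
  have hy1 : ∀ ζ, coord k (y ζ) = ζ * coord k x := fun ζ => by
    simp [y, coord_unitVec, coord_dropCoord]
  have hy2 : ∀ ζ, dropCoord k (y ζ) = ζ⁻¹ • dropCoord k x := fun ζ => by
    refine ext_coord fun j => ?_
    rw [coord_dropCoord]
    simp only [y, map_add, map_smul, coord_unitVec, coord_dropCoord]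
    split_ifs <;> simp
  have hyx : y 1 = x := by
    simp [y, dropCoord]
  -- On the inner circle the radii `(2, 1/4)` become `(2/3, 3/4)`, inside the unit ball; on the
  -- outer one `(2a/3, 3/(4a))`, inside the spike `(a, 1/a)`. Both leave the margin `1 / (4a)`, the
  -- reciprocal of `spikeIndex k`.
  let A : Set ℂ := {ζ | 1 / 3 < ‖ζ‖ ∧ ‖ζ‖ < a / 3}
  have hAo : IsOpen A := (isOpen_lt continuous_const continuous_norm).inter
    (isOpen_lt continuous_norm continuous_const)
  have hAc : closure A ⊆ {ζ | 1 / 3 ≤ ‖ζ‖ ∧ ‖ζ‖ ≤ a / 3} :=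
    closure_minimal (fun ζ hζ => ⟨hζ.1.le, hζ.2.le⟩)
      ((isClosed_le continuous_const continuous_norm).inter
        (isClosed_le continuous_norm continuous_const))
  have hdiff : DifferentiableOn ℂ (fun ζ => P (y ζ)) (closure A) := fun ζ hζ => by
    have hζ0 : ζ ≠ 0 := by
      rintro rfl
      have := (hAc hζ).1
      norm_num at this
    have hyd : DifferentiableAt ℂ y ζ :=
      (differentiableAt_id.smul_const _).add ((differentiableAt_inv hζ0).smul_const _)
    exact ((hP.analyticAt (y ζ)).differentiableAt.comp ζ hyd).differentiableWithinAt
  have hbound : ∀ ζ ∈ frontier A, ‖P (y ζ)‖ ≤ C := fun ζ hζ => by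
    rw [hAo.frontier_eq] at hζ
    have h1 := hAc hζ.1
    have hζpos : 0 < ‖ζ‖ := lt_of_lt_of_le (by norm_num) h1.1
    have e1 : ‖coord k (y ζ)‖ ≤ ‖ζ‖ * 2 := by
      rw [hy1, norm_mul]
      exact mul_le_mul_of_nonneg_left hx.1.le hζpos.le
    have e2 : ‖dropCoord k (y ζ)‖ ≤ ‖ζ‖⁻¹ * (1 / 4) := by
      rw [hy2, norm_smul, norm_inv]
      exact mul_le_mul_of_nonneg_left hx.2.le (inv_pos.2 hζpos).le
    refine h _ ((mem_exhaustion_iff (one_le_spikeIndex k)).2 ?_)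
    rw [hm]
    have hcase : ‖ζ‖ = 1 / 3 ∨ ‖ζ‖ = a / 3 := by
      by_contra! hne
      exact hζ.2 ⟨lt_of_le_of_ne h1.1 hne.1.symm, lt_of_le_of_ne h1.2 hne.2⟩
    rcases hcase with hz | hz
    · rw [hz] at e1 e2
      have hn : ‖y ζ‖ ≤ 3 / 4 :=
        norm_le_of_coord_of_dropCoord (e1.trans (by norm_num)) (e2.trans (by norm_num))
      refine ⟨by linarith, fun v hv => Or.inl ?_⟩
      have h16 : 1 / (4 * a) ≤ 1 / 4 := one_div_le_one_div_of_le (by norm_num) (by linarith)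
      rw [mem_ball, dist_eq_norm] at hv
      rw [mem_ball_zero_iff]
      have := norm_add_le (v - y ζ) (y ζ)
      rw [sub_add_cancel] at this
      linarith
    · rw [hz] at e1 e2
      have e2' : ‖dropCoord k (y ζ)‖ ≤ 3 / (4 * a) := e2.trans (le_of_eq (by
        field_simp))
      have h16 : 1 / (4 * a) ≤ 1 / 4 := one_div_le_one_div_of_le (by norm_num) (by linarith)
      have h17 : 3 / (4 * a) = 3 * (1 / (4 * a)) := by ring
      refine ⟨norm_le_of_coord_of_dropCoord (k := k) (by linarith) (by linarith),
        (ball_subset_polydisc (k := k) (a := a) (b := 1 / a) (by linarith) ?_).trans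
          ((Set.subset_iUnion (fun k => (polydisc k (spikeLength k) (1 / spikeLength k) : Set E))
            k).trans Set.subset_union_right)⟩
      have h18 : 1 / a = 4 * (1 / (4 * a)) := by
        field_simp
      linarith
  have := Complex.norm_le_of_forall_mem_frontier_norm_le (f := fun ζ => P (y ζ)) (U := A)
    (isBounded_iff_forall_norm_le.2 ⟨a / 3, fun ζ hζ => hζ.2.le⟩) hdiff.diffContOnCl hbound
    (z := 1) (subset_closure ⟨by norm_num, by rw [norm_one]; linarith⟩)
  rwa [hyx] at this

theorem polydisc_subset_hullUnion (k : ℕ) :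
    polydisc k 2 (1 / 4) ⊆ hullUnion (spikedBall E) := fun _ hx =>
  ⟨spikeIndex k, one_le_spikeIndex k, polydisc_subset_polyHull k hx⟩

theorem exists_norm_add_eq (z : ℂ) {c : ℝ} (hc : 0 ≤ c) : ∃ v : ℂ, ‖v‖ = c ∧ ‖z + v‖ = ‖z‖ + c := by
  by_cases hz : z = 0
  · exact ⟨c, by simp [abs_of_nonneg hc], by simp [hz, abs_of_nonneg hc]⟩
  · have hz' : 0 < ‖z‖ := norm_pos_iff.2 hz
    refine ⟨((c / ‖z‖ : ℝ) : ℂ) * z, ?_, ?_⟩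
    · rw [norm_mul, Complex.norm_real, Real.norm_of_nonneg (by positivity),
        div_mul_cancel₀ _ hz'.ne']
    · have : z + ((c / ‖z‖ : ℝ) : ℂ) * z = ((1 + c / ‖z‖ : ℝ) : ℂ) * z := by
        push_cast
        ring
      rw [this, norm_mul, Complex.norm_real, Real.norm_of_nonneg (by positivity)]
      field_simp

/-- The far coordinates of a point deep inside the spiked ball are small. -/
theorem norm_coord_le_of_ball_subset {x : E} {δ : ℝ} (hδ : 0 < δ)
    (hx : ball x δ ⊆ spikedBall E) {k : ℕ} (hk : 1 / spikeLength k < δ / 2) :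
    ‖coord k x‖ ≤ 1 - δ / 2 := by
  by_contra! hlt
  obtain ⟨v, hv, hv'⟩ := exists_norm_add_eq (coord k x) (half_pos hδ).le
  obtain ⟨v₁, hv₁, hv₁'⟩ := exists_norm_add_eq (coord (k + 1) x) (half_pos hδ).le
  -- Pushing two coordinates outwards by `δ / 2` stays in the ball about `x`. The `k`-th then
  -- exceeds `1`, which excludes the unit ball and all spikes but the `k`-th; the next one is at
  -- least `δ / 2`, which excludes the `k`-th spike.
  set y : E := x + (v • unitVec k + v₁ • unitVec (k + 1)) with hy
  have hyk : 1 < ‖coord k y‖ := by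
    have : coord k y = coord k x + v := by simp [hy, coord_unitVec]
    rw [this, hv']
    linarith
  have hyk1 : δ / 2 ≤ ‖coord (k + 1) y‖ := by
    have : coord (k + 1) y = coord (k + 1) x + v₁ := by simp [hy, coord_unitVec]
    rw [this, hv₁']
    linarith [norm_nonneg (coord (k + 1) x)]
  have hdist : y ∈ ball x δ := by
    rw [mem_ball, dist_eq_norm, hy, add_sub_cancel_left]
    refine lt_of_le_of_lt ((norm_le_iff (half_pos hδ).le).2 fun j => ?_) (half_lt_self hδ)
    simp only [map_add, map_smul, coord_unitVec]
    split_ifs with h1 h2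
    · omega
    · simp [hv]
    · simp [hv₁]
    · simpa using (half_pos hδ).le
  rcases hx hdist with h | h
  · rw [mem_ball_zero_iff] at h
    linarith [norm_coord_apply_le k y]
  · obtain ⟨l, hl⟩ := Set.mem_iUnion.1 h
    by_cases hlk : l = k
    · subst hlk
      have h1 := (norm_coord_apply_le (l + 1) (dropCoord l y)).trans_lt hl.2
      rw [coord_dropCoord, if_neg (by omega)] at h1
      linarith
    · have h1 := (norm_coord_apply_le k (dropCoord l y)).trans_lt hl.2
      rw [coord_dropCoord, if_neg (Ne.symm hlk)] at h1
      have h2 : 1 / spikeLength l ≤ 1 := by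
        rw [div_le_one (by linarith [four_le_spikeLength l])]
        linarith [four_le_spikeLength l]
      linarith

/-! ### A function of bounded type on the spiked ball -/

/-- The entire function `x ↦ ∑ₖ xₖ ^ (k + 1)` on `c₀`. -/
def diagonalSeries (x : E) : ℂ := ∑' k, coord k x ^ (k + 1)

/-- As `x` is a null sequence, all but finitely many coordinates are at most `1 / 2` throughout the
ball of radius `1 / 4` about `x`, so the series is locally dominated by a geometric one. -/
theorem analyticAt_diagonalSeries (x : E) : AnalyticAt ℂ diagonalSeries x := by
  obtain ⟨N, hN⟩ := Metric.tendsto_atTop.1 (tendsto_coord x) (1 / 4) (by norm_num)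
  have hgeo : Summable fun k : ℕ => (1 / 2 : ℝ) ^ (k + 1) :=
    (summable_nat_add_iff 1).2 (summable_geometric_of_lt_one (by norm_num) (by norm_num))
  refine analyticAt_tsum (u := fun k => (1 / 2) ^ (k + 1) +
      if k < N then (‖x‖ + 1) ^ (k + 1) else 0) (ρ := 1 / 4) (hgeo.add
    (summable_of_ne_finset_zero (s := Finset.range N) fun m hm => by
      rw [if_neg (by simpa using hm)])) (by norm_num) fun k y hy => ⟨?_, ?_⟩
  · exact ((coord k).analyticAt y).pow _
  · rw [mem_ball, dist_eq_norm] at hy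
    have h1 := norm_add_le (coord k (y - x)) (coord k x)
    rw [← map_add, sub_add_cancel] at h1
    have h2 := norm_coord_apply_le k (y - x)
    rw [norm_pow]
    split_ifs with h
    · have h3 : ‖coord k y‖ ≤ ‖x‖ + 1 := by linarith [norm_coord_apply_le k x]
      have h4 := pow_le_pow_left₀ (norm_nonneg _) h3 (k + 1)
      have h5 : (0 : ℝ) ≤ (1 / 2) ^ (k + 1) := by positivity
      linarith
    · have h3 := hN k (not_lt.1 h)
      rw [dist_zero_right] at h3
      rw [add_zero]
      exact pow_le_pow_left₀ (norm_nonneg _) (by linarith) _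

/-- For `k ≥ 2m` the spikes are thinner than `1 / (2m)`, so the coordinates on `U_m` are at most `q
< 1`; the remaining finitely many terms are bounded by powers of `m`. -/
theorem exists_norm_diagonalSeries_le {m : ℕ} (hm : 1 ≤ m) :
    ∃ C, ∀ x ∈ exhaustion (spikedBall E) m, ‖diagonalSeries x‖ ≤ C := by
  have hm1 : (1 : ℝ) ≤ m := by exact_mod_cast hm
  set q : ℝ := 1 - 1 / m / 2 with hq
  have hq0 : 0 ≤ q := by
    have : 1 / (m : ℝ) ≤ 1 := by
      rw [div_le_one (by linarith)]
      exact hm1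
    linarith
  have hq1 : q < 1 := by
    have : 0 < 1 / (m : ℝ) := by positivity
    linarith
  have hu : Summable fun k : ℕ => q ^ (k + 1) + if k < 2 * m then (m : ℝ) ^ (k + 1) else 0 :=
    ((summable_nat_add_iff 1).2 (summable_geometric_of_lt_one hq0 hq1)).add
      (summable_of_ne_finset_zero (s := Finset.range (2 * m)) fun k hk => by
        rw [if_neg (by simpa using hk)])
  refine ⟨_, fun x hx => tsum_of_norm_bounded hu.hasSum fun k => ?_⟩
  rw [mem_exhaustion_iff hm] at hx
  rw [norm_pow]
  split_ifs with h
  · have h1 := pow_le_pow_left₀ (norm_nonneg _) ((norm_coord_apply_le k x).trans hx.1) (k + 1)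
    have h2 : 0 ≤ q ^ (k + 1) := by positivity
    linarith
  · rw [add_zero]
    refine pow_le_pow_left₀ (norm_nonneg _) (norm_coord_le_of_ball_subset (by positivity) hx.2 ?_) _
    have h1 : (2 * m : ℝ) ≤ k := by exact_mod_cast not_lt.1 h
    have h2 : 1 / (m : ℝ) / 2 = 1 / (2 * m) := by
      field_simp
    rw [h2]
    refine one_div_lt_one_div_of_lt (by positivity) ?_
    unfold spikeLength
    linarith

variable (E) in
/-- The restriction of `x ↦ ∑ₖ xₖ ^ (k + 1)` to the spiked ball. -/
def diagonalHb : Hb (Subtype.val : spikedBall E → E) :=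
  ⟨diagonalSeries ∘ Subtype.val, mem_Hb_comp_subtypeVal isOpen_spikedBall
    (fun x _ => analyticAt_diagonalSeries x) fun _ hm => exists_norm_diagonalSeries_le hm⟩

/-- Points of the hull at which `x ↦ ∑ₖ xₖ ^ (k + 1)` is large. -/
def spikePoint (k : ℕ) : E := (3 / 2 : ℂ) • unitVec k

theorem coord_spikePoint (k j : ℕ) : coord j (spikePoint k : E) = if j = k then 3 / 2 else 0 := by
  simp [spikePoint, coord_unitVec]

theorem dropCoord_spikePoint (k : ℕ) : dropCoord k (spikePoint k : E) = 0 :=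
  ext_coord fun j => by
    rw [coord_dropCoord, coord_spikePoint]
    split_ifs <;> simp

theorem norm_spikePoint_le (k : ℕ) : ‖(spikePoint k : E)‖ ≤ 3 / 2 :=
  (norm_le_iff (by norm_num)).2 fun j => by
    rw [coord_spikePoint]
    split_ifs <;> norm_num

theorem diagonalSeries_spikePoint (k : ℕ) :
    diagonalSeries (spikePoint k : E) = (3 / 2) ^ (k + 1) := by
  rw [diagonalSeries, tsum_eq_single k fun j hj => by simp [coord_spikePoint, hj]]
  simp [coord_spikePoint]

theorem ball_spikePoint_subset (k : ℕ) :
    ball (spikePoint k : E) (1 / 8) ⊆ polydisc k (7 / 4) (1 / 6) := by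
  refine ball_subset_polydisc ?_ ?_
  · rw [coord_spikePoint]
    norm_num
  · rw [dropCoord_spikePoint]
    norm_num

theorem polydisc_mono {k : ℕ} {a b a' b' : ℝ} (ha : a ≤ a') (hb : b ≤ b') :
    (polydisc k a b : Set E) ⊆ polydisc k a' b' := fun _ hx =>
  ⟨hx.1.trans_le ha, hx.2.trans_le hb⟩

theorem not_bddAbove_pow (C : ℝ) : ∃ k : ℕ, C < ‖((3 : ℂ) / 2) ^ (k + 1)‖ := by
  obtain ⟨k, hk⟩ := pow_unbounded_of_one_lt C (show (1 : ℝ) < 3 / 2 by norm_num)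
  refine ⟨k, hk.trans_le ?_⟩
  rw [norm_pow]
  have : ‖(3 : ℂ) / 2‖ = 3 / 2 := by simp
  rw [this]
  exact pow_le_pow_right₀ (by norm_num) (Nat.le_succ k)

theorem not_isBoundedType_diagonalSeries :
    ¬ IsBoundedType (Subtype.val : hullUnion (spikedBall E) → E)
      (diagonalSeries ∘ Subtype.val) := by
  intro h
  have hmem : ∀ k, ball (spikePoint k : E) (1 / 8) ⊆ hullUnion (spikedBall E) := fun k =>
    ((ball_spikePoint_subset k).trans (polydisc_mono (by norm_num) (by norm_num))).trans
      (polydisc_subset_hullUnion k)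
  let x : ℕ → hullUnion (spikedBall E) := fun k =>
    ⟨spikePoint k, hmem k (mem_ball_self (by norm_num))⟩
  have hA : IsDomainBounded Subtype.val (Set.range x) :=
    (isDomainBounded_subtypeVal_iff isOpen_hullUnion).2 ⟨3 / 2, 1 / 8, by norm_num, by
      rintro _ ⟨k, rfl⟩
      exact ⟨norm_spikePoint_le k, hmem k⟩⟩
  obtain ⟨C, hC⟩ := isBounded_iff_forall_norm_le.1 (h _ hA)
  obtain ⟨k, hk⟩ := not_bddAbove_pow C
  have h1 := hC _ ⟨x k, ⟨k, rfl⟩, rfl⟩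
  rw [Function.comp_apply, diagonalSeries_spikePoint] at h1
  linarith

end SpikedBall

end BoundedType

namespace BoundedType

open Filter Metric NullSequenceSpace

section NullSequenceSpace

variable {E : Type*} [NormedAddCommGroup E] [NormedSpace ℂ E] [NullSequenceSpace E]

/-- The polydisc lies in the hull of a single set of the exhaustion. The bound depends on `k`; the
unboundedness of `g` at the spike points shows that it cannot be uniform. -/
theorem exists_norm_hullExt_le_of_polydisc (k : ℕ) (f : Hb (Subtype.val : spikedBall E → E)) :
    ∃ C, ∀ x ∈ polydisc k 2 (1 / 4), ‖hullExt f x‖ ≤ C := by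
  have hm := one_le_spikeIndex k
  obtain ⟨C, hC⟩ := (isBoundedType_subtypeVal_iff isOpen_spikedBall).1 f.2.2 (2 * spikeIndex k)
    (by omega)
  exact ⟨_, fun x hx => norm_hullExt_le isOpen_spikedBall balanced_spikedBall nonempty_spikedBall f
    hm (abs_nonneg C) (fun u hu => (hC u hu).trans (le_abs_self C))
    (polydisc_subset_polyHull k hx)⟩

end NullSequenceSpace

/-! ### The spiked ball has no `H_b`-`H_b`-envelope -/

section NoEnvelope

variable {E : Type} [NormedAddCommGroup E] [NormedSpace ℂ E] [NullSequenceSpace E]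

variable (E) in
/-- The spiked ball together with one polydisc of its hull. -/
def enlargedBall (k : ℕ) : Set E := spikedBall E ∪ polydisc k (7 / 4) (1 / 6)

theorem isOpen_enlargedBall (k : ℕ) : IsOpen (enlargedBall E k) :=
  isOpen_spikedBall.union (isOpen_polydisc _ _ _)

theorem balanced_enlargedBall (k : ℕ) : Balanced ℂ (enlargedBall E k) :=
  balanced_spikedBall.union (balanced_polydisc _ _ _)

theorem enlargedBall_subset_hullUnion (k : ℕ) : enlargedBall E k ⊆ hullUnion (spikedBall E) :=
  Set.union_subset (subset_hullUnion isOpen_spikedBall)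
    ((polydisc_mono (by norm_num) (by norm_num)).trans (polydisc_subset_hullUnion k))

/-- A point deep inside the enlarged ball either lies in the polydisc of radii `2` and `1 / 4`,
where the hull gives a bound, or is far enough from the smaller polydisc to be deep inside the
spiked ball itself. -/
theorem exists_norm_hullExt_le_of_enlargedBall (k : ℕ) (f : Hb (Subtype.val : spikedBall E → E))
    (R : ℝ) {δ : ℝ} (hδ : 0 < δ) :
    ∃ C, ∀ x : E, ‖x‖ ≤ R → ball x δ ⊆ enlargedBall E k → ‖hullExt f x‖ ≤ C := by
  obtain ⟨C, hC⟩ := exists_norm_hullExt_le_of_polydisc k f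
  -- `1 / 12 = 1 / 4 - 1 / 6` is the smaller of the gaps between the radii of the two polydiscs.
  have hδ' : 0 < min δ (1 / 12) := by positivity
  obtain ⟨m, hm, hsub⟩ := exists_exhaustion_superset (U := spikedBall E) (R := R) hδ'
  obtain ⟨C', hC'⟩ := (isBoundedType_subtypeVal_iff isOpen_spikedBall).1 f.2.2 m hm
  refine ⟨max C C', fun x hx hb => ?_⟩
  by_cases hxp : x ∈ polydisc k 2 (1 / 4)
  · exact (hC x hxp).trans (le_max_left _ _)
  · have hmem : x ∈ exhaustion (spikedBall E) m := by
      refine hsub x hx fun y hy => ?_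
      refine (hb (ball_subset_ball (min_le_left _ _) hy)).resolve_right fun hyp => hxp ?_
      have hd : ‖x - y‖ < 1 / 12 := by
        rw [mem_ball, dist_comm, dist_eq_norm] at hy
        exact hy.trans_le (min_le_right _ _)
      have e1 := norm_add_le (coord k (x - y)) (coord k y)
      have e2 := norm_add_le (dropCoord k (x - y)) (dropCoord k y)
      rw [← map_add, sub_add_cancel] at e1 e2
      have e3 := norm_coord_apply_le k (x - y)
      have e4 := norm_dropCoord_apply_le k (x - y)
      exact ⟨by linarith [hyp.1], by linarith [hyp.2]⟩
    have h1 := hC' ⟨x, exhaustion_subset _ hmem⟩ hmem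
    have h2 := hullExt_apply isOpen_spikedBall balanced_spikedBall f
      ⟨x, exhaustion_subset _ hmem⟩
    rw [← h2] at h1
    exact h1.trans (le_max_right _ _)

theorem IsHolomorphic.comp_section {X Z : Type*} [TopologicalSpace X] [TopologicalSpace Z]
    {p : X → E} {q : Z → E} {h : X → ℂ} (hh : IsHolomorphic p h) {σ : Z → X} (hσ : Continuous σ)
    (hpσ : ∀ z, p (σ z) = q z) : IsHolomorphic q (h ∘ σ) := fun z => by
  obtain ⟨F, hF, hFh⟩ := hh (σ z)
  rw [hpσ] at hF
  refine ⟨F, hF, ?_⟩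
  filter_upwards [hσ.continuousAt.eventually hFh] with z' hz'
  rw [Function.comp_apply, hz', Function.comp_apply, hpσ, Function.comp_apply]

/-- Holomorphic functions on the enlarged ball are determined by their values on the spiked ball. -/
theorem eq_of_isHolomorphic_enlargedBall (k : ℕ) {h : enlargedBall E k → ℂ}
    (hh : IsHolomorphic Subtype.val h) {G : E → ℂ} (hG : ∀ x ∈ enlargedBall E k, AnalyticAt ℂ G x)
    (heq : ∀ (x : E) (hx : x ∈ spikedBall E), h ⟨x, Or.inl hx⟩ = G x) (x : enlargedBall E k) :
    h x = G x := by
  have h0 : (0 : E) ∈ spikedBall E := Or.inl (mem_ball_self one_pos)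
  have := AnalyticOnNhd.eqOn_of_preconnected_of_eventuallyEq
    (fun x hx => IsHolomorphic.analyticAt_zeroExt (isOpen_enlargedBall k) hh hx) hG
    (isPreconnected_of_balanced (balanced_enlargedBall k)) (Or.inl h0)
    (by
      filter_upwards [isOpen_spikedBall.mem_nhds h0] with x hx
      rw [← heq x hx]
      exact zeroExt_apply h ⟨x, Or.inl hx⟩)
  rw [← zeroExt_apply h x]
  exact this x.2

variable (E) in
/-- The projection of the enlarged ball, lifted to an arbitrary universe. -/
def enlargedProj (k : ℕ) (z : ULift.{w} (enlargedBall E k)) : E := z.down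

/-- The inclusion of the spiked ball into the lifted enlarged ball. -/
def enlargedIncl (k : ℕ) (x : spikedBall E) : ULift.{w} (enlargedBall E k) := ⟨x, Or.inl x.2⟩

theorem isHbHbExtension_enlargedIncl (k : ℕ) :
    IsHbHbExtension (Subtype.val : spikedBall E → E) (enlargedProj.{w} E k)
      (enlargedIncl.{w} k) := by
  have hcont : Continuous (enlargedIncl.{w} k : spikedBall E → _) :=
    continuous_uliftUp.comp (continuous_subtype_val.subtype_mk _)
  have hrange : Set.range (enlargedProj.{w} E k) = enlargedBall E k := by
    ext x
    exact ⟨fun ⟨z, hz⟩ => hz ▸ z.down.2, fun hx => ⟨⟨x, hx⟩, rfl⟩⟩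
  refine ⟨isRiemannDomain_subtypeVal isOpen_spikedBall, ⟨inferInstance, ?_⟩, ⟨hcont, rfl⟩,
    fun f hf => ?_⟩
  · exact (isRiemannDomain_subtypeVal (isOpen_enlargedBall k)).isLocalHomeomorph.comp
      Homeomorph.ulift.isLocalHomeomorph
  · let f' : Hb (Subtype.val : spikedBall E → E) := ⟨f, hf⟩
    have ha := analyticAt_hullExt isOpen_spikedBall balanced_spikedBall nonempty_spikedBall f'
    have he := hullExt_apply isOpen_spikedBall balanced_spikedBall f'
    refine ⟨hullExt f' ∘ enlargedProj E k, ⟨⟨fun z =>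
      ⟨hullExt f', ha _ (enlargedBall_subset_hullUnion k z.down.2), .of_forall fun _ => rfl⟩,
      fun A hA => ?_⟩, funext fun x => he x⟩, ?_⟩
    · obtain ⟨R, δ, hδ, hA⟩ := hA.exists_ball_subset
      rw [hrange] at hA
      obtain ⟨C, hC⟩ := exists_norm_hullExt_le_of_enlargedBall k f' R hδ
      refine isBounded_iff_forall_norm_le.2 ⟨C, ?_⟩
      rintro _ ⟨z, hz, rfl⟩
      exact hC _ (hA z hz).1 (hA z hz).2
    · rintro h ⟨hh, hhf⟩
      have hh' : IsHolomorphic Subtype.val (h ∘ ULift.up) :=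
        hh.1.comp_section (q := Subtype.val) continuous_uliftUp fun _ => rfl
      have := eq_of_isHolomorphic_enlargedBall k hh' (G := hullExt f')
        (fun x hx => ha x (enlargedBall_subset_hullUnion k hx))
        fun x hx => (congrFun hhf ⟨x, hx⟩).trans (he ⟨x, hx⟩).symm
      funext z
      exact this z.down

/-- Each enlarged ball would map into the envelope. The images of the spike points project to a
bounded set and keep distance at least `1 / 8`, while the identity theorem on each enlarged ball
forces the extension of `g` to take the values `(3/2) ^ (k + 1)`. -/
theorem not_exists_isHbHbEnvelope_spikedBall :
    ¬ ∃ (Y : Type v) (_ : TopologicalSpace Y) (q : Y → E) (τ : spikedBall E → Y),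
      IsHbHbEnvelope.{_, _, v, w} (Subtype.val : spikedBall E → E) q τ := by
  rintro ⟨Y, _, q, τ, ⟨-, hq, hτ, hext⟩, huniv⟩
  obtain ⟨g', ⟨hg', hg'τ⟩, -⟩ := hext _ (diagonalHb E).2
  choose μ hμ hμτ using fun k =>
    huniv _ (enlargedProj.{w} E k) (enlargedIncl.{w} k) (isHbHbExtension_enlargedIncl k)
  have hqμ : ∀ k z, q (μ k z) = z.down := fun k z => congrFun (hμ k).comp_eq z
  have hball : ∀ k, ball (spikePoint k : E) (1 / 8) ⊆ enlargedBall E k := fun k =>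
    (ball_spikePoint_subset k).trans Set.subset_union_right
  let x : ∀ k, enlargedBall E k := fun k =>
    ⟨spikePoint k, hball k (mem_ball_self (by norm_num))⟩
  let y : ℕ → Y := fun k => μ k ⟨x k⟩
  have hqy : ∀ k, q (y k) = spikePoint k := fun k => hqμ k _
  have hval : ∀ k, g' (y k) = (3 / 2) ^ (k + 1) := fun k => by
    have h1 : IsHolomorphic (Subtype.val : enlargedBall E k → E)
        (g' ∘ fun z => μ k (ULift.up z)) :=
      hg'.1.comp_section ((hμ k).continuous.comp continuous_uliftUp) fun z => hqμ k _
    have h2 := eq_of_isHolomorphic_enlargedBall k h1 (G := diagonalSeries)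
      (fun x _ => analyticAt_diagonalSeries x) (fun x hx => by
        have h3 : μ k (ULift.up ⟨x, Or.inl hx⟩) = τ ⟨x, hx⟩ := congrFun (hμτ k) ⟨x, hx⟩
        rw [Function.comp_apply, h3]
        exact congrFun hg'τ ⟨x, hx⟩) (x k)
    rw [← diagonalSeries_spikePoint (E := E) k]
    exact h2
  have hA : IsDomainBounded q (Set.range y) := by
    refine ⟨isBounded_iff_forall_norm_le.2 ⟨3 / 2, ?_⟩, ?_⟩
    · rintro _ ⟨_, ⟨k, rfl⟩, rfl⟩
      rw [hqy]
      exact norm_spikePoint_le k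
    · refine lt_of_lt_of_le (ENNReal.ofReal_pos.2 (show (0 : ℝ) < 1 / 8 by norm_num))
        (le_iInf₂ ?_)
      rintro _ ⟨k, rfl⟩
      have hb : ball (q (y k)) (1 / 8) ⊆ enlargedBall E k := by
        rw [hqy]
        exact hball k
      refine ofReal_le_distTo_of_isLocalHomeomorph hq.isLocalHomeomorph (by norm_num)
        (fun z => μ k ⟨Set.inclusion hb z⟩)
        ((hμ k).continuous.comp (continuous_uliftUp.comp (continuous_inclusion hb)))
        (fun z => hqμ k _) ?_
      have h1 : Set.inclusion hb ⟨q (y k), mem_ball_self (by norm_num)⟩ = x k :=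
        Subtype.ext (hqy k)
      rw [h1]
  obtain ⟨C, hC⟩ := isBounded_iff_forall_norm_le.1 (hg'.2 _ hA)
  obtain ⟨k, hk⟩ := not_bddAbove_pow C
  have h1 := hC _ ⟨y k, ⟨k, rfl⟩, rfl⟩
  rw [hval] at h1
  linarith

end NoEnvelope

end BoundedType

namespace BoundedType

open Filter Metric NullSequenceSpace

/-! ### Evaluations in the spectrum at points of the bidual -/

theorem exists_add_mem_of_isOpen {G : Type*} [SeminormedAddCommGroup G] {O : Set G}
    (hO : IsOpen O) {w : G} (hw : w ∈ O) : ∃ ε > 0, ∀ z, ‖z‖ < ε → w + z ∈ O := by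
  obtain ⟨ε, hε, h⟩ := Metric.isOpen_iff.1 hO w hw
  exact ⟨ε, hε, fun z hz => h (by rwa [mem_ball, dist_eq_norm, add_sub_cancel_left])⟩

theorem isOpen_of_forall_norm_sub_lt {G : Type*} [SeminormedAddCommGroup G] {S : Set G} {A : Set S}
    (h : ∀ w ∈ A, ∃ ε > 0, ∀ w' : S, ‖(w' : G) - w‖ < ε → w' ∈ A) : IsOpen A :=
  Metric.isOpen_iff.2 fun w hw => by
    obtain ⟨ε, hε, h⟩ := h w hw
    exact ⟨ε, hε, fun w' hw' => h w' (by rwa [mem_ball, Subtype.dist_eq, dist_eq_norm] at hw')⟩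

section SpectrumPoints

variable {E : Type*} [NormedAddCommGroup E] [NormedSpace ℂ E] [NullSequenceSpace E]

theorem dropCoord_trunc (k M : ℕ) (x : E) : dropCoord k (trunc M x) = trunc M (dropCoord k x) :=
  ext_coord fun j => by
    simp only [coord_dropCoord, coord_trunc]
    split_ifs <;> rfl

theorem trunc_mem_polydisc {k : ℕ} {a b : ℝ} (M : ℕ) {x : E} (hx : x ∈ polydisc k a b) :
    trunc M x ∈ polydisc k a b := by
  refine ⟨lt_of_le_of_lt ?_ hx.1, lt_of_le_of_lt ?_ hx.2⟩
  · rw [coord_trunc]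
    split_ifs
    · exact le_rfl
    · simp
  · rw [dropCoord_trunc]
    exact norm_trunc_apply_le M _

/-- On the polydiscs in the hull of the spiked ball, extensions of functions of bounded type are
uniform limits of their truncations. -/
theorem exists_norm_hullExt_trunc_sub_lt (k : ℕ) (f : Hb (Subtype.val : spikedBall E → E)) {ε : ℝ}
    (hε : 0 < ε) : ∃ M, ∀ x ∈ polydisc k 2 (1 / 4), ‖hullExt f (trunc M x) - hullExt f x‖ < ε := by
  set m := spikeIndex k
  have hm : 1 ≤ m := one_le_spikeIndex k
  set F := zeroExt (f : spikedBall E → ℂ) with hF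
  have hFa : ∀ x ∈ spikedBall E, AnalyticAt ℂ F x := Hb.analyticAt_zeroExt isOpen_spikedBall f
  obtain ⟨C, hC⟩ := Hb.exists_norm_zeroExt_le isOpen_spikedBall f (m := 2 * m) (by omega)
  have hC' : ∀ u ∈ exhaustion (spikedBall E) (2 * m), ‖F u‖ ≤ |C| := fun u hu =>
    (hC u hu).trans (le_abs_self C)
  set q := hullRatio m
  have hq0 : 0 ≤ q := hullRatio_nonneg m
  have hq1 : q < 1 := hullRatio_lt_one hm
  have hterm : ∀ n, ∀ x ∈ polydisc k 2 (1 / 4), ‖taylorZero F n fun _ => x‖ ≤ |C| * q ^ n :=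
    fun n x hx => norm_taylorZero_le balanced_spikedBall nonempty_spikedBall hFa hm (abs_nonneg C)
      hC' (polydisc_subset_polyHull k hx) n
  have hgeo : Summable fun n => |C| * q ^ n := (summable_geometric_of_lt_one hq0 hq1).mul_left _
  have hsum : ∀ x ∈ polydisc k 2 (1 / 4), Summable fun n => taylorZero F n fun _ => x :=
    fun x hx => .of_norm_bounded hgeo fun n => hterm n x hx
  let D : ℕ → ℕ → ℝ := fun M n =>
    ‖(taylorZero F n).compContinuousLinearMap (fun _ => trunc M) - taylorZero F n‖ * 2 ^ n
  -- The first bound dominates uniformly in `M`, the second tends to `0` for each `n`; the factor `2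
  -- ^ n` in `D` comes from `‖x‖ ≤ 2` on the polydisc.
  let b : ℕ → ℕ → ℝ := fun M n => min (2 * (|C| * q ^ n)) (D M n)
  have hb0 : ∀ M n, 0 ≤ b M n := fun M n => by positivity
  have hbsum : ∀ M, Summable (b M) := fun M =>
    .of_nonneg_of_le (hb0 M) (fun n => min_le_left _ _) (hgeo.mul_left 2)
  have hlim : Tendsto (fun M => ∑' n, b M n) atTop (𝓝 0) := by
    have := tendsto_tsum_of_dominated_convergence (𝓕 := atTop) (f := b) (g := fun _ => 0)
      (hgeo.mul_left 2) (fun n => ?_) (.of_forall fun M n => ?_)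
    · simpa using this
    · have h1 := (tendsto_iff_norm_sub_tendsto_zero.1
        (tendsto_compContinuousLinearMap_trunc (taylorZero F n))).mul_const ((2 : ℝ) ^ n)
      rw [zero_mul] at h1
      exact squeeze_zero (fun M => hb0 M n) (fun M => min_le_right _ _) h1
    · rw [Real.norm_of_nonneg (hb0 M n)]
      exact min_le_left _ _
  obtain ⟨M, hM⟩ := (hlim.eventually (gt_mem_nhds hε)).exists
  refine ⟨M, fun x hx => lt_of_le_of_lt ?_ hM⟩
  have hx' := trunc_mem_polydisc M hx
  change ‖∑' n, taylorZero F n (fun _ => trunc M x) - ∑' n, taylorZero F n (fun _ => x)‖ ≤ _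
  rw [← (hsum _ hx').tsum_sub (hsum _ hx)]
  refine tsum_of_norm_bounded (hbsum M).hasSum fun n => le_min ?_ ?_
  · refine (norm_sub_le _ _).trans ?_
    linarith [hterm n x hx, hterm n _ hx']
  · have hx2 : ‖x‖ ≤ 2 := norm_le_of_coord_of_dropCoord hx.1.le (hx.2.le.trans (by norm_num))
    refine (((taylorZero F n).compContinuousLinearMap (fun _ => trunc M) -
      taylorZero F n).le_opNorm fun _ => x).trans ?_
    refine mul_le_mul_of_nonneg_left ?_ (norm_nonneg _)
    simpa using pow_le_pow_left₀ (norm_nonneg x) hx2 n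

variable (E) in
/-- The ball of `c₀''` about the `k`-th spike point. -/
def bidualBall (k : ℕ) : Set (StrongDual ℂ (StrongDual ℂ E)) :=
  ball (NormedSpace.inclusionInDoubleDual ℂ E (spikePoint k)) (1 / 8)

variable {k : ℕ} {w z : StrongDual ℂ (StrongDual ℂ E)}

/-- The constants fit exactly in the small coordinates: `1/8 + 1/8 = 1/4`; in the `k`-th, `3/2 + 1/8
+ 1/8 ≤ 2`. -/
theorem ball_bidualTrunc_subset (hw : w ∈ bidualBall E k) (N : ℕ) :
    ball (bidualTrunc N w) (1 / 8) ⊆ polydisc k 2 (1 / 4) := by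
  have hcoord : ∀ j, ‖w (coord j) - coord j (spikePoint k : E)‖ ≤ 1 / 8 := fun j => by
    have h1 := norm_apply_coord_le (w - NormedSpace.inclusionInDoubleDual ℂ E (spikePoint k)) j
    exact h1.trans ((mem_ball_iff_norm (E := StrongDual ℂ (StrongDual ℂ E))).1 hw).le
  refine ball_subset_polydisc ?_ ?_
  · rw [coord_bidualTrunc]
    have h1 := hcoord k
    rw [coord_spikePoint, if_pos rfl] at h1
    split_ifs
    · have h2 := norm_add_le (w (coord k) - 3 / 2) (3 / 2)
      rw [sub_add_cancel] at h2
      have h3 : ‖(3 : ℂ) / 2‖ = 3 / 2 := by simp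
      linarith
    · norm_num
  · have h1 : ‖dropCoord k (bidualTrunc N w)‖ ≤ 1 / 8 := (norm_le_iff (by norm_num)).2 fun j => by
      rw [coord_dropCoord, coord_bidualTrunc]
      split_ifs with h2 h3
      · norm_num
      · have := hcoord j
        rwa [coord_spikePoint, if_neg h2, sub_zero] at this
      · norm_num
    linarith

theorem bidualTrunc_mem_polydisc (hw : w ∈ bidualBall E k) (N : ℕ) :
    bidualTrunc N w ∈ polydisc k 2 (1 / 4) :=
  ball_bidualTrunc_subset hw N (mem_ball_self (by norm_num))

theorem bidualTrunc_mem_hullUnion (hw : w ∈ bidualBall E k) (N : ℕ) :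
    bidualTrunc N w ∈ hullUnion (spikedBall E) :=
  polydisc_subset_hullUnion k (bidualTrunc_mem_polydisc hw N)

/-- The value at `w ∈ c₀''` of the extension of `f`. -/
def bidualEval (w : StrongDual ℂ (StrongDual ℂ E)) (f : Hb (Subtype.val : spikedBall E → E)) : ℂ :=
  limUnder atTop fun N => hullExt f (bidualTrunc N w)

/-- All later truncations of `w` have the same `M`-th truncation, so uniform approximation by
truncation on the polydisc makes the values a Cauchy sequence. -/
theorem tendsto_bidualEval (hw : w ∈ bidualBall E k) (f : Hb (Subtype.val : spikedBall E → E)) :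
    Tendsto (fun N => hullExt f (bidualTrunc N w)) atTop (𝓝 (bidualEval w f)) := by
  refine CauchySeq.tendsto_limUnder (Metric.cauchySeq_iff'.2 fun ε hε => ?_)
  obtain ⟨M, hM⟩ := exists_norm_hullExt_trunc_sub_lt k f hε
  refine ⟨M, fun N hN => ?_⟩
  have := hM _ (bidualTrunc_mem_polydisc hw N)
  rwa [trunc_bidualTrunc hN, ← dist_eq_norm, dist_comm] at this

/-- By the identity theorem any analytic continuation to the hulls may replace `hullExt f`. The
algebraic identities and all explicit values of `bidualEval` follow from this. -/
theorem bidualEval_eq_of_eqOn (hw : w ∈ bidualBall E k) (f : Hb (Subtype.val : spikedBall E → E))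
    {G : E → ℂ} (hG : ∀ x ∈ hullUnion (spikedBall E), AnalyticAt ℂ G x)
    (h : ∀ x : spikedBall E, G x = (f : spikedBall E → ℂ) x) {c : ℂ}
    (hc : Tendsto (fun N => G (bidualTrunc N w)) atTop (𝓝 c)) : bidualEval w f = c :=
  tendsto_nhds_unique ((tendsto_bidualEval hw f).congr fun N =>
    hullExt_eqOn isOpen_spikedBall balanced_spikedBall nonempty_spikedBall f hG h
      (bidualTrunc_mem_hullUnion hw N)) hc

theorem analyticAt_hullExt_spikedBall (f : Hb (Subtype.val : spikedBall E → E)) :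
    ∀ x ∈ hullUnion (spikedBall E), AnalyticAt ℂ (hullExt f) x :=
  analyticAt_hullExt isOpen_spikedBall balanced_spikedBall nonempty_spikedBall f

theorem hullExt_spikedBall_apply (f : Hb (Subtype.val : spikedBall E → E)) (x : spikedBall E) :
    hullExt f x = (f : spikedBall E → ℂ) x :=
  hullExt_apply isOpen_spikedBall balanced_spikedBall f x

/-- The homomorphism `f ↦ f̃(w)` for `w ∈ c₀''` near a spike point. -/
def bidualEvalHom (w : StrongDual ℂ (StrongDual ℂ E)) (hw : w ∈ bidualBall E k) :
    Hb (Subtype.val : spikedBall E → E) →ₐ[ℂ] ℂ where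
  toFun := bidualEval w
  map_one' := bidualEval_eq_of_eqOn hw 1 (G := fun _ => 1) (fun _ _ => analyticAt_const)
    (fun _ => rfl) tendsto_const_nhds
  map_mul' f g := bidualEval_eq_of_eqOn hw (f * g) (G := fun x => hullExt f x * hullExt g x)
    (fun x hx => (analyticAt_hullExt_spikedBall f x hx).mul (analyticAt_hullExt_spikedBall g x hx))
    (fun x => by rw [hullExt_spikedBall_apply, hullExt_spikedBall_apply]; rfl)
    ((tendsto_bidualEval hw f).mul (tendsto_bidualEval hw g))
  map_zero' := bidualEval_eq_of_eqOn hw 0 (G := fun _ => 0) (fun _ _ => analyticAt_const)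
    (fun _ => rfl) tendsto_const_nhds
  map_add' f g := bidualEval_eq_of_eqOn hw (f + g) (G := fun x => hullExt f x + hullExt g x)
    (fun x hx => (analyticAt_hullExt_spikedBall f x hx).add (analyticAt_hullExt_spikedBall g x hx))
    (fun x => by rw [hullExt_spikedBall_apply, hullExt_spikedBall_apply]; rfl)
    ((tendsto_bidualEval hw f).add (tendsto_bidualEval hw g))
  commutes' c := bidualEval_eq_of_eqOn hw (algebraMap ℂ _ c) (G := fun _ => c)
    (fun _ _ => analyticAt_const) (fun _ => rfl) tendsto_const_nhds

theorem norm_bidualEval_le (hw : w ∈ bidualBall E k) {C : ℝ} (hC0 : 0 ≤ C)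
    (f : Hb (Subtype.val : spikedBall E → E))
    (hC : ∀ u : spikedBall E, (u : E) ∈ exhaustion (spikedBall E) (2 * spikeIndex k) →
      ‖(f : spikedBall E → ℂ) u‖ ≤ C) :
    ‖bidualEval w f‖ ≤ C * (1 - hullRatio (spikeIndex k))⁻¹ :=
  le_of_tendsto (tendsto_bidualEval hw f).norm (.of_forall fun N =>
    norm_hullExt_le isOpen_spikedBall balanced_spikedBall nonempty_spikedBall f
      (one_le_spikeIndex k) hC0 hC (polydisc_subset_polyHull k (bidualTrunc_mem_polydisc hw N)))

theorem continuous_of_norm_le {U : Set E} {A : Set U} (hA : IsDomainBounded Subtype.val A)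
    (φ : Hb (Subtype.val : U → E) →ₐ[ℂ] ℂ) {K : ℝ} (hK : 0 < K)
    (h : ∀ (C : ℝ) (f : Hb (Subtype.val : U → E)), 0 ≤ C → (∀ u ∈ A, ‖(f : U → ℂ) u‖ ≤ C) →
      ‖φ f‖ ≤ C * K) : Continuous[hbTopology Subtype.val, inferInstance] φ := by
  let _ : TopologicalSpace (Hb (Subtype.val : U → E)) := hbTopology Subtype.val
  refine continuous_iff_continuousAt.2 fun f₀ => Metric.tendsto_nhds.2 fun ε hε => ?_
  have h1 : Tendsto (fun f : Hb (Subtype.val : U → E) =>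
      UniformOnFun.ofFun {A : Set U | IsDomainBounded Subtype.val A} (f : U → ℂ)) (𝓝 f₀)
      (𝓝 (UniformOnFun.ofFun _ (f₀ : U → ℂ))) := continuous_induced_dom.tendsto f₀
  have h2 := UniformOnFun.tendsto_iff_tendstoUniformlyOn.1 h1 A hA
  filter_upwards [Metric.tendstoUniformlyOn_iff.1 h2 (ε / (2 * K)) (by positivity)] with f hf
  have h3 := h (ε / (2 * K)) (f - f₀) (by positivity) fun u hu => by
    have := (hf u hu).le
    rw [dist_comm, dist_eq_norm] at this
    exact this
  rw [dist_eq_norm, ← map_sub]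
  refine h3.trans_lt ?_
  have : ε / (2 * K) * K = ε / 2 := by field_simp
  linarith

/-- The point of the spectrum given by `w ∈ c₀''` near a spike point. -/
def bidualPoint (w : StrongDual ℂ (StrongDual ℂ E)) (hw : w ∈ bidualBall E k) :
    Spectrum (spikedBall E) where
  toAlgHom := bidualEvalHom w hw
  continuous := by
    have hm := one_le_spikeIndex k
    refine continuous_of_norm_le (isDomainBounded_exhaustion isOpen_spikedBall
      (m := 2 * spikeIndex k) (by omega)) _ (K := (1 - hullRatio (spikeIndex k))⁻¹)
      (inv_pos.2 (sub_pos.2 (hullRatio_lt_one hm))) fun C f hC0 hC => ?_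
    exact norm_bidualEval_le hw hC0 f hC

theorem proj_bidualPoint (hw : w ∈ bidualBall E k) : proj _ (bidualPoint w hw) = w := by
  ext γ
  exact bidualEval_eq_of_eqOn hw _ (G := γ) (fun x _ => γ.analyticAt x) (fun _ => rfl)
    (tendsto_apply_bidualTrunc w γ)

/-! ### Translates of these points -/

/-- The `n`-th term of the translation by `z`. -/
def translateTerm (F : E → ℂ) (z : StrongDual ℂ (StrongDual ℂ E)) (n : ℕ) (x : E) : ℂ :=
  (n.factorial : ℂ)⁻¹ * aronBerner n (fun _ => z) (iteratedFDeriv ℂ n F x)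

theorem analyticAt_translateTerm {F : E → ℂ} {x : E} (hF : AnalyticAt ℂ F x) (n : ℕ) :
    AnalyticAt ℂ (translateTerm F z n) x := by
  have h : AnalyticAt ℂ (iteratedFDeriv ℂ n F) x :=
    AnalyticOnNhd.iteratedFDeriv (s := {x}) (fun y hy => hy ▸ hF) n x rfl
  exact analyticAt_const.mul (((aronBerner n fun _ => z).analyticAt _).comp h)

theorem translateTerm_congr {F G : E → ℂ} {x : E} (h : F =ᶠ[𝓝 x] G) (n : ℕ) :
    translateTerm F z n x = translateTerm G z n x := by
  rw [translateTerm, translateTerm, (h.iteratedFDeriv ℂ n).eq_of_nhds]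

theorem translateTerm_hullExt (f : Hb (Subtype.val : spikedBall E → E)) (n : ℕ) {x : E}
    (hx : x ∈ spikedBall E) :
    translateTerm (hullExt f) z n x = translateTerm (zeroExt (f : spikedBall E → ℂ)) z n x := by
  refine translateTerm_congr ?_ n
  filter_upwards [isOpen_spikedBall.mem_nhds hx] with y hy
  rw [hullExt_spikedBall_apply f ⟨y, hy⟩]
  exact (zeroExt_apply (f : spikedBall E → ℂ) ⟨y, hy⟩).symm

variable (z) in
theorem translateTerm_mem_Hb (f : Hb (Subtype.val : spikedBall E → E)) (n : ℕ) :
    translateTerm (zeroExt (f : spikedBall E → ℂ)) z n ∘ Subtype.val ∈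
      Hb (Subtype.val : spikedBall E → E) := by
  have hFa := Hb.analyticAt_zeroExt isOpen_spikedBall f
  refine mem_Hb_comp_subtypeVal isOpen_spikedBall
    (fun x hx => analyticAt_translateTerm (hFa x hx) n) fun m hm => ?_
  have hm1 : (1 : ℝ) ≤ m := by exact_mod_cast hm
  obtain ⟨C, hC⟩ := Hb.exists_norm_zeroExt_le isOpen_spikedBall f (m := 2 * m) (by omega)
  refine ⟨‖(n.factorial : ℂ)⁻¹‖ * (‖aronBerner n fun _ : Fin n => z‖ *
    (C * (2 * (n + 1) / (1 / (2 * m))) ^ n)), fun x hx => ?_⟩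
  rw [mem_exhaustion_iff hm] at hx
  rw [translateTerm, norm_mul]
  refine mul_le_mul_of_nonneg_left (((aronBerner n fun _ => z).le_opNorm _).trans
    (mul_le_mul_of_nonneg_left ?_ (norm_nonneg _))) (norm_nonneg _)
  refine norm_iteratedFDeriv_le_of_ball (by positivity) n fun y hy => ?_
  have hhalf : 1 / (2 * (m : ℝ)) + 1 / (2 * m) = 1 / m := by
    field_simp
    norm_num
  have hpos : 0 < 1 / (2 * (m : ℝ)) := by positivity
  have hle : 1 / (2 * (m : ℝ)) ≤ m := by
    rw [div_le_iff₀ (by positivity)]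
    nlinarith
  have hy' : y ∈ exhaustion (spikedBall E) (2 * m) := by
    rw [mem_exhaustion_iff (by omega)]
    push_cast
    rw [mem_ball, dist_eq_norm] at hy
    refine ⟨?_, fun v hv => hx.2 ?_⟩
    · have := norm_add_le (y - x) x
      rw [sub_add_cancel] at this
      linarith [hx.1]
    · rw [mem_ball, dist_eq_norm] at hv ⊢
      have := norm_add_le (v - y) (y - x)
      rw [sub_add_sub_cancel] at this
      linarith
  exact ⟨hFa y (exhaustion_subset _ hy'), hC y hy'⟩

/-- `hullExt f ∘ trunc M` depends on the first `M` coordinates only, so its derivatives at the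
truncations of `w` are constant from `M` on. Cauchy's estimate on balls of radius `1 / 8` transfers
uniform closeness of the functions to their derivatives. -/
theorem cauchySeq_iteratedFDeriv_hullExt (hw : w ∈ bidualBall E k)
    (f : Hb (Subtype.val : spikedBall E → E)) (n : ℕ) :
    CauchySeq fun N => iteratedFDeriv ℂ n (hullExt f) (bidualTrunc N w) := by
  have ha := analyticAt_hullExt_spikedBall f
  refine Metric.cauchySeq_iff'.2 fun ε hε => ?_
  set c : ℝ := (2 * (n + 1) / (1 / 8)) ^ n with hc
  have hc0 : 0 < c := by positivity
  obtain ⟨M, hM⟩ := exists_norm_hullExt_trunc_sub_lt k f (ε := ε / (4 * c)) (by positivity)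
  have hta : ∀ x ∈ polydisc k 2 (1 / 4), AnalyticAt ℂ (hullExt f ∘ trunc M) x := fun x hx =>
    (ha _ (polydisc_subset_hullUnion k (trunc_mem_polydisc M hx))).comp ((trunc M).analyticAt x)
  have hdiff : ∀ N, ‖iteratedFDeriv ℂ n (hullExt f ∘ trunc M) (bidualTrunc N w) -
      iteratedFDeriv ℂ n (hullExt f) (bidualTrunc N w)‖ ≤ ε / 4 := fun N => by
    have hmem := bidualTrunc_mem_polydisc hw N
    have h1 := norm_iteratedFDeriv_le_of_ball (f := hullExt f ∘ trunc M - hullExt f)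
      (C := ε / (4 * c)) (ρ := 1 / 8) (by norm_num) n (x := bidualTrunc N w) fun y hy => by
        have hy' := ball_bidualTrunc_subset hw N hy
        exact ⟨(hta y hy').sub (ha y (polydisc_subset_hullUnion k hy')), (hM y hy').le⟩
    rw [iteratedFDeriv_sub_apply (hta _ hmem).contDiffAt
      (ha _ (polydisc_subset_hullUnion k hmem)).contDiffAt] at h1
    refine h1.trans (le_of_eq ?_)
    rw [← hc]
    field_simp
  have hconst : ∀ N, M ≤ N → iteratedFDeriv ℂ n (hullExt f ∘ trunc M) (bidualTrunc N w) =
      iteratedFDeriv ℂ n (hullExt f ∘ trunc M) (bidualTrunc M w) := fun N hN => by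
    have h1 : ∀ L, M ≤ L → (fun v => (hullExt f ∘ trunc M) (bidualTrunc L w + v)) =
        fun v => hullExt f (bidualTrunc M w + trunc M v) := fun L hL => by
      funext v
      rw [Function.comp_apply, map_add, trunc_bidualTrunc hL]
    have h2 := iteratedFDeriv_comp_add_left (𝕜 := ℂ) (f := hullExt f ∘ trunc M) n (bidualTrunc N w) 0
    have h3 := iteratedFDeriv_comp_add_left (𝕜 := ℂ) (f := hullExt f ∘ trunc M) n (bidualTrunc M w) 0
    rw [h1 N hN, add_zero] at h2
    rw [h1 M le_rfl, add_zero] at h3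
    rw [← h2, ← h3]
  refine ⟨M, fun N hN => ?_⟩
  have h1 := hdiff N
  have h2 := hdiff M
  rw [hconst N hN] at h1
  rw [norm_sub_rev] at h1
  rw [dist_eq_norm]
  have h3 := norm_add_le
    (iteratedFDeriv ℂ n (hullExt f) (bidualTrunc N w) -
      iteratedFDeriv ℂ n (hullExt f ∘ trunc M) (bidualTrunc M w))
    (iteratedFDeriv ℂ n (hullExt f ∘ trunc M) (bidualTrunc M w) -
      iteratedFDeriv ℂ n (hullExt f) (bidualTrunc M w))
  rw [sub_add_sub_cancel] at h3
  linarith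

/-- The Taylor expansion of `f` at a point of the bidual. -/
theorem hasSum_bidualEval_translate (hw : w ∈ bidualBall E k) (hwz : w + z ∈ bidualBall E k)
    (hz : ‖z‖ < 1 / 16) (f : Hb (Subtype.val : spikedBall E → E))
    {P : ℕ → Hb (Subtype.val : spikedBall E → E)}
    (hP : ∀ (n : ℕ) (x : spikedBall E),
      (P n : spikedBall E → ℂ) x = translateTerm (zeroExt (f : spikedBall E → ℂ)) z n x) :
    HasSum (fun n => bidualEval w (P n)) (bidualEval (w + z) f) := by
  have ha := analyticAt_hullExt_spikedBall f
  obtain ⟨C, hC⟩ := exists_norm_hullExt_le_of_polydisc k f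
  let t : ℕ → ℕ → ℂ := fun N n => (n.factorial : ℂ)⁻¹ *
    iteratedFDeriv ℂ n (hullExt f) (bidualTrunc N w) fun _ => bidualTrunc N z
  -- The bound `‖z‖ < 1 / 16` leaves room for the disc of radius `2`, whose Cauchy estimates give
  -- the factor `(1 / 2) ^ n` uniformly in `N`.
  have hball : ∀ N (ζ : ℂ), ‖ζ‖ ≤ 2 →
      bidualTrunc N w + ζ • bidualTrunc N z ∈ polydisc k 2 (1 / 4) := fun N ζ hζ => by
    refine ball_bidualTrunc_subset hw N ?_
    rw [mem_ball, dist_eq_norm, add_sub_cancel_left, norm_smul]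
    have h1 := norm_bidualTrunc_le N z
    nlinarith [norm_nonneg ζ, norm_nonneg (bidualTrunc N z)]
  have hd : ∀ N (ζ : ℂ), ‖ζ‖ ≤ 2 → DifferentiableAt ℂ
      (fun ζ : ℂ => hullExt f (bidualTrunc N w + ζ • bidualTrunc N z)) ζ := fun N ζ hζ =>
    (ha _ (polydisc_subset_hullUnion k (hball N ζ hζ))).differentiableAt.comp ζ (by fun_prop)
  have hsum : ∀ N, HasSum (t N) (hullExt f (bidualTrunc N (w + z))) := fun N => by
    rw [bidualTrunc_add]
    exact hasSum_taylor_line (ha _ (bidualTrunc_mem_hullUnion hw N)) _ one_lt_two fun ζ hζ =>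
      (hd N ζ (by simpa using (mem_ball.1 hζ).le)).differentiableWithinAt
  have ht : ∀ N n, ‖t N n‖ ≤ C * (1 / 2) ^ n := fun N n => by
    have h1 := norm_taylor_line_le (ha _ (bidualTrunc_mem_hullUnion hw N)) (bidualTrunc N z)
      two_pos (DifferentiableOn.diffContOnCl fun ζ hζ => (hd N ζ (by
        rw [closure_ball _ two_ne_zero] at hζ
        simpa using hζ)).differentiableWithinAt)
      (fun ζ hζ => hC _ (hball N ζ hζ.le)) n
    exact h1.trans_eq (by rw [one_div, inv_pow, div_eq_mul_inv])
  have hgeo : Summable fun n : ℕ => C * (1 / 2 : ℝ) ^ n :=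
    (summable_geometric_of_lt_one (by norm_num) (by norm_num)).mul_left C
  have hlim : ∀ n, Tendsto (fun N => t N n) atTop (𝓝 (bidualEval w (P n))) := fun n => by
    obtain ⟨T, hT⟩ := cauchySeq_tendsto_of_complete (cauchySeq_iteratedFDeriv_hullExt hw f n)
    have h1 : bidualEval w (P n) = (n.factorial : ℂ)⁻¹ * aronBerner n (fun _ => z) T :=
      bidualEval_eq_of_eqOn hw (P n) (G := translateTerm (hullExt f) z n)
        (fun x hx => analyticAt_translateTerm (ha x hx) n)
        (fun x => (translateTerm_hullExt f n x.2).trans (hP n x).symm)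
        ((((aronBerner n fun _ => z).continuous.tendsto T).comp hT).const_mul _)
    rw [h1]
    exact (tendsto_apply_bidualTrunc_aronBerner z hT).const_mul _
  -- Taylor's formula holds in c₀ at each truncation; dominated convergence carries it to the
  -- bidual.
  have h1 := tendsto_tsum_of_dominated_convergence (𝓕 := atTop) hgeo hlim
    (.of_forall fun N n => ht N n)
  have h2 : bidualEval (w + z) f = ∑' n, bidualEval w (P n) :=
    tendsto_nhds_unique (tendsto_bidualEval hwz f) (h1.congr fun N => (hsum N).tsum_eq)
  rw [h2]
  exact (Summable.of_norm_bounded hgeo fun n =>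
    le_of_tendsto (hlim n).norm (.of_forall fun N => ht N n)).hasSum

theorem isTranslate_bidualPoint (hw : w ∈ bidualBall E k) (hwz : w + z ∈ bidualBall E k)
    (hz : ‖z‖ < 1 / 16) : IsTranslate z (bidualPoint w hw) (bidualPoint (w + z) hwz) := fun f =>
  ⟨fun n => ⟨_, translateTerm_mem_Hb z f n⟩, fun _ _ => rfl,
    hasSum_bidualEval_translate hw hwz hz f fun _ _ => rfl⟩

/-- Sums are unique, so a small translate of an evaluation can only be the evaluation at the shifted
point. Hence the section is open. -/
theorem IsTranslate.eq_bidualPoint (hw : w ∈ bidualBall E k) (hwz : w + z ∈ bidualBall E k)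
    (hz : ‖z‖ < 1 / 16) {ψ : Spectrum (spikedBall E)} (h : IsTranslate z (bidualPoint w hw) ψ) :
    ψ = bidualPoint (w + z) hwz := by
  obtain ⟨a, ha⟩ := ψ
  have : a = bidualEvalHom (w + z) hwz := AlgHom.ext fun f => by
    obtain ⟨P, hP, hsum⟩ := h f
    exact hsum.unique (hasSum_bidualEval_translate hw hwz hz f hP)
  subst this
  rfl

variable (k) in
/-- The section of the projection of the spectrum over the ball about a spike point. -/
def bidualSection (w : bidualBall E k) : Spectrum (spikedBall E) := bidualPoint w.1 w.2

theorem isOpen_bidualSection_image {O : Set (StrongDual ℂ (StrongDual ℂ E))} (hO : IsOpen O) :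
    IsOpen (bidualSection k '' (Subtype.val ⁻¹' O) : Set (Spectrum (spikedBall E))) := by
  rintro _ ⟨⟨w, hw⟩, hwO, rfl⟩
  obtain ⟨ε, hε, h⟩ := exists_add_mem_of_isOpen (G := StrongDual ℂ (StrongDual ℂ E))
    (hO.inter (isOpen_ball (α := StrongDual ℂ (StrongDual ℂ E)))) (w := w)
    (Set.mem_inter hwO hw)
  refine ⟨min ε (1 / 16), by positivity, fun z hz ψ hψ => ?_⟩
  have hmem := h z (hz.trans_le (min_le_left _ _))
  exact ⟨⟨w + z, hmem.2⟩, hmem.1,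
    (hψ.eq_bidualPoint hw hmem.2 (hz.trans_le (min_le_right _ _))).symm⟩

theorem isOpen_range_bidualSection :
    IsOpen (Set.range (bidualSection k : bidualBall E k → Spectrum (spikedBall E))) := by
  have := isOpen_bidualSection_image (E := E) (k := k) isOpen_univ
  rwa [Set.preimage_univ, Set.image_univ] at this

theorem continuous_bidualSection :
    Continuous (bidualSection k : bidualBall E k → Spectrum (spikedBall E)) := by
  refine continuous_def.2 fun T hT =>
    isOpen_of_forall_norm_sub_lt (G := StrongDual ℂ (StrongDual ℂ E)) fun w hw => ?_
  obtain ⟨ε, hε, h⟩ := (show ∀ φ ∈ T, ∃ ε > 0, ∀ z : StrongDual ℂ (StrongDual ℂ E), ‖z‖ < ε →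
    ∀ ψ : Spectrum (spikedBall E), IsTranslate z φ ψ → ψ ∈ T from hT) _ hw
  refine ⟨min ε (1 / 16), by positivity, fun w' hw' => ?_⟩
  have hadd : (w : StrongDual ℂ (StrongDual ℂ E)) + (w' - w) = w' := by
    ext γ
    exact add_sub_cancel (w.1 γ) (w'.1 γ)
  have hmem : (w : StrongDual ℂ (StrongDual ℂ E)) + (w' - w) ∈ bidualBall E k := by
    rw [hadd]
    exact w'.2
  have h1 := h _ (hw'.trans_le (min_le_left _ _)) _
    (isTranslate_bidualPoint w.2 hmem (hw'.trans_le (min_le_right _ _)))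
  simp only [hadd] at h1
  exact h1

theorem continuousOn_proj :
    ContinuousOn (proj (spikedBall E))
      (Set.range (bidualSection k : bidualBall E k → Spectrum (spikedBall E))) := by
  refine (continuousOn_open_iff isOpen_range_bidualSection).2 fun O hO => ?_
  convert isOpen_bidualSection_image (E := E) (k := k) hO using 1
  ext φ
  constructor
  · rintro ⟨⟨w, rfl⟩, hφ⟩
    refine ⟨w, ?_, rfl⟩
    rwa [Set.mem_preimage, bidualSection, proj_bidualPoint] at hφ
  · rintro ⟨w, hw, rfl⟩
    refine ⟨⟨w, rfl⟩, ?_⟩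
    rwa [Set.mem_preimage, bidualSection, proj_bidualPoint]

/-- The section lives over a ball of radius `1 / 8` for every `k`, so the evaluations at the spike
points form a domain-bounded family. -/
theorem ofReal_le_distTo_bidualPoint
    (hw : NormedSpace.inclusionInDoubleDual ℂ E (spikePoint k) ∈ bidualBall E k) :
    ENNReal.ofReal (1 / 8) ≤ distTo (proj (spikedBall E)) (bidualPoint _ hw) := by
  have hb : ball (proj (spikedBall E) (bidualPoint _ hw)) (1 / 8) = bidualBall E k := by
    rw [proj_bidualPoint, bidualBall]
  have hr : Set.range (fun w : ball (proj (spikedBall E) (bidualPoint _ hw)) (1 / 8) =>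
      bidualSection k ⟨w.1, hb ▸ w.2⟩) = Set.range (bidualSection k) :=
    (Function.Surjective.range_comp (f := fun w : ball (proj (spikedBall E)
      (bidualPoint _ hw)) (1 / 8) => (⟨w.1, hb ▸ w.2⟩ : bidualBall E k))
      (fun w => ⟨⟨w.1, hb.symm ▸ w.2⟩, rfl⟩) (bidualSection k))
  refine ofReal_le_distTo (by norm_num) (fun w => bidualSection k ⟨w.1, hb ▸ w.2⟩)
    (continuous_bidualSection.comp (continuous_subtype_val.subtype_mk _))
    (fun w => proj_bidualPoint _) ?_ ?_ ?_
  · rw [hr]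
    exact isOpen_range_bidualSection
  · rw [hr]
    exact continuousOn_proj
  · simp only [proj_bidualPoint]
    rfl

theorem not_isBoundedType_gelfand_diagonalHb :
    ¬ IsBoundedType (proj (spikedBall E)) (gelfand (diagonalHb E)) := by
  intro h
  have hmem : ∀ k, NormedSpace.inclusionInDoubleDual ℂ E (spikePoint k) ∈ bidualBall E k :=
    fun k => mem_ball_self (by norm_num)
  let φ : ℕ → Spectrum (spikedBall E) := fun k => bidualPoint _ (hmem k)
  have hA : IsDomainBounded (proj (spikedBall E)) (Set.range φ) := by
    refine ⟨isBounded_iff_forall_norm_le.2 ⟨3 / 2, ?_⟩, ?_⟩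
    · rintro _ ⟨_, ⟨k, rfl⟩, rfl⟩
      rw [proj_bidualPoint]
      exact (NormedSpace.double_dual_bound ℂ E _).trans (norm_spikePoint_le k)
    · refine lt_of_lt_of_le (ENNReal.ofReal_pos.2 (show (0 : ℝ) < 1 / 8 by norm_num))
        (le_iInf₂ ?_)
      rintro _ ⟨k, rfl⟩
      exact ofReal_le_distTo_bidualPoint (hmem k)
  obtain ⟨C, hC⟩ := isBounded_iff_forall_norm_le.1 (h _ hA)
  obtain ⟨k, hk⟩ := not_bddAbove_pow C
  have h1 := hC _ ⟨φ k, ⟨k, rfl⟩, rfl⟩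
  have h2 : gelfand (diagonalHb E) (φ k) = (3 / 2) ^ (k + 1) := by
    rw [← diagonalSeries_spikePoint (E := E) k]
    refine bidualEval_eq_of_eqOn (hmem k) (diagonalHb E) (G := diagonalSeries)
      (fun x _ => analyticAt_diagonalSeries x) (fun _ => rfl) ?_
    refine ((analyticAt_diagonalSeries (spikePoint k : E)).continuousAt.tendsto.comp
      (tendsto_trunc _)).congr fun N => ?_
    rw [Function.comp_apply, trunc_eq_sum]
    rfl
  rw [h2] at h1
  linarith

end SpectrumPoints

end BoundedType

end

theorem mainTheorem4 :
    ∃ U : Set C₀(ℕ, ℂ), IsOpen U ∧ Balanced ℂ U ∧ IsOpen (BoundedType.hullUnion U) ∧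
      ∃ hU : U ⊆ BoundedType.hullUnion U,
        -- the inclusion `U ↪ Û_𝒫` is the `H_b`-envelope of `U`
        BoundedType.IsHbEnvelope.{0, 0, 0, u} (Subtype.val : U → C₀(ℕ, ℂ))
          (Subtype.val : BoundedType.hullUnion U → C₀(ℕ, ℂ)) (Set.inclusion hU) ∧
        ∃ g : BoundedType.Hb (Subtype.val : U → C₀(ℕ, ℂ)),
          -- the holomorphic extension of `g` to the envelope is not of bounded type
          (∃ g' : BoundedType.hullUnion U → ℂ,
            BoundedType.IsHolomorphic Subtype.val g' ∧ g' ∘ Set.inclusion hU = g ∧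
              ¬ BoundedType.IsBoundedType Subtype.val g') ∧
          -- the canonical extension of `g` to the spectrum is not of bounded type
          ¬ BoundedType.IsBoundedType (BoundedType.proj U) (BoundedType.gelfand g) ∧
          -- `U` has no `H_b`-`H_b`-envelope
          ¬ ∃ (Y : Type v) (_ : TopologicalSpace Y) (q : Y → C₀(ℕ, ℂ)) (τ : U → Y),
            BoundedType.IsHbHbEnvelope.{0, 0, v, w} (Subtype.val : U → C₀(ℕ, ℂ)) q τ := by
  open BoundedType in
  exact ⟨spikedBall C₀(ℕ, ℂ), isOpen_spikedBall, balanced_spikedBall,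
    isOpen_hullUnion, subset_hullUnion isOpen_spikedBall,
    isHbEnvelope_hullUnion isOpen_spikedBall balanced_spikedBall nonempty_spikedBall,
    diagonalHb C₀(ℕ, ℂ),
    -- `g` is the restriction of a function analytic on all of c₀, so that function also gives its
    -- extension to the envelope.
    ⟨diagonalSeries ∘ Subtype.val,
      isHolomorphic_comp_subtypeVal fun x _ => analyticAt_diagonalSeries x, rfl,
      not_isBoundedType_diagonalSeries⟩,
    not_isBoundedType_gelfand_diagonalHb, not_exists_isHbHbEnvelope_spikedBall⟩
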